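/- **Theorem 5.1 (conditional DMV–strong uniqueness, bounded DMV solutions).** *Setting.* Let $T>0$ and let $\Omega\subset\mathbb R^3$ be a bounded domain with smooth boundary and outer unit normal $\mathbf n$. Let $\partial\Omega=\Gamma^\vartheta_D\cup\Gamma^\vartheta_N=\Gamma^{\mathbf B}_D\cup\Gamma^{\mathbf B}_N$ with all four sets compact, $\Gamma^\vartheta_D\cap\Gamma^\vartheta_N=\emptyset=\Gamma^{\mathbf B}_D\cap\Gamma^{\mathbf B}_N$ and $\Gamma_D^\vartheta\ne\emptyset$. Let $\vartheta_B\in C^{1,2}([0,T]\times\overline\Omega)$, $\vartheta_B>0$, and let $\mathbf b_\tau=\mathbf B_B\times\mathbf n|_{\Gamma_D^{\mathbf B}}$, $b_\nu=\mathbf B_B\cdot\mathbf n|_{\Gamma_N^{\mathbf B}}$ for some $C^1$ field $\mathbf B_B=\mathbf B_B(x)$ with ${\rm div}\,\mathbf B_B=0$, ${\bf curl}\,\mathbf B_B=0$ in $\Omega$. Here $C^{1,2}$ means that $\partial_t f,\nabla_xf,\nabla_x^2f$ are continuous on $[0,T]\times\overline\Omega$. *Constitutive functions.* Let $\mu,\eta,\kappa,\zeta$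 be continuously differentiable functions of $(\varrho,\vartheta)\in(0,\infty)^2$ with $\mu>0$, $\eta\ge0$, $\kappa>0$, $\zeta>0$. Let $p,e,s$ be continuously differentiable on $(0,\infty)^2$, the first partial derivatives of $p$ and $s$ being locally Lipschitz continuous, with Gibbs' equation $\vartheta Ds=De+pD(1/\varrho)$ and thermodynamic stability $\partial_\varrho p>0$, $\partial_\vartheta e>0$. Put $\mathbb D(\mathbf u)=\frac12(\nabla\mathbf u+\nabla^t\mathbf u)$, $\mathbb S(\varrho,\vartheta,\mathbb D)=\mu(\varrho,\vartheta)\big(2\mathbb D-\frac13{\rm Tr}(\mathbb D)\mathbb I\big)+\frac{\eta(\varrho,\vartheta)}3{\rm Tr}(\mathbb D)\mathbb I$ and $\mathbf q(\varrho,\vartheta,\nabla\vartheta)=-\kappa(\varrho,\vartheta)\nabla\vartheta$. *Strong solution.* Let $\varrho_0,\vartheta_0>0$, $\mathbf u_0$, $\mathbf B_0$ with ${\rm div}\,\mathbf B_0=0$ be given on $\Omega$. A strong solution is $(r,\Theta,\mathbf U,\mathbf H)$ with $r\in C^1([0,T]\times\overline\Omega)$, $\Theta,\mathbf U,\mathbf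 H\in C^{1,2}([0,T]\times\overline\Omega)$, $r,\Theta>0$ on $[0,T]\times\overline\Omega$, which equals $(\varrho_0,\vartheta_0,\mathbf u_0,\mathbf B_0)$ at $t=0$ and satisfies pointwise in $(0,T)\times\Omega$ $$\partial_tr+{\rm div}(r\mathbf U)=0,$$ $$\partial_t(r\mathbf U)+{\rm div}(r\mathbf U\otimes\mathbf U)+\nabla p(r,\Theta)={\rm div}\,\mathbb S(r,\Theta,\mathbb D(\mathbf U))+{\bf curl}\,\mathbf H\times\mathbf H,$$ $$\partial_t\mathbf H+{\bf curl}(\mathbf H\times\mathbf U)+{\bf curl}(\zeta(r,\Theta){\bf curl}\,\mathbf H)=0,\qquad{\rm div}\,\mathbf H=0,$$ $$\partial_t(rs)+{\rm div}(rs\mathbf U)+{\rm div}\frac{\mathbf q}\Theta=\frac1\Theta\Big(\mathbb S:\nabla\mathbf U-\frac{\mathbf q\cdot\nabla\Theta}\Theta+\zeta|{\bf curl}\,\mathbf H|^2\Big)$$ (with $s,\mathbf q,\mathbb S,\zeta$ evaluated at the strong solution), and for $t\in[0,T]$: $\mathbf U=0$ on $\partial\Omega$; $\Theta=\vartheta_B$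 on $\Gamma_D^\vartheta$; $\mathbf q\cdot\mathbf n=0$ on $\Gamma_N^\vartheta$; $\mathbf H\times\mathbf n=\mathbf b_\tau$ on $\Gamma_D^{\mathbf B}$; $\mathbf H\cdot\mathbf n=b_\nu$ and ${\bf curl}\,\mathbf H\times\mathbf n=0$ on $\Gamma_N^{\mathbf B}$. *DMV solution.* Let $\mathcal F$ be the set of all $[\varrho,\mathbf u,\vartheta,\mathbf B,\mathbb D_{\mathbf u},\mathbf D_\vartheta,\mathbf C_{\mathbf B}]$ with $\varrho,\vartheta\in[0,\infty)$, $\mathbf u,\mathbf B,\mathbf D_\vartheta,\mathbf C_{\mathbf B}\in\mathbb R^3$, $\mathbb D_{\mathbf u}\in\mathbb R^{3\times3}_{\rm sym}$, and $\mathcal F_0$ the set of all $[\varrho,\mathbf u,\vartheta,\mathbf B]$ as before. A dissipative measure-valued (DMV) solution is a measurable family of probability measures $\mathcal V_{t,x}$ on $\mathcal F$, $(t,x)\in(0,T)\times\Omega$, with initial value a measurable family $\mathcal V_{0,x}$ on $\mathcal F_0$, for which all the observables in brackets $\langle\cdot\,;\cdot\rangle$ in 1–7 are integrable, and for which there are matrix-valued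 finite signed measures $\mathfrak R^M,\mathfrak R^B$ on $[0,T]\times\overline\Omega$ and dissipation defects $0\le\mathcal D_{\tilde\vartheta},\mathcal D_{\tilde{\mathbf B}}\in L^\infty(0,T)$ such that, for a.e. $\tau\in(0,T)$ (the null set may depend on the test functions), with $P:=\frac1\vartheta\big(\mathbb S(\varrho,\vartheta,\mathbb D_{\mathbf u}):\mathbb D_{\mathbf u}+\frac{\kappa|\mathbf D_\vartheta|^2}\vartheta+\zeta|\mathbf C_{\mathbf B}|^2\big)$: 1. $\big[\int_\Omega\langle\mathcal V;\varrho\rangle\varphi\big]_0^\tau=\int_0^\tau\!\!\int_\Omega\langle\mathcal V;\varrho\rangle\partial_t\varphi+\langle\mathcal V;\varrho\mathbf u\rangle\cdot\nabla\varphi$ for all $\varphi\in C^1([0,T]\times\overline\Omega)$. 2. $\big[\int_\Omega\langle\mathcal V;\varrho\mathbf u\rangle\cdot\boldsymbol\varphi\big]_0^\tau=\int_0^\tau\!\!\int_\Omega\langle\mathcal V;\varrho\mathbf u\rangle\cdot\partial_t\boldsymbol\varphi-\langle\mathcal V;\mathbb S\rangle:\nabla\boldsymbol\varphi+\langle\mathcal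 V;\varrho\mathbf u\otimes\mathbf u-\mathbf B\otimes\mathbf B\rangle:\nabla\boldsymbol\varphi+\langle\mathcal V;p+\frac12|\mathbf B|^2\rangle{\rm div}\,\boldsymbol\varphi+\int_{[0,\tau]\times\overline\Omega}\nabla\boldsymbol\varphi:d(\mathfrak R^M+\mathfrak R^B)$ for all $\boldsymbol\varphi\in C^1([0,T]\times\overline\Omega;\mathbb R^3)$ with $\boldsymbol\varphi|_{\partial\Omega}=0$. 3. $\big[\int_\Omega\langle\mathcal V;\mathbf B\rangle\cdot\boldsymbol\varphi\big]_0^\tau=\int_0^\tau\!\!\int_\Omega\langle\mathcal V;\mathbf B\rangle\cdot\partial_t\boldsymbol\varphi-\langle\mathcal V;\mathbf B\times\mathbf u+\zeta\mathbf C_{\mathbf B}\rangle\cdot{\bf curl}\,\boldsymbol\varphi$ for all $\boldsymbol\varphi\in C^1([0,T]\times\overline\Omega;\mathbb R^3)$ with ${\rm div}\,\boldsymbol\varphi=0$, $\boldsymbol\varphi\times\mathbf n|_{\Gamma_D^{\mathbf B}}=0$, $\boldsymbol\varphi\cdot\mathbf n|_{\Gamma_N^{\mathbf B}}=0$; and $\int_0^\tau\!\!\int_\Omega\langle\mathcal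 V;\mathbf B\rangle\cdot\nabla\varphi=0$ for all $\varphi\in C^1_c([0,T]\times\Omega)$. 4. $\big[\int_\Omega\langle\mathcal V;\varrho s\rangle\varphi\big]_0^\tau-\int_0^\tau\!\!\int_\Omega\langle\mathcal V;P\rangle\varphi\ge\int_0^\tau\!\!\int_\Omega\langle\mathcal V;\varrho s\rangle\partial_t\varphi+\langle\mathcal V;\varrho s\mathbf u-\frac{\kappa\mathbf D_\vartheta}\vartheta\rangle\cdot\nabla\varphi$ for all $0\le\varphi\in C^1([0,T]\times\overline\Omega)$ with $\varphi|_{\Gamma_D^\vartheta}=0$. 5. For all $0<\tilde\vartheta\in C^{1,2}([0,T]\times\overline\Omega)$ with $\tilde\vartheta|_{\Gamma_D^\vartheta}=\vartheta_B$ and all $\tilde{\mathbf B}\in C^{1,2}([0,T]\times\overline\Omega;\mathbb R^3)$ with ${\rm div}\,\tilde{\mathbf B}=0$, $\tilde{\mathbf B}\times\mathbf n|_{\Gamma_D^{\mathbf B}}=\mathbf b_\tau$, $\tilde{\mathbf B}\cdot\mathbf n|_{\Gamma_N^{\mathbf B}}=b_\nu$: $$\Big[\int_\Omega\big\langle\mathcal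 V;\tfrac12\varrho|\mathbf u|^2+\varrho e+\tfrac12|\mathbf B|^2-\tilde\vartheta\varrho s-\tilde{\mathbf B}\cdot\mathbf B\big\rangle\Big]_0^\tau+\mathcal D_{\tilde\vartheta}(\tau)+\mathcal D_{\tilde{\mathbf B}}(\tau)+\int_0^\tau\!\!\int_\Omega\langle\mathcal V;P\rangle\tilde\vartheta$$ $$\le-\int_0^\tau\!\!\int_\Omega\Big(\langle\mathcal V;\varrho s\rangle\partial_t\tilde\vartheta+\langle\mathcal V;\varrho s\mathbf u-\tfrac{\kappa\mathbf D_\vartheta}\vartheta\rangle\cdot\nabla\tilde\vartheta\Big)-\int_0^\tau\!\!\int_\Omega\Big(\langle\mathcal V;\mathbf B\rangle\cdot\partial_t\tilde{\mathbf B}-\langle\mathcal V;\mathbf B\times\mathbf u+\zeta\mathbf C_{\mathbf B}\rangle\cdot{\bf curl}\,\tilde{\mathbf B}\Big).$$ 6. For all $\tilde\vartheta$, $\tilde{\mathbf B}$ as in 5 there is $c$ such that for all $0\le\xi\in C([0,T])$: $\int_{[0,\tau]\times\overline\Omega}\xi\,d|\mathfrak R^M|\le c\int_0^\tau\xi\mathcal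 D_{\tilde\vartheta}\,dt$ and $\int_{[0,\tau]\times\overline\Omega}\xi\,d|\mathfrak R^B|\le c\int_0^\tau\xi\mathcal D_{\tilde{\mathbf B}}\,dt$. 7. $-\int_0^T\!\!\int_\Omega\langle\mathcal V;\mathbf u\rangle\cdot{\rm div}\,\mathbb Z=\int_0^T\!\!\int_\Omega\langle\mathcal V;\mathbb D_{\mathbf u}\rangle:\mathbb Z$ for all $\mathbb Z\in C^1([0,T]\times\overline\Omega;\mathbb R^{3\times3}_{\rm sym})$; $-\int_0^T\!\!\int_\Omega\langle\mathcal V;\vartheta-\tilde\vartheta\rangle{\rm div}\,\boldsymbol\psi=\int_0^T\!\!\int_\Omega\langle\mathcal V;\mathbf D_\vartheta-\nabla\tilde\vartheta\rangle\cdot\boldsymbol\psi$ for all $\boldsymbol\psi\in C^1([0,T]\times\overline\Omega;\mathbb R^3)$ with $\boldsymbol\psi\cdot\mathbf n|_{\Gamma_N^\vartheta}=0$ and all $\tilde\vartheta\in C^{1,2}([0,T]\times\overline\Omega)$ with $\tilde\vartheta|_{\Gamma_D^\vartheta}=\vartheta_B$; $\int_0^T\!\!\int_\Omega\langle\mathcal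 V;\mathbf B-\tilde{\mathbf B}\rangle\cdot{\bf curl}\,\mathbf G=\int_0^T\!\!\int_\Omega\mathbf G\cdot\langle\mathcal V;\mathbf C_{\mathbf B}-{\bf curl}\,\tilde{\mathbf B}\rangle$ for all $\tilde{\mathbf B}\in C^{1,2}([0,T]\times\overline\Omega;\mathbb R^3)$ with $\tilde{\mathbf B}\times\mathbf n|_{\Gamma_D^{\mathbf B}}=\mathbf b_\tau$ and all $\mathbf G\in C^1([0,T]\times\overline\Omega;\mathbb R^3)$ with $\mathbf G\times\mathbf n|_{\Gamma_N^{\mathbf B}}=0$ or $\mathbf G|_{\Gamma_N^{\mathbf B}}=0$. 8. There is $c$ such that for all $\tilde{\mathbf u}\in L^2(0,T;W^{1,2}_0(\Omega;\mathbb R^3))$ and all $\tau\in[0,T]$: $\int_0^\tau\!\!\int_\Omega\langle\mathcal V;|\mathbf u-\tilde{\mathbf u}|^2\rangle\le c\int_0^\tau\!\!\int_\Omega\langle\mathcal V;|\mathbb T[\mathbb D_{\mathbf u}]-\mathbb T[\mathbb D(\tilde{\mathbf u})]|^2\rangle$, where $\mathbb T[\mathbb D]=\mathbb D-\frac13{\rm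 Tr}(\mathbb D)\mathbb I$ (values in $[0,\infty]$). *Claim.* Let $(r,\Theta,\mathbf U,\mathbf H)$ be a strong solution with initial data $(\varrho_0,\vartheta_0,\mathbf u_0,\mathbf B_0)$ and $\mathcal V$ a DMV solution of the same problem such that, for some positive constants $\underline\varrho,\overline\varrho,\underline\vartheta,\overline\vartheta$, $$\mathcal V_{t,x}\{\underline\varrho<\varrho<\overline\varrho,\ \underline\vartheta<\vartheta<\overline\vartheta\}=1\quad\text{for a.e. }(t,x)\in(0,T)\times\Omega,$$ and $\mathcal V_{0,x}=\delta_{[\varrho_0(x),\mathbf u_0(x),\vartheta_0(x),\mathbf B_0(x)]}$ for a.e. $x\in\Omega$. Then $$\mathcal V_{t,x}=\delta_{[r,\mathbf U,\Theta,\mathbf H,\mathbb D(\mathbf U),\nabla_x\Theta,{\bf curl}_x\mathbf H](t,x)}\quad\text{for a.e. }(t,x)\in(0,T)\times\Omega.$$ -/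

import Mathlib

open MeasureTheory ProbabilityTheory Filter Set
open scoped Topology ContDiff Matrix ENNReal

noncomputable section

namespace MHD

/-! ### Vectors, matrices and differential operators in three space dimensions -/

/-- Vectors of `R³`. Only `⬝ᵥ` and `normSq` are used for lengths, never the sup norm. -/
abbrev V3 := Fin 3 → ℝ

/-- Real `3 × 3` matrices. -/
abbrev M3 := Matrix (Fin 3) (Fin 3) ℝ

/-- The Borel (product) `σ`-algebra of the space of matrices. -/
instance : MeasurableSpace M3 := inferInstanceAs (MeasurableSpace (Fin 3 → Fin 3 → ℝ))

/-- `|v|²`. -/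
def normSq (v : V3) : ℝ := v ⬝ᵥ v

/-- `A : B`. -/
def frob (A B : M3) : ℝ := ∑ i, ∑ j, A i j * B i j

/-- `v ⊗ w`. -/
def tensor (v w : V3) : M3 := Matrix.of fun i j => v i * w j

/-- The partial derivative `∂_j f (x)`. -/
def pd (j : Fin 3) (f : V3 → ℝ) (x : V3) : ℝ := fderiv ℝ f x (Pi.single j 1)

def grad (f : V3 → ℝ) (x : V3) : V3 := fun j => pd j f x

/-- `(∇f)_{ij} = ∂_j f_i`. -/
def jac (f : V3 → V3) (x : V3) : M3 := Matrix.of fun i j => pd j (fun y => f y i) x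

def dvg (f : V3 → V3) (x : V3) : ℝ := ∑ j, pd j (fun y => f y j) x

/-- `(div A)_i = ∑_j ∂_j A_{ij}`. -/
def dvgM (A : V3 → M3) (x : V3) : V3 := fun i => ∑ j, pd j (fun y => A y i j) x

def curl (f : V3 → V3) (x : V3) : V3 :=
  ![pd 1 (fun y => f y 2) x - pd 2 (fun y => f y 1) x,
    pd 2 (fun y => f y 0) x - pd 0 (fun y => f y 2) x,
    pd 0 (fun y => f y 1) x - pd 1 (fun y => f y 0) x]

/-- The time derivative of a scalar function of `(t, x)`. -/
def dt (f : ℝ → V3 → ℝ) (t : ℝ) (x : V3) : ℝ := deriv (fun τ => f τ x) t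

/-- The time derivative of a vector function of `(t, x)`. -/
def dtV (f : ℝ → V3 → V3) (t : ℝ) (x : V3) : V3 := fun i => deriv (fun τ => f τ x i) t

/-- Symmetric part `(A + Aᵗ)/2`. -/
def symPart (A : M3) : M3 := (1 / 2 : ℝ) • (A + Aᵀ)

/-- The symmetric gradient `𝔻(f)`. -/
def symGrad (f : V3 → V3) (x : V3) : M3 := symPart (jac f x)

/-- The traceless part `𝕋[D] = D - (1/3) Tr(D) 𝕀`. -/
def traceless (D : M3) : M3 := D - (D.trace / 3) • (1 : M3)

/-- Class `C¹([0,T] × Ω̄)`: restrictions of functions that are `C¹` on `ℝ × R³`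
(for a smooth bounded `Ω` every function that is `C¹` up to the boundary is one). -/
def IsC1 {F : Type*} [NormedAddCommGroup F] [NormedSpace ℝ F] (f : ℝ → V3 → F) : Prop :=
  ContDiff ℝ 1 fun q : ℝ × V3 => f q.1 q.2

/-- Class `C^{1,2}([0,T] × Ω̄)`: `∂_t f`, `∇f` and `∇²f` are continuous
(again as restrictions of functions on `ℝ × R³`). -/
def IsC12 {F : Type*} [NormedAddCommGroup F] [NormedSpace ℝ F] (f : ℝ → V3 → F) : Prop :=
  IsC1 f ∧ (∀ t, ContDiff ℝ 2 (f t)) ∧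
    Continuous fun q : ℝ × V3 => fderiv ℝ (fun y => fderiv ℝ (f q.1) y) q.2

/-! ### The spatial domain and the boundary data -/

/-- `g` is a smooth function with `Ω = {g < 0}` near the boundary point `x`, and `∇g(x) ≠ 0`. -/
def IsLocalDefiningFunction (Ω : Set V3) (x : V3) (g : V3 → ℝ) : Prop :=
  ContDiff ℝ ∞ g ∧ g x = 0 ∧ grad g x ≠ 0 ∧ ∀ᶠ y in 𝓝 x, (y ∈ Ω ↔ g y < 0)

/-- A time horizon `T`, a bounded domain `Ω` with smooth boundary, its outer unit normal `n`, and
the Dirichlet/Neumann splittings of `∂Ω` for the temperature and for the magnetic field.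
(Two disjoint compact sets that cover `∂Ω` are unions of finitely many components of `∂Ω`,
or empty. The velocity satisfies the Dirichlet condition on all of `∂Ω`.) -/
structure Geometry where
  T : ℝ
  T_pos : 0 < T
  Ω : Set V3
  isOpen : IsOpen Ω
  isConnected : IsConnected Ω
  isBounded : Bornology.IsBounded Ω
  /-- the outer unit normal (relevant on `∂Ω` only) -/
  n : V3 → V3
  smooth_boundary : ∀ x ∈ frontier Ω, ∃ g, IsLocalDefiningFunction Ω x g ∧
    n x = (Real.sqrt (normSq (grad g x)))⁻¹ • grad g x
  ΓθD : Set V3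
  ΓθN : Set V3
  ΓBD : Set V3
  ΓBN : Set V3
  compact_θD : IsCompact ΓθD
  compact_θN : IsCompact ΓθN
  compact_BD : IsCompact ΓBD
  compact_BN : IsCompact ΓBN
  union_θ : ΓθD ∪ ΓθN = frontier Ω
  union_B : ΓBD ∪ ΓBN = frontier Ω
  disjoint_θ : Disjoint ΓθD ΓθN
  disjoint_B : Disjoint ΓBD ΓBN
  nonempty_θD : ΓθD.Nonempty

/-- The space-time cylinder `(0,τ) × Ω`. -/
def Geometry.cyl (G : Geometry) (τ : ℝ) : Set (ℝ × V3) := Ioo 0 τ ×ˢ G.Ω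

/-- The boundary temperature `ϑ_B` and the stationary magnetic boundary data `b_τ`, `b_ν`. -/
structure BoundaryData (G : Geometry) where
  θB : ℝ → V3 → ℝ
  θB_reg : IsC12 θB
  θB_pos : ∀ t ∈ Icc 0 G.T, ∀ x ∈ closure G.Ω, 0 < θB t x
  bτ : V3 → V3
  bν : V3 → ℝ
  stationary : ∃ BB : V3 → V3, ContDiff ℝ 1 BB ∧
    (∀ x ∈ G.Ω, dvg BB x = 0) ∧ (∀ x ∈ G.Ω, curl BB x = 0) ∧
    (∀ x ∈ G.ΓBN, BB x ⬝ᵥ G.n x = bν x) ∧ (∀ x ∈ G.ΓBD, BB x ⨯₃ G.n x = bτ x)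

/-! ### Constitutive functions -/

/-- The viscosity, heat conductivity and magnetic diffusivity coefficients and the pressure,
internal energy and entropy, as functions of density and temperature. Only their values
for positive density and temperature are meaningful. -/
structure Fluid where
  μ : ℝ → ℝ → ℝ
  η : ℝ → ℝ → ℝ
  κ : ℝ → ℝ → ℝ
  ζ : ℝ → ℝ → ℝ
  p : ℝ → ℝ → ℝ
  e : ℝ → ℝ → ℝ
  s : ℝ → ℝ → ℝ

/-- The open quadrant `(0,∞)²`. -/
def quadrant : Set (ℝ × ℝ) := Ioi 0 ×ˢ Ioi 0

/-- Continuous differentiability in `(ϱ,ϑ) ∈ (0,∞)²`. -/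
def C1Quad (f : ℝ → ℝ → ℝ) : Prop :=
  ContDiffOn ℝ 1 (fun q : ℝ × ℝ => f q.1 q.2) quadrant

/-- The first derivatives are locally Lipschitz in `(0,∞)²`. -/
def LipDerivQuad (f : ℝ → ℝ → ℝ) : Prop :=
  LocallyLipschitzOn quadrant (fderiv ℝ fun q : ℝ × ℝ => f q.1 q.2)

/-- Gibbs' equation `ϑ Ds = De + p D(1/ϱ)`. -/
def Fluid.Gibbs (fl : Fluid) : Prop :=
  ∀ q ∈ quadrant,
    q.2 • fderiv ℝ (fun q : ℝ × ℝ => fl.s q.1 q.2) q =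
      fderiv ℝ (fun q : ℝ × ℝ => fl.e q.1 q.2) q +
        fl.p q.1 q.2 • fderiv ℝ (fun q : ℝ × ℝ => 1 / q.1) q

/-- Thermodynamic stability: `∂p/∂ϱ > 0` and `∂e/∂ϑ > 0`. -/
def Fluid.ThermodynamicallyStable (fl : Fluid) : Prop :=
  ∀ ρ θ : ℝ, 0 < ρ → 0 < θ →
    0 < deriv (fun ρ' => fl.p ρ' θ) ρ ∧ 0 < deriv (fun θ' => fl.e ρ θ') θ

/-- The viscous stress
`𝕊(ϱ,ϑ,D) = μ(ϱ,ϑ) (2D - (1/3) Tr(D) 𝕀) + (η(ϱ,ϑ)/3) Tr(D) 𝕀`. -/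
def Fluid.stress (fl : Fluid) (ρ θ : ℝ) (D : M3) : M3 :=
  fl.μ ρ θ • ((2 : ℝ) • D - (D.trace / 3) • (1 : M3)) + (fl.η ρ θ / 3 * D.trace) • (1 : M3)

/-- Fourier's law `q(ϱ,ϑ,∇ϑ) = - κ(ϱ,ϑ) ∇ϑ`, with `g` standing for `∇ϑ`. -/
def Fluid.heatFlux (fl : Fluid) (ρ θ : ℝ) (g : V3) : V3 := -(fl.κ ρ θ • g)

/-- The entropy production rate
`(1/ϑ) (𝕊(ϱ,ϑ,D) : A - q(ϱ,ϑ,g)·g/ϑ + ζ(ϱ,ϑ)|C|²)`;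
`D`, `A`, `g`, `C` stand for `𝔻(u)`, `∇u`, `∇ϑ`, `curl B`. -/
def Fluid.production (fl : Fluid) (ρ θ : ℝ) (D A : M3) (g C : V3) : ℝ :=
  1 / θ * (frob (fl.stress ρ θ D) A - fl.heatFlux ρ θ g ⬝ᵥ g / θ + fl.ζ ρ θ * normSq C)

/-! ### Strong solutions -/

/-- `(r, U, Θ, H)` is a strong solution of the compressible MHD system on `[0,T] × Ω̄`: it is
continuously differentiable, `U`, `Θ`, `H` are also twice continuously differentiable in space,
and the equations and the initial and boundary conditions hold pointwise. -/
structure IsStrongSolution (G : Geometry) (bd : BoundaryData G) (fl : Fluid)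
    (ρ₀ : V3 → ℝ) (u₀ : V3 → V3) (θ₀ : V3 → ℝ) (B₀ : V3 → V3)
    (r : ℝ → V3 → ℝ) (U : ℝ → V3 → V3) (Θ : ℝ → V3 → ℝ) (H : ℝ → V3 → V3) : Prop where
  r_reg : IsC1 r
  U_reg : IsC12 U
  Θ_reg : IsC12 Θ
  H_reg : IsC12 H
  r_pos : ∀ t ∈ Icc 0 G.T, ∀ x ∈ closure G.Ω, 0 < r t x
  Θ_pos : ∀ t ∈ Icc 0 G.T, ∀ x ∈ closure G.Ω, 0 < Θ t x
  continuity : ∀ t ∈ Ioo 0 G.T, ∀ x ∈ G.Ω,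
    dt r t x + dvg (fun y => r t y • U t y) x = 0
  momentum : ∀ t ∈ Ioo 0 G.T, ∀ x ∈ G.Ω,
    dtV (fun t x => r t x • U t x) t x
        + dvgM (fun y => r t y • tensor (U t y) (U t y)) x
        + grad (fun y => fl.p (r t y) (Θ t y)) x
      = dvgM (fun y => fl.stress (r t y) (Θ t y) (symGrad (U t) y)) x
        + curl (H t) x ⨯₃ H t x
  induction : ∀ t ∈ Ioo 0 G.T, ∀ x ∈ G.Ω,
    dtV H t x + curl (fun y => H t y ⨯₃ U t y) x
      + curl (fun y => fl.ζ (r t y) (Θ t y) • curl (H t) y) x = 0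
  solenoidal : ∀ t ∈ Icc 0 G.T, ∀ x ∈ G.Ω, dvg (H t) x = 0
  entropy : ∀ t ∈ Ioo 0 G.T, ∀ x ∈ G.Ω,
    dt (fun t x => r t x * fl.s (r t x) (Θ t x)) t x
        + dvg (fun y => (r t y * fl.s (r t y) (Θ t y)) • U t y) x
        + dvg (fun y => (1 / Θ t y) • fl.heatFlux (r t y) (Θ t y) (grad (Θ t) y)) x
      = fl.production (r t x) (Θ t x) (symGrad (U t) x) (jac (U t) x) (grad (Θ t) x)
          (curl (H t) x)
  bc_velocity : ∀ t ∈ Icc 0 G.T, ∀ x ∈ frontier G.Ω, U t x = 0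
  bc_temperature : ∀ t ∈ Icc 0 G.T, ∀ x ∈ G.ΓθD, Θ t x = bd.θB t x
  bc_heatFlux : ∀ t ∈ Icc 0 G.T, ∀ x ∈ G.ΓθN,
    fl.heatFlux (r t x) (Θ t x) (grad (Θ t) x) ⬝ᵥ G.n x = 0
  bc_tangential : ∀ t ∈ Icc 0 G.T, ∀ x ∈ G.ΓBD, H t x ⨯₃ G.n x = bd.bτ x
  bc_normal : ∀ t ∈ Icc 0 G.T, ∀ x ∈ G.ΓBN, H t x ⬝ᵥ G.n x = bd.bν x
  bc_curl : ∀ t ∈ Icc 0 G.T, ∀ x ∈ G.ΓBN, curl (H t) x ⨯₃ G.n x = 0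
  init_density : ∀ x ∈ G.Ω, r 0 x = ρ₀ x
  init_velocity : ∀ x ∈ G.Ω, U 0 x = u₀ x
  init_temperature : ∀ x ∈ G.Ω, Θ 0 x = θ₀ x
  init_magnetic : ∀ x ∈ G.Ω, H 0 x = B₀ x

/-! ### Phase spaces and Young measures -/

/-- Points `[ϱ, u, ϑ, B, D_u, D_ϑ, C_B]`. Measures on the phase space `𝓕` are measures on this
vector space that are concentrated on the closed set `phaseSet`. -/
abbrev Phase := ℝ × V3 × ℝ × V3 × M3 × V3 × V3

/-- Points `[ϱ₀, u₀, ϑ₀, B₀]` of the phase space of the initial data. -/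
abbrev Phase₀ := ℝ × V3 × ℝ × V3

namespace Phase
def ρ (z : Phase) : ℝ := z.1
def u (z : Phase) : V3 := z.2.1
def θ (z : Phase) : ℝ := z.2.2.1
def B (z : Phase) : V3 := z.2.2.2.1
def Du (z : Phase) : M3 := z.2.2.2.2.1
def Dθ (z : Phase) : V3 := z.2.2.2.2.2.1
def CB (z : Phase) : V3 := z.2.2.2.2.2.2
end Phase

namespace Phase₀
def ρ (z : Phase₀) : ℝ := z.1
def u (z : Phase₀) : V3 := z.2.1
def θ (z : Phase₀) : ℝ := z.2.2.1
def B (z : Phase₀) : V3 := z.2.2.2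
end Phase₀

/-- `ϱ, ϑ ∈ [0,∞)` and `D_u` symmetric. -/
def phaseSet : Set Phase := {z | 0 ≤ z.ρ ∧ 0 ≤ z.θ ∧ z.Du.IsSymm}

def phaseSet₀ : Set Phase₀ := {z | 0 ≤ z.ρ ∧ 0 ≤ z.θ}

/-- `⟨ν; g⟩` for a scalar observable `g`. -/
def av {Z : Type*} [MeasurableSpace Z] (ν : Measure Z) (g : Z → ℝ) : ℝ := ∫ z, g z ∂ν

/-- `⟨ν; g⟩` for a vector observable `g`. -/
def avV {Z : Type*} [MeasurableSpace Z] (ν : Measure Z) (g : Z → V3) : V3 :=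
  fun i => ∫ z, g z i ∂ν

/-- `⟨ν; g⟩` for a matrix observable `g`. -/
def avM {Z : Type*} [MeasurableSpace Z] (ν : Measure Z) (g : Z → M3) : M3 :=
  Matrix.of fun i j => ∫ z, g z i j ∂ν

/-- The function `(t,x) ↦ ⟨V_{t,x}; |g|⟩` is integrable over `(0,T) × Ω`. -/
def ObsIntegrable (G : Geometry) (V : Kernel (ℝ × V3) Phase) (g : Phase → ℝ) : Prop :=
  Integrable (fun w : (ℝ × V3) × Phase => g w.2) ((volume.restrict (G.cyl G.T)) ⊗ₘ V)

/-- The function `x ↦ ⟨V_{0,x}; |g|⟩` is integrable over `Ω`. -/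
def ObsIntegrable₀ (G : Geometry) (V₀ : Kernel V3 Phase₀) (g : Phase₀ → ℝ) : Prop :=
  Integrable (fun w : V3 × Phase₀ => g w.2) ((volume.restrict G.Ω) ⊗ₘ V₀)

/-! Observables of the definition of a dissipative measure-valued solution -/

def Fluid.stressObs (fl : Fluid) (z : Phase) : M3 := fl.stress z.ρ z.θ z.Du

/-- `ϱ u ⊗ u - B ⊗ B`. -/
def convObs (z : Phase) : M3 := z.ρ • tensor z.u z.u - tensor z.B z.B

/-- `p(ϱ,ϑ) + |B|²/2`. -/
def Fluid.pressureObs (fl : Fluid) (z : Phase) : ℝ := fl.p z.ρ z.θ + 1 / 2 * normSq z.B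

/-- `B × u + ζ(ϱ,ϑ) C_B`. -/
def Fluid.inductionObs (fl : Fluid) (z : Phase) : V3 := z.B ⨯₃ z.u + fl.ζ z.ρ z.θ • z.CB

/-- `ϱ s(ϱ,ϑ)`. -/
def Fluid.entropyObs (fl : Fluid) (z : Phase) : ℝ := z.ρ * fl.s z.ρ z.θ

/-- `ϱ s(ϱ,ϑ) u - κ(ϱ,ϑ) D_ϑ / ϑ`. -/
def Fluid.entropyFluxObs (fl : Fluid) (z : Phase) : V3 :=
  (z.ρ * fl.s z.ρ z.θ) • z.u - (fl.κ z.ρ z.θ / z.θ) • z.Dθ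

/-- `(1/ϑ) (𝕊(ϱ,ϑ,D_u) : D_u + κ(ϱ,ϑ) |D_ϑ|²/ϑ + ζ(ϱ,ϑ) |C_B|²)`. -/
def Fluid.productionObs (fl : Fluid) (z : Phase) : ℝ :=
  1 / z.θ * (frob (fl.stressObs z) z.Du + fl.κ z.ρ z.θ * normSq z.Dθ / z.θ
    + fl.ζ z.ρ z.θ * normSq z.CB)

/-- `ϱ|u|²/2 + ϱ e(ϱ,ϑ) + |B|²/2`. -/
def Fluid.energy (fl : Fluid) (ρ : ℝ) (u : V3) (θ : ℝ) (B : V3) : ℝ :=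
  1 / 2 * ρ * normSq u + ρ * fl.e ρ θ + 1 / 2 * normSq B

/-- The ballistic energy
`ϱ|u|²/2 + ϱ e(ϱ,ϑ) + |B|²/2 - ϑ' ϱ s(ϱ,ϑ) - B'·B` with parameters `ϑ'`, `B'`. -/
def Fluid.ballistic (fl : Fluid) (θ' : ℝ) (B' : V3) (ρ : ℝ) (u : V3) (θ : ℝ) (B : V3) : ℝ :=
  fl.energy ρ u θ B - θ' * (ρ * fl.s ρ θ) - B' ⬝ᵥ B

/-! ### Matrix-valued measures -/

/-- A signed, matrix-valued measure on space-time, given by its entries (a defect measure in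
`𝓜([0,T] × Ω̄; R^{3×3})`; it is only ever evaluated on subsets of `[0,T] × Ω̄`). -/
abbrev MatrixMeasure := Fin 3 → Fin 3 → SignedMeasure (ℝ × V3)

/-- `∫_A f dν` for a signed measure `ν`. -/
def signedInt (ν : SignedMeasure (ℝ × V3)) (A : Set (ℝ × V3)) (f : ℝ × V3 → ℝ) : ℝ :=
  (∫ q in A, f q ∂ν.toJordanDecomposition.posPart) -
    ∫ q in A, f q ∂ν.toJordanDecomposition.negPart

/-- `∫_A F : dR`. -/
def MatrixMeasure.int (R : MatrixMeasure) (A : Set (ℝ × V3)) (F : ℝ × V3 → M3) : ℝ :=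
  ∑ i, ∑ j, signedInt (R i j) A fun q => F q i j

/-- `|R|`, the sum of the total variations of the entries (equivalent, up to a numerical factor,
to the total variation with respect to any norm of matrices). -/
def MatrixMeasure.var (R : MatrixMeasure) : Measure (ℝ × V3) :=
  ∑ i, ∑ j, (R i j).totalVariation

/-! ### The space `L²(0,T; W₀^{1,2}(Ω; R³))` -/

/-- `w ∈ W₀^{1,2}(Ω; R³)` with weak gradient `A`: both are limits in `L²(Ω)` along smooth
compactly supported fields. -/
def InW012 (Ω : Set V3) (w : V3 → V3) (A : V3 → M3) : Prop :=
  ∃ φ : ℕ → V3 → V3,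
    (∀ k, ContDiff ℝ ∞ (φ k) ∧ HasCompactSupport (φ k) ∧ tsupport (φ k) ⊆ Ω) ∧
    Tendsto (fun k => ∫⁻ x in Ω, ENNReal.ofReal (normSq (φ k x - w x))) atTop (𝓝 0) ∧
    Tendsto (fun k => ∫⁻ x in Ω, ENNReal.ofReal
      (frob (jac (φ k) x - A x) (jac (φ k) x - A x))) atTop (𝓝 0)

/-- `v ∈ L²(0,T; W₀^{1,2}(Ω; R³))` with weak spatial gradient `A`. -/
structure InL2W012 (G : Geometry) (v : ℝ → V3 → V3) (A : ℝ → V3 → M3) : Prop where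
  memLp : ∀ i, MemLp (fun q : ℝ × V3 => v q.1 q.2 i) 2 (volume.restrict (G.cyl G.T))
  grad_memLp : ∀ i j, MemLp (fun q : ℝ × V3 => A q.1 q.2 i j) 2 (volume.restrict (G.cyl G.T))
  slices : ∀ᵐ t ∂volume.restrict (Ioo 0 G.T), InW012 G.Ω (v t) (A t)

/-! ### Classes of test functions -/

/-- `ϑ' ∈ C^{1,2}([0,T] × Ω̄)` with `ϑ' = ϑ_B` on the Dirichlet part of the boundary. -/
structure IsTempExtension (G : Geometry) (bd : BoundaryData G) (θ' : ℝ → V3 → ℝ) : Prop where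
  reg : IsC12 θ'
  bc : ∀ t ∈ Icc 0 G.T, ∀ x ∈ G.ΓθD, θ' t x = bd.θB t x

/-- Such a `ϑ'` that is moreover positive on `[0,T] × Ω̄`. -/
structure IsTempTest (G : Geometry) (bd : BoundaryData G) (θ' : ℝ → V3 → ℝ) : Prop
    extends IsTempExtension G bd θ' where
  pos : ∀ t ∈ Icc 0 G.T, ∀ x ∈ closure G.Ω, 0 < θ' t x

/-- `B' ∈ C^{1,2}([0,T] × Ω̄; R³)` with `B' × n = b_τ` on the Dirichlet part of the boundary. -/
structure IsMagExtension (G : Geometry) (bd : BoundaryData G) (B' : ℝ → V3 → V3) : Prop where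
  reg : IsC12 B'
  bc_tangential : ∀ t ∈ Icc 0 G.T, ∀ x ∈ G.ΓBD, B' t x ⨯₃ G.n x = bd.bτ x

/-- Such a `B'` that is moreover solenoidal with `B'·n = b_ν` on the Neumann part. -/
structure IsMagTest (G : Geometry) (bd : BoundaryData G) (B' : ℝ → V3 → V3) : Prop
    extends IsMagExtension G bd B' where
  solenoidal : ∀ t ∈ Icc 0 G.T, ∀ x ∈ G.Ω, dvg (B' t) x = 0
  bc_normal : ∀ t ∈ Icc 0 G.T, ∀ x ∈ G.ΓBN, B' t x ⬝ᵥ G.n x = bd.bν x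

/-! ### Dissipative measure-valued solutions -/

/-- The Young measure `V` with initial value `V₀`, concentration defect measures `RM`, `RB` and
dissipation defects `𝓓_{ϑ'} = DT ϑ'`, `𝓓_{B'} = DB B'` is a dissipative measure-valued solution. -/
structure IsDMVSolutionWith (G : Geometry) (bd : BoundaryData G) (fl : Fluid)
    (V : Kernel (ℝ × V3) Phase) (V₀ : Kernel V3 Phase₀)
    (RM RB : MatrixMeasure) (DT : (ℝ → V3 → ℝ) → ℝ → ℝ) (DB : (ℝ → V3 → V3) → ℝ → ℝ) :
    Prop where
  -- Young measures on the phase spaces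
  phase : ∀ᵐ q ∂volume.restrict (G.cyl G.T), ∀ᵐ z ∂V q, z ∈ phaseSet
  phase₀ : ∀ᵐ x ∂volume.restrict G.Ω, ∀ᵐ z ∂V₀ x, z ∈ phaseSet₀
  -- integrability of all observables that are paired with the Young measures
  int_density : ObsIntegrable G V fun z => z.ρ
  int_momentum : ∀ i, ObsIntegrable G V fun z => (z.ρ • z.u) i
  int_stress : ∀ i j, ObsIntegrable G V fun z => fl.stressObs z i j
  int_conv : ∀ i j, ObsIntegrable G V fun z => convObs z i j
  int_pressure : ObsIntegrable G V fl.pressureObs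
  int_induction : ∀ i, ObsIntegrable G V fun z => fl.inductionObs z i
  int_entropy : ObsIntegrable G V fl.entropyObs
  int_entropyFlux : ∀ i, ObsIntegrable G V fun z => fl.entropyFluxObs z i
  int_production : ObsIntegrable G V fl.productionObs
  int_energy : ObsIntegrable G V fun z => fl.energy z.ρ z.u z.θ z.B
  int_velocity : ∀ i, ObsIntegrable G V fun z => z.u i
  int_temperature : ObsIntegrable G V fun z => z.θ
  int_magnetic : ∀ i, ObsIntegrable G V fun z => z.B i
  int_Du : ∀ i j, ObsIntegrable G V fun z => z.Du i j
  int_Dθ : ∀ i, ObsIntegrable G V fun z => z.Dθ i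
  int_CB : ∀ i, ObsIntegrable G V fun z => z.CB i
  int₀_density : ObsIntegrable₀ G V₀ fun z => z.ρ
  int₀_momentum : ∀ i, ObsIntegrable₀ G V₀ fun z => (z.ρ • z.u) i
  int₀_magnetic : ∀ i, ObsIntegrable₀ G V₀ fun z => z.B i
  int₀_entropy : ObsIntegrable₀ G V₀ fun z => z.ρ * fl.s z.ρ z.θ
  int₀_energy : ObsIntegrable₀ G V₀ fun z => fl.energy z.ρ z.u z.θ z.B
  -- equation of continuity
  continuity : ∀ φ : ℝ → V3 → ℝ, IsC1 φ → ∀ᵐ τ ∂volume.restrict (Ioo 0 G.T),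
    (∫ x in G.Ω, av (V (τ, x)) (fun z => z.ρ) * φ τ x)
        - (∫ x in G.Ω, av (V₀ x) (fun z => z.ρ) * φ 0 x)
      = ∫ q in G.cyl τ, (av (V q) (fun z => z.ρ) * dt φ q.1 q.2
          + avV (V q) (fun z => z.ρ • z.u) ⬝ᵥ grad (φ q.1) q.2)
  -- momentum equation
  momentum : ∀ φ : ℝ → V3 → V3, IsC1 φ →
    (∀ t ∈ Icc 0 G.T, ∀ x ∈ frontier G.Ω, φ t x = 0) →
    ∀ᵐ τ ∂volume.restrict (Ioo 0 G.T),
    (∫ x in G.Ω, avV (V (τ, x)) (fun z => z.ρ • z.u) ⬝ᵥ φ τ x)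
        - (∫ x in G.Ω, avV (V₀ x) (fun z => z.ρ • z.u) ⬝ᵥ φ 0 x)
      = (∫ q in G.cyl τ, (avV (V q) (fun z => z.ρ • z.u) ⬝ᵥ dtV φ q.1 q.2
            - frob (avM (V q) fl.stressObs) (jac (φ q.1) q.2)))
        + (∫ q in G.cyl τ, (frob (avM (V q) convObs) (jac (φ q.1) q.2)
            + av (V q) fl.pressureObs * dvg (φ q.1) q.2))
        + RM.int (Icc 0 τ ×ˢ closure G.Ω) (fun q => jac (φ q.1) q.2)
        + RB.int (Icc 0 τ ×ˢ closure G.Ω) (fun q => jac (φ q.1) q.2)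
  -- magnetic induction equation
  induction : ∀ φ : ℝ → V3 → V3, IsC1 φ →
    (∀ t ∈ Icc 0 G.T, ∀ x ∈ G.Ω, dvg (φ t) x = 0) →
    (∀ t ∈ Icc 0 G.T, ∀ x ∈ G.ΓBD, φ t x ⨯₃ G.n x = 0) →
    (∀ t ∈ Icc 0 G.T, ∀ x ∈ G.ΓBN, φ t x ⬝ᵥ G.n x = 0) →
    ∀ᵐ τ ∂volume.restrict (Ioo 0 G.T),
    (∫ x in G.Ω, avV (V (τ, x)) (fun z => z.B) ⬝ᵥ φ τ x)
        - (∫ x in G.Ω, avV (V₀ x) (fun z => z.B) ⬝ᵥ φ 0 x)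
      = ∫ q in G.cyl τ, (avV (V q) (fun z => z.B) ⬝ᵥ dtV φ q.1 q.2
          - avV (V q) fl.inductionObs ⬝ᵥ curl (φ q.1) q.2)
  -- the magnetic field is solenoidal; test functions in `C¹_c([0,T] × Ω)`
  solenoidal : ∀ φ : ℝ → V3 → ℝ, IsC1 φ →
    (∃ K : Set V3, IsCompact K ∧ K ⊆ G.Ω ∧ ∀ t ∈ Icc 0 G.T, ∀ x ∉ K, φ t x = 0) →
    ∀ᵐ τ ∂volume.restrict (Ioo 0 G.T),
    ∫ q in G.cyl τ, avV (V q) (fun z => z.B) ⬝ᵥ grad (φ q.1) q.2 = 0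
  -- entropy inequality
  entropy : ∀ φ : ℝ → V3 → ℝ, IsC1 φ →
    (∀ t ∈ Icc 0 G.T, ∀ x ∈ closure G.Ω, 0 ≤ φ t x) →
    (∀ t ∈ Icc 0 G.T, ∀ x ∈ G.ΓθD, φ t x = 0) →
    ∀ᵐ τ ∂volume.restrict (Ioo 0 G.T),
    (∫ x in G.Ω, av (V (τ, x)) fl.entropyObs * φ τ x)
        - (∫ x in G.Ω, av (V₀ x) (fun z => z.ρ * fl.s z.ρ z.θ) * φ 0 x)
        - (∫ q in G.cyl τ, av (V q) fl.productionObs * φ q.1 q.2)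
      ≥ ∫ q in G.cyl τ, (av (V q) fl.entropyObs * dt φ q.1 q.2
          + avV (V q) fl.entropyFluxObs ⬝ᵥ grad (φ q.1) q.2)
  -- dissipation defects
  DT_bdd : ∀ θ', IsTempTest G bd θ' → MemLp (DT θ') ∞ (volume.restrict (Ioo 0 G.T))
  DT_nonneg : ∀ θ', IsTempTest G bd θ' → ∀ᵐ τ ∂volume.restrict (Ioo 0 G.T), 0 ≤ DT θ' τ
  DB_bdd : ∀ B', IsMagTest G bd B' → MemLp (DB B') ∞ (volume.restrict (Ioo 0 G.T))
  DB_nonneg : ∀ B', IsMagTest G bd B' → ∀ᵐ τ ∂volume.restrict (Ioo 0 G.T), 0 ≤ DB B' τ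
  -- ballistic energy inequality
  ballistic : ∀ θ' B', IsTempTest G bd θ' → IsMagTest G bd B' →
    ∀ᵐ τ ∂volume.restrict (Ioo 0 G.T),
    (∫ x in G.Ω, av (V (τ, x)) (fun z => fl.ballistic (θ' τ x) (B' τ x) z.ρ z.u z.θ z.B))
        - (∫ x in G.Ω, av (V₀ x) (fun z => fl.ballistic (θ' 0 x) (B' 0 x) z.ρ z.u z.θ z.B))
        + DT θ' τ + DB B' τ
        + (∫ q in G.cyl τ, av (V q) fl.productionObs * θ' q.1 q.2)
      ≤ -(∫ q in G.cyl τ, (av (V q) fl.entropyObs * dt θ' q.1 q.2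
            + avV (V q) fl.entropyFluxObs ⬝ᵥ grad (θ' q.1) q.2))
        - (∫ q in G.cyl τ, (avV (V q) (fun z => z.B) ⬝ᵥ dtV B' q.1 q.2
            - avV (V q) fl.inductionObs ⬝ᵥ curl (B' q.1) q.2))
  -- the concentration defects are dominated by the dissipation defects
  defect_momentum : ∀ θ', IsTempTest G bd θ' → ∃ c : ℝ, ∀ ξ : ℝ → ℝ, Continuous ξ →
    (∀ t ∈ Icc 0 G.T, 0 ≤ ξ t) → ∀ᵐ τ ∂volume.restrict (Ioo 0 G.T),
    (∫ q in Icc 0 τ ×ˢ closure G.Ω, ξ q.1 ∂(MatrixMeasure.var RM)) ≤ c * ∫ t in Ioo 0 τ, ξ t * DT θ' t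
  defect_magnetic : ∀ B', IsMagTest G bd B' → ∃ c : ℝ, ∀ χ : ℝ → ℝ, Continuous χ →
    (∀ t ∈ Icc 0 G.T, 0 ≤ χ t) → ∀ᵐ τ ∂volume.restrict (Ioo 0 G.T),
    (∫ q in Icc 0 τ ×ˢ closure G.Ω, χ q.1 ∂(MatrixMeasure.var RB)) ≤ c * ∫ t in Ioo 0 τ, χ t * DB B' t
  -- compatibility conditions
  compat_velocity : ∀ Z : ℝ → V3 → M3,
    (∀ i j, IsC1 fun t x => Z t x i j) →
    (∀ t ∈ Icc 0 G.T, ∀ x ∈ closure G.Ω, (Z t x).IsSymm) →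
    -(∫ q in G.cyl G.T, avV (V q) (fun z => z.u) ⬝ᵥ dvgM (Z q.1) q.2)
      = ∫ q in G.cyl G.T, frob (avM (V q) (fun z => z.Du)) (Z q.1 q.2)
  compat_temperature : ∀ (ψ : ℝ → V3 → V3) (θ' : ℝ → V3 → ℝ), IsC1 ψ →
    (∀ t ∈ Icc 0 G.T, ∀ x ∈ G.ΓθN, ψ t x ⬝ᵥ G.n x = 0) → IsTempExtension G bd θ' →
    -(∫ q in G.cyl G.T, av (V q) (fun z => z.θ - θ' q.1 q.2) * dvg (ψ q.1) q.2)
      = ∫ q in G.cyl G.T, avV (V q) (fun z => z.Dθ - grad (θ' q.1) q.2) ⬝ᵥ ψ q.1 q.2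
  compat_magnetic : ∀ B' E : ℝ → V3 → V3, IsMagExtension G bd B' → IsC1 E →
    ((∀ t ∈ Icc 0 G.T, ∀ x ∈ G.ΓBN, E t x ⨯₃ G.n x = 0) ∨
      (∀ t ∈ Icc 0 G.T, ∀ x ∈ G.ΓBN, E t x = 0)) →
    (∫ q in G.cyl G.T, avV (V q) (fun z => z.B - B' q.1 q.2) ⬝ᵥ curl (E q.1) q.2)
      = ∫ q in G.cyl G.T, E q.1 q.2 ⬝ᵥ avV (V q) (fun z => z.CB - curl (B' q.1) q.2)
  -- Korn-Poincaré inequality (both sides in `[0,∞]`)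
  korn_poincare : ∃ c : ℝ, ∀ (v : ℝ → V3 → V3) (A : ℝ → V3 → M3), InL2W012 G v A →
    ∀ τ ∈ Icc 0 G.T,
    (∫⁻ q in G.cyl τ, ∫⁻ z, ENNReal.ofReal (normSq (z.u - v q.1 q.2)) ∂V q)
      ≤ ENNReal.ofReal c * ∫⁻ q in G.cyl τ, ∫⁻ z, ENNReal.ofReal
          (frob (traceless z.Du - traceless (symPart (A q.1 q.2)))
            (traceless z.Du - traceless (symPart (A q.1 q.2)))) ∂V q

/-- Dissipative measure-valued solutions of the compressible MHD system. -/
def IsDMVSolution (G : Geometry) (bd : BoundaryData G) (fl : Fluid)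
    (V : Kernel (ℝ × V3) Phase) (V₀ : Kernel V3 Phase₀) : Prop :=
  ∃ (RM RB : MatrixMeasure) (DT : (ℝ → V3 → ℝ) → ℝ → ℝ) (DB : (ℝ → V3 → V3) → ℝ → ℝ),
    IsDMVSolutionWith G bd fl V V₀ RM RB DT DB

end MHD

end

namespace MHD

/-! ### Partial derivatives -/

/-! The proof is the relative energy method. The distance of a state `z` from the strong solution is
measured by `StrongPoint.relEnergy`: ½ϱ|u−U|² + ½|B−H|² plus the thermal part `Fluid.relThermal`,
which is the first-order Taylor remainder at (r,Θ) of ϱ(e−Θs) with Θ kept as a parameter; by Gibbs'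
equation the temperature derivative of this function vanishes at (r,Θ). Gibbs' equation and
thermodynamic stability make the thermal part strictly convex along a density path followed by a
temperature path. On a compact rectangle of positive densities and temperatures the whole relative
energy therefore dominates the squared distance (`StrongPoint.exists_relEnergy_coercive`).

The average of the relative energy is the ballistic energy with parameters Θ, H, minus the momentum
tested with U, plus the density tested with ½|U|² − (e−Θs+p/r), plus p(r,Θ)+½|H|². The ballistic
inequality, the momentum equation and the equation of continuity thus bound the relative energy at
time τ plus the dissipation defects by the integral of `StrongPoint.raw` and a multiple of the time
integral of the defects (`Comparison.exists_relEnergy_inequality`). The initial terms cancel because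
the initial Young measure sits at the initial state of the strong solution, and the concentration
measures are tested with the bounded field ∇U, so the defects dominate them.

`StrongPoint.raw` contains several terms whose integrals vanish: the three compatibility identities
tested with 𝕊, κ∇Θ/Θ and ζ curl H, the solenoidality tested with H·U, and the divergence of the
mechanical energy flux. They are added so that all first-order terms cancel pointwise once the
equations of the strong solution and Maxwell's relation are inserted (`StrongPoint.raw_eq`). The
rest is quadratic in the differences of states, together with four dissipative forms. Taylor
expansion and Young's inequality then give raw ≤ C·relEnergy − m·diss, where diss is the squared
distance of the gradients (`StrongPoint.exists_raw_bound`).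

Grönwall's inequality, applied to the relative energy plus the defects, gives zero
(`Comparison.ae_eq_zero_of_inequality`). Returning to the inequality, the average of raw is
nonpositive almost everywhere and has nonnegative integral, so it vanishes as well, and with it the
gradient distance. Hence the Young measure charges a single point.

Two classes of test functions need repair. The fluxes 𝕊, κ∇Θ/Θ, ζ curl H have continuous spatial
gradients but possibly no time derivative; `integral_eq_zero_of_frozen` tests with φ(t)Z(s,x) at
frozen s and recovers Z(t,x) by Bernstein approximation in time. The field H·U vanishes on ∂Ω
without having compact support in Ω; `exists_compactly_supported_approx` truncates its values. The
same truncation yields the divergence theorem for fields that vanish on the boundary, with no use of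
boundary smoothness. -/

theorem pd_eq_of_hasFDerivAt {f : V3 → ℝ} {f' : V3 →L[ℝ] ℝ} {x : V3} (h : HasFDerivAt f f' x)
    (j : Fin 3) : pd j f x = f' (Pi.single j 1) := by
  rw [pd, h.fderiv]

theorem pd_add {f g : V3 → ℝ} {x : V3} (hf : DifferentiableAt ℝ f x)
    (hg : DifferentiableAt ℝ g x) (j : Fin 3) :
    pd j (fun y => f y + g y) x = pd j f x + pd j g x := by
  rw [pd_eq_of_hasFDerivAt (hf.hasFDerivAt.fun_add hg.hasFDerivAt)]; rfl

theorem pd_sub {f g : V3 → ℝ} {x : V3} (hf : DifferentiableAt ℝ f x)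
    (hg : DifferentiableAt ℝ g x) (j : Fin 3) :
    pd j (fun y => f y - g y) x = pd j f x - pd j g x := by
  rw [pd_eq_of_hasFDerivAt (hf.hasFDerivAt.fun_sub hg.hasFDerivAt)]; rfl

theorem pd_mul {f g : V3 → ℝ} {x : V3} (hf : DifferentiableAt ℝ f x)
    (hg : DifferentiableAt ℝ g x) (j : Fin 3) :
    pd j (fun y => f y * g y) x = f x * pd j g x + g x * pd j f x := by
  rw [pd_eq_of_hasFDerivAt (hf.hasFDerivAt.fun_mul hg.hasFDerivAt)]; rfl

theorem pd_const (c : ℝ) (x : V3) (j : Fin 3) : pd j (fun _ => c) x = 0 := by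
  rw [pd_eq_of_hasFDerivAt (hasFDerivAt_const c x)]; rfl

theorem pd_const_mul (c : ℝ) {f : V3 → ℝ} {x : V3} (hf : DifferentiableAt ℝ f x) (j : Fin 3) :
    pd j (fun y => c * f y) x = c * pd j f x := by
  rw [pd_mul (differentiableAt_const c) hf, pd_const]; ring

theorem pd_congr {f g : V3 → ℝ} {x : V3} (h : f =ᶠ[𝓝 x] g) (j : Fin 3) : pd j f x = pd j g x := by
  rw [pd, pd, h.fderiv_eq]

theorem pd_comp {h : ℝ → ℝ} {f : V3 → ℝ} {x : V3} (hh : DifferentiableAt ℝ h (f x))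
    (hf : DifferentiableAt ℝ f x) (j : Fin 3) :
    pd j (fun y => h (f y)) x = deriv h (f x) * pd j f x := by
  rw [pd_eq_of_hasFDerivAt (f := fun y => h (f y))
    (hh.hasDerivAt.comp_hasFDerivAt x hf.hasFDerivAt)]; rfl

theorem fderiv_eq_zero_of_pd {f : V3 → ℝ} {x : V3} (h : fderiv ℝ f x = 0) (j : Fin 3) :
    pd j f x = 0 := by
  rw [pd, h]; rfl

/-! ### Space-time regularity -/

section Regularity

variable {F : Type*} [NormedAddCommGroup F] [NormedSpace ℝ F]

theorem IsC1.slice {f : ℝ → V3 → F} (hf : IsC1 f) (t : ℝ) : ContDiff ℝ 1 (f t) :=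
  ContDiff.comp (g := fun q : ℝ × V3 => f q.1 q.2) (f := fun x => (t, x)) hf (by fun_prop)

theorem IsC1.timeSlice {f : ℝ → V3 → F} (hf : IsC1 f) (x : V3) : ContDiff ℝ 1 fun t => f t x :=
  ContDiff.comp (g := fun q : ℝ × V3 => f q.1 q.2) (f := fun t => (t, x)) hf (by fun_prop)

theorem IsC1.continuous {f : ℝ → V3 → F} (hf : IsC1 f) : Continuous fun q : ℝ × V3 => f q.1 q.2 :=
  ContDiff.continuous hf

theorem IsC1.differentiableAt {f : ℝ → V3 → F} (hf : IsC1 f) (t : ℝ) (x : V3) :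
    DifferentiableAt ℝ (f t) x :=
  (hf.slice t).differentiable one_ne_zero x

theorem IsC1.differentiableAt_time {f : ℝ → V3 → F} (hf : IsC1 f) (t : ℝ) (x : V3) :
    DifferentiableAt ℝ (fun s => f s x) t :=
  (hf.timeSlice x).differentiable one_ne_zero t

theorem IsC1.hasFDerivAt {f : ℝ → V3 → F} (hf : IsC1 f) (q : ℝ × V3) :
    HasFDerivAt (fun q : ℝ × V3 => f q.1 q.2) (fderiv ℝ (fun q : ℝ × V3 => f q.1 q.2) q) q :=
  (ContDiff.differentiable hf one_ne_zero q).hasFDerivAt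

theorem IsC1.continuous_fderiv {f : ℝ → V3 → F} (hf : IsC1 f) :
    Continuous (fderiv ℝ fun q : ℝ × V3 => f q.1 q.2) :=
  ContDiff.continuous_fderiv hf one_ne_zero

end Regularity

theorem IsC1.pd_eq {f : ℝ → V3 → ℝ} (hf : IsC1 f) (j : Fin 3) (t : ℝ) (x : V3) :
    pd j (f t) x = fderiv ℝ (fun q : ℝ × V3 => f q.1 q.2) (t, x) (0, Pi.single j 1) := by
  have h := (hf.hasFDerivAt (t, x)).comp x (hasFDerivAt_prodMk_right t x)
  rw [pd_eq_of_hasFDerivAt (f := f t) h]; rfl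

theorem IsC1.dt_eq {f : ℝ → V3 → ℝ} (hf : IsC1 f) (t : ℝ) (x : V3) :
    dt f t x = fderiv ℝ (fun q : ℝ × V3 => f q.1 q.2) (t, x) (1, 0) := by
  have h := HasFDerivAt.comp (f := fun s : ℝ => (s, x)) t (hf.hasFDerivAt (t, x))
    (hasFDerivAt_prodMk_left t x)
  have h' := h.hasDerivAt.deriv
  simp only [ContinuousLinearMap.comp_apply, ContinuousLinearMap.inl_apply] at h'
  exact h'

theorem IsC1.continuous_pd {f : ℝ → V3 → ℝ} (hf : IsC1 f) (j : Fin 3) :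
    Continuous fun q : ℝ × V3 => pd j (f q.1) q.2 := by
  simp only [hf.pd_eq]
  exact hf.continuous_fderiv.clm_apply continuous_const

theorem IsC1.continuous_dt {f : ℝ → V3 → ℝ} (hf : IsC1 f) :
    Continuous fun q : ℝ × V3 => dt f q.1 q.2 := by
  simp only [hf.dt_eq]
  exact hf.continuous_fderiv.clm_apply continuous_const

theorem IsC1.mul {f g : ℝ → V3 → ℝ} (hf : IsC1 f) (hg : IsC1 g) :
    IsC1 fun t x => f t x * g t x := ContDiff.mul hf hg

theorem IsC1.add {f g : ℝ → V3 → ℝ} (hf : IsC1 f) (hg : IsC1 g) :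
    IsC1 fun t x => f t x + g t x := ContDiff.add hf hg

theorem IsC1.sub {f g : ℝ → V3 → ℝ} (hf : IsC1 f) (hg : IsC1 g) :
    IsC1 fun t x => f t x - g t x := ContDiff.sub hf hg

theorem IsC1.const (c : ℝ) : IsC1 fun _ _ => c := contDiff_const

theorem IsC1.sum {ι : Type*} {s : Finset ι} {f : ι → ℝ → V3 → ℝ} (hf : ∀ i, IsC1 (f i)) :
    IsC1 fun t x => ∑ i ∈ s, f i t x :=
  ContDiff.sum (f := fun i (q : ℝ × V3) => f i q.1 q.2) fun i _ => hf i

theorem IsC1.div {f g : ℝ → V3 → ℝ} (hf : IsC1 f) (hg : IsC1 g) (h : ∀ t x, g t x ≠ 0) :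
    IsC1 fun t x => f t x / g t x := ContDiff.div hf hg fun q => h q.1 q.2

theorem IsC1.apply {f : ℝ → V3 → V3} (hf : IsC1 f) (i : Fin 3) : IsC1 fun t x => f t x i :=
  contDiff_pi.1 hf i

theorem IsC1.pi {f : ℝ → V3 → V3} (hf : ∀ i, IsC1 fun t x => f t x i) : IsC1 f :=
  contDiff_pi.2 hf

theorem IsC1.dt_mul {f g : ℝ → V3 → ℝ} (hf : IsC1 f) (hg : IsC1 g) (t : ℝ) (x : V3) :
    dt (fun t x => f t x * g t x) t x = dt f t x * g t x + f t x * dt g t x :=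
  ((hf.differentiableAt_time t x).hasDerivAt.mul (hg.differentiableAt_time t x).hasDerivAt).deriv

theorem IsC1.dt_add {f g : ℝ → V3 → ℝ} (hf : IsC1 f) (hg : IsC1 g) (t : ℝ) (x : V3) :
    dt (fun t x => f t x + g t x) t x = dt f t x + dt g t x :=
  ((hf.differentiableAt_time t x).hasDerivAt.add (hg.differentiableAt_time t x).hasDerivAt).deriv

theorem IsC1.dt_sub {f g : ℝ → V3 → ℝ} (hf : IsC1 f) (hg : IsC1 g) (t : ℝ) (x : V3) :
    dt (fun t x => f t x - g t x) t x = dt f t x - dt g t x :=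
  ((hf.differentiableAt_time t x).hasDerivAt.sub (hg.differentiableAt_time t x).hasDerivAt).deriv

/-- `C¹` composition with a constitutive function. -/
theorem IsC1.comp_quadrant {h : ℝ → ℝ → ℝ} (hh : C1Quad h) {r θ : ℝ → V3 → ℝ} (hr : IsC1 r)
    (hθ : IsC1 θ) (rpos : ∀ t x, 0 < r t x) (θpos : ∀ t x, 0 < θ t x) :
    IsC1 fun t x => h (r t x) (θ t x) := by
  have h1 : ContDiff ℝ 1 fun q : ℝ × V3 => (r q.1 q.2, θ q.1 q.2) := ContDiff.prodMk hr hθ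
  rw [IsC1, ← contDiffOn_univ] at *
  exact ContDiffOn.comp (g := fun q : ℝ × ℝ => h q.1 q.2) hh h1
    (fun q _ => ⟨rpos q.1 q.2, θpos q.1 q.2⟩)

/-- Continuous space-time functions whose spatial gradient exists and is continuous. -/
structure IsC01 (f : ℝ → V3 → ℝ) : Prop where
  continuous : Continuous fun q : ℝ × V3 => f q.1 q.2
  slice : ∀ t, ContDiff ℝ 1 (f t)
  continuous_pd : ∀ j, Continuous fun q : ℝ × V3 => pd j (f q.1) q.2

theorem IsC1.isC01 {f : ℝ → V3 → ℝ} (hf : IsC1 f) : IsC01 f :=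
  ⟨hf.continuous, hf.slice, hf.continuous_pd⟩

theorem IsC01.differentiableAt {f : ℝ → V3 → ℝ} (hf : IsC01 f) (t : ℝ) (x : V3) :
    DifferentiableAt ℝ (f t) x :=
  (hf.slice t).differentiable one_ne_zero x

theorem IsC01.mul {f g : ℝ → V3 → ℝ} (hf : IsC01 f) (hg : IsC01 g) :
    IsC01 fun t x => f t x * g t x := by
  refine ⟨hf.continuous.mul hg.continuous, fun t => (hf.slice t).mul (hg.slice t), fun j => ?_⟩
  simp only [pd_mul (hf.differentiableAt _ _) (hg.differentiableAt _ _)]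
  exact (hf.continuous.mul (hg.continuous_pd j)).add (hg.continuous.mul (hf.continuous_pd j))

theorem IsC01.add {f g : ℝ → V3 → ℝ} (hf : IsC01 f) (hg : IsC01 g) :
    IsC01 fun t x => f t x + g t x := by
  refine ⟨hf.continuous.add hg.continuous, fun t => (hf.slice t).add (hg.slice t), fun j => ?_⟩
  simp only [pd_add (hf.differentiableAt _ _) (hg.differentiableAt _ _)]
  exact (hf.continuous_pd j).add (hg.continuous_pd j)

theorem IsC01.const (c : ℝ) : IsC01 fun _ _ => c := (IsC1.const c).isC01

theorem IsC01.sub {f g : ℝ → V3 → ℝ} (hf : IsC01 f) (hg : IsC01 g) :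
    IsC01 fun t x => f t x - g t x := by
  simpa [sub_eq_add_neg] using hf.add ((IsC01.const (-1)).mul hg)

theorem IsC01.sum {ι : Type*} [Fintype ι] {f : ι → ℝ → V3 → ℝ} (hf : ∀ i, IsC01 (f i)) :
    IsC01 fun t x => ∑ i, f i t x := by
  classical
  have key : ∀ s : Finset ι, IsC01 fun t x => ∑ i ∈ s, f i t x := by
    intro s
    induction s using Finset.induction_on with
    | empty => simpa using IsC01.const 0
    | insert a s ha ih => simpa [Finset.sum_insert ha] using (hf a).add ih
  exact key _

theorem IsC12.apply {f : ℝ → V3 → V3} (hf : IsC12 f) (i : Fin 3) : IsC12 fun t x => f t x i := by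
  refine ⟨hf.1.apply i, fun t => contDiff_pi.1 (hf.2.1 t) i, ?_⟩
  let P : V3 →L[ℝ] ℝ := ContinuousLinearMap.proj i
  have h1 : ∀ t, (fun y => fderiv ℝ (fun x => f t x i) y)
      = fun y => ContinuousLinearMap.compL ℝ V3 V3 ℝ P (fderiv ℝ (f t) y) := by
    intro t; funext y
    have hd := ((hf.2.1 t).differentiable two_ne_zero y).hasFDerivAt
    exact (P.hasFDerivAt.comp y hd).fderiv
  have h2 : ∀ t y, fderiv ℝ (fun y => fderiv ℝ (fun x => f t x i) y) y
      = (ContinuousLinearMap.compL ℝ V3 V3 ℝ P).comp (fderiv ℝ (fun y => fderiv ℝ (f t) y) y) := by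
    intro t y
    rw [h1]
    have hd : DifferentiableAt ℝ (fun y => fderiv ℝ (f t) y) y :=
      (((hf.2.1 t).fderiv_right (m := 1) (by norm_num)).differentiable one_ne_zero) y
    exact ((ContinuousLinearMap.compL ℝ V3 V3 ℝ P).hasFDerivAt.comp y hd.hasFDerivAt).fderiv
  simp only [h2]
  exact continuous_const.clm_comp hf.2.2

theorem IsC12.pd_pd_eq {f : ℝ → V3 → ℝ} (hf : IsC12 f) (j k : Fin 3) (t : ℝ) (x : V3) :
    pd k (fun y => pd j (f t) y) x
      = fderiv ℝ (fun y => fderiv ℝ (f t) y) x (Pi.single k 1) (Pi.single j 1) := by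
  have hd : DifferentiableAt ℝ (fun y => fderiv ℝ (f t) y) x :=
    (((hf.2.1 t).fderiv_right (m := 1) (by norm_num)).differentiable one_ne_zero) x
  have := (hd.hasFDerivAt).clm_apply (hasFDerivAt_const (Pi.single j (1 : ℝ) : V3) x)
  rw [pd_eq_of_hasFDerivAt (f := fun y => pd j (f t) y) this]
  simp

/-- First spatial derivatives of a `C^{1,2}` field need not be differentiable in time. `IsC01` is
therefore all that the stress, the entropy flux and the resistive electric field of a strong
solution inherit. -/
theorem IsC12.isC01_pd {f : ℝ → V3 → ℝ} (hf : IsC12 f) (j : Fin 3) :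
    IsC01 fun t x => pd j (f t) x := by
  refine ⟨hf.1.continuous_pd j, fun t => ?_, fun k => ?_⟩
  · exact ((hf.2.1 t).fderiv_right (m := 1) (by norm_num)).clm_apply contDiff_const
  · simp only [hf.pd_pd_eq]
    exact (hf.2.2.clm_apply continuous_const).clm_apply continuous_const

/-! ### Fields that vanish on the boundary -/

/-- The derivative of a `C¹` function vanishes almost everywhere on its zero set. -/
theorem ae_fderiv_eq_zero_of_eq_zero {W : V3 → ℝ} (hW : ContDiff ℝ 1 W) :
    ∀ᵐ x ∂(volume : Measure V3), W x = 0 → fderiv ℝ W x = 0 := by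
  have hs : MeasurableSet {x | W x = 0} := (isClosed_eq hW.continuous continuous_const).measurableSet
  let v : V3 := Pi.single 0 1
  have hv : v ≠ 0 := by simp [v]
  -- On the zero set the zero map is an exact linear approximation, and almost everywhere on a
  -- measurable set such a bound passes to the derivative. That principle concerns maps of a space
  -- into itself, so `W` is multiplied by a fixed nonzero vector.
  have happ : ApproximatesLinearOn (fun x => W x • v) (0 : V3 →L[ℝ] V3) {x | W x = 0} 0 := by
    intro x hx y hy
    simp only [mem_ofPred_eq] at hx hy
    simp [hx, hy]
  have h := happ.norm_fderiv_sub_le (μ := volume) hs (fun x => (fderiv ℝ W x).smulRight v)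
    (fun x _ => ((hW.differentiable one_ne_zero x).hasFDerivAt.smul_const v).hasFDerivWithinAt)
  rw [ae_restrict_iff' hs] at h
  filter_upwards [h] with x hx h0
  have h1 : (fderiv ℝ W x).smulRight v = 0 := by
    have := hx h0
    rw [sub_zero] at this
    exact nnnorm_eq_zero.1 (le_antisymm this zero_le)
  ext y
  have h2 : fderiv ℝ W x y • v = 0 := by
    have := congrArg (fun L : V3 →L[ℝ] V3 => L y) h1
    simpa using this
  simpa [hv] using h2

/-- A smooth function that vanishes near `0` and is the identity far from `0`. -/
noncomputable def truncation (s : ℝ) : ℝ := s * Real.smoothTransition (s ^ 2 - 1)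

theorem contDiff_truncation : ContDiff ℝ 1 truncation := by
  have : ContDiff ℝ 1 Real.smoothTransition := Real.smoothTransition.contDiff
  unfold truncation
  exact contDiff_id.mul (this.comp (by fun_prop))

theorem truncation_eq_zero {s : ℝ} (hs : |s| ≤ 1) : truncation s = 0 := by
  have : s ^ 2 - 1 ≤ 0 := by nlinarith [abs_nonneg s, sq_abs s]
  simp [truncation, Real.smoothTransition.zero_of_nonpos this]

theorem truncation_eq_self {s : ℝ} (hs : 2 ≤ |s|) : truncation s = s := by
  have : 1 ≤ s ^ 2 - 1 := by nlinarith [abs_nonneg s, sq_abs s]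
  simp [truncation, Real.smoothTransition.one_of_one_le this]

theorem deriv_truncation_zero : deriv truncation 0 = 0 := by
  have : truncation =ᶠ[𝓝 0] fun _ => 0 := by
    filter_upwards [Metric.ball_mem_nhds (0 : ℝ) one_pos] with s hs
    exact truncation_eq_zero (by simpa using (mem_ball_zero_iff.1 hs).le)
  rw [this.deriv_eq, deriv_const]

theorem deriv_truncation_eq_one {s : ℝ} (hs : 2 < |s|) : deriv truncation s = 1 := by
  have : truncation =ᶠ[𝓝 s] fun s => s := by
    filter_upwards [(isOpen_lt continuous_const continuous_abs).mem_nhds hs] with y hy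
    exact truncation_eq_self (le_of_lt hy)
  rw [this.deriv_eq, deriv_id'']

theorem exists_bound_deriv_truncation : ∃ C, ∀ s, |deriv truncation s| ≤ C := by
  obtain ⟨C, hC⟩ := (isCompact_Icc (a := (-2 : ℝ)) (b := 2)).exists_bound_of_continuousOn
    (contDiff_truncation.continuous_deriv le_rfl).continuousOn
  refine ⟨max C 1, fun s => ?_⟩
  by_cases hs : 2 < |s|
  · simp [deriv_truncation_eq_one hs]
  · exact (hC s (abs_le.1 (not_lt.1 hs))).trans (le_max_left _ _)

/-- Truncate the values of `W`, not its domain: with η the truncation and c = n+1, the function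
c⁻¹η(cW) vanishes wherever |W| < 1/c, in particular near the boundary, and its gradient is η'(cW)∇W.
This is bounded uniformly in n. Where W ≠ 0 it eventually equals ∇W; where W = 0 it is zero, and so
is ∇W almost everywhere on that set. -/
theorem exists_compactly_supported_approx {Ω : Set V3} (hΩ : IsOpen Ω)
    (hb : Bornology.IsBounded Ω) {W : V3 → ℝ} (hW : ContDiff ℝ 1 W)
    (h0 : ∀ x ∈ frontier Ω, W x = 0) :
    ∃ Wn : ℕ → V3 → ℝ, (∀ n, ContDiff ℝ 1 (Wn n)) ∧
      (∀ n, ∃ K, IsCompact K ∧ K ⊆ Ω ∧ ∀ x ∉ K, Wn n x = 0) ∧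
      (∃ C, ∀ n, ∀ x ∈ Ω, ∀ j, |pd j (Wn n) x| ≤ C) ∧
      ∀ᵐ x ∂volume.restrict Ω, ∀ j, Tendsto (fun n => pd j (Wn n) x) atTop (𝓝 (pd j W x)) := by
  classical
  let c : ℕ → ℝ := fun n => n + 1
  have hc : ∀ n, 0 < c n := fun n => by positivity
  let T : ℕ → V3 → ℝ := fun n x => (c n)⁻¹ * truncation (c n * W x)
  have hT : ∀ n, ContDiff ℝ 1 (T n) := fun n =>
    contDiff_const.mul (contDiff_truncation.comp (contDiff_const.mul hW))
  have hT0 : ∀ n x, |W x| < (c n)⁻¹ → T n x = 0 := by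
    intro n x hx
    have : |c n * W x| ≤ 1 := by
      rw [abs_mul, abs_of_pos (hc n)]
      calc c n * |W x| ≤ c n * (c n)⁻¹ := by gcongr
        _ = 1 := mul_inv_cancel₀ (hc n).ne'
    simp [T, truncation_eq_zero this]
  have hpdT : ∀ n x j, pd j (T n) x = deriv truncation (c n * W x) * pd j W x := by
    intro n x j
    have hWd := hW.differentiable one_ne_zero x
    have htd : ∀ s, DifferentiableAt ℝ truncation s := contDiff_truncation.differentiable one_ne_zero
    have h1 : DifferentiableAt ℝ (fun y => c n * W y) x := hWd.const_mul _
    have h2 : DifferentiableAt ℝ (fun y => truncation (c n * W y)) x := (htd _).comp x h1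
    simp only [T]
    rw [pd_const_mul _ h2, pd_comp (f := fun y => c n * W y) (htd _) h1, pd_const_mul _ hWd]
    field_simp [(hc n).ne']
  have hin : ∀ n, ∀ x ∈ Ω, Ω.indicator (T n) =ᶠ[𝓝 x] T n := fun n x hx => by
    filter_upwards [hΩ.mem_nhds hx] with y hy
    simp [hy]
  refine ⟨fun n => Ω.indicator (T n), fun n => ?_, fun n => ?_, ?_, ?_⟩
  · rw [contDiff_iff_contDiffAt]
    intro x
    by_cases hx : x ∈ Ω
    · exact (hT n).contDiffAt.congr_of_eventuallyEq (hin n x hx)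
    -- Near a boundary point the truncated function is already zero, so extension by zero outside Ω
    -- keeps it `C¹` whatever the boundary looks like.
    · have : Ω.indicator (T n) =ᶠ[𝓝 x] fun _ => 0 := by
        by_cases hx' : x ∈ closure Ω
        · have hfr : W x = 0 := h0 x ⟨hx', by rwa [hΩ.interior_eq]⟩
          have : ∀ᶠ y in 𝓝 x, |W y| < (c n)⁻¹ :=
            hW.continuous.abs.continuousAt.eventually_lt_const (by simp [hfr, hc n])
          filter_upwards [this] with y hy
          simp [indicator, hT0 n y hy]
        · filter_upwards [isClosed_closure.isOpen_compl.mem_nhds hx'] with y hy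
          exact indicator_of_notMem (fun h => hy (subset_closure h)) _
      exact contDiffAt_const.congr_of_eventuallyEq this
  · refine ⟨closure Ω ∩ {x | (c n)⁻¹ ≤ |W x|}, ?_, ?_, ?_⟩
    · exact (hb.isCompact_closure).inter_right (isClosed_le continuous_const hW.continuous.abs)
    · rintro x ⟨hx, hx'⟩
      by_contra hn
      have hfr : W x = 0 := h0 x ⟨hx, by rwa [hΩ.interior_eq]⟩
      simp only [mem_ofPred_eq, hfr, abs_zero] at hx'
      exact absurd (inv_pos.2 (hc n)) (not_lt.2 hx')
    · intro x hx
      by_cases hxΩ : x ∈ Ω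
      · have : |W x| < (c n)⁻¹ := by
          by_contra h
          exact hx ⟨subset_closure hxΩ, not_lt.1 h⟩
        simp [hxΩ, hT0 n x this]
      · simp [hxΩ]
  · obtain ⟨C, hC⟩ := exists_bound_deriv_truncation
    have hWb : ∀ j, ∃ D, ∀ x ∈ closure Ω, ‖pd j W x‖ ≤ D := fun j =>
      hb.isCompact_closure.exists_bound_of_continuousOn
        (((hW.continuous_fderiv one_ne_zero).clm_apply continuous_const).continuousOn)
    choose D hD using hWb
    refine ⟨∑ j, |C| * |D j|, fun n x hx j => ?_⟩
    rw [pd_congr (hin n x hx), hpdT, abs_mul]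
    calc _ ≤ |C| * |D j| :=
          mul_le_mul ((hC _).trans (le_abs_self _))
            ((hD j x (subset_closure hx)).trans (le_abs_self _)) (abs_nonneg _) (abs_nonneg _)
      _ ≤ _ := Finset.single_le_sum (f := fun j => |C| * |D j|) (fun i _ => by positivity)
          (Finset.mem_univ j)
  · filter_upwards [ae_restrict_of_ae (ae_fderiv_eq_zero_of_eq_zero hW),
      ae_restrict_mem hΩ.measurableSet] with x hx hxΩ j
    simp_rw [pd_congr (hin _ x hxΩ), hpdT]
    by_cases hWx : W x = 0
    · simp [hWx, deriv_truncation_zero, fderiv_eq_zero_of_pd (hx hWx)]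
    · refine tendsto_const_nhds.congr' ?_
      have hlim : Tendsto (fun n : ℕ => ((n : ℝ) + 1) * |W x|) atTop atTop :=
        (tendsto_natCast_atTop_atTop.atTop_add tendsto_const_nhds).atTop_mul_const
          (abs_pos.2 hWx)
      filter_upwards [hlim.eventually_gt_atTop 2] with n hn
      rw [deriv_truncation_eq_one, one_mul]
      rw [abs_mul, abs_of_pos (hc n)]
      exact hn

theorem integral_pd_eq_zero_of_compact {W : V3 → ℝ} (hW : ContDiff ℝ 1 W)
    (hs : HasCompactSupport W) (j : Fin 3) : ∫ x, pd j W x = 0 := by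
  have hpd : Continuous fun x => pd j W x :=
    (hW.continuous_fderiv one_ne_zero).clm_apply continuous_const
  have hsupp : HasCompactSupport fun x => pd j W x :=
    (hs.fderiv ℝ).comp_left (g := fun L : V3 →L[ℝ] ℝ => L (Pi.single j 1)) rfl
  -- Integration by parts against the constant function 1.
  have := integral_bilinear_hasFDerivAt_right_eq_neg_left_of_integrable (μ := (volume : Measure V3))
    (f := fun _ => (1 : ℝ)) (f' := fun _ => 0) (g := W) (g' := fun x => fderiv ℝ W x)
    (v := Pi.single j 1) (B := ContinuousLinearMap.mul ℝ ℝ)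
    (by simp) (by simpa [pd] using hpd.integrable_of_hasCompactSupport hsupp)
    (by simpa using hW.continuous.integrable_of_hasCompactSupport hs)
    (fun x _ => hasFDerivAt_const _ x) (fun x _ => (hW.differentiable one_ne_zero x).hasFDerivAt)
  simpa [pd] using this

/-- The divergence theorem for functions that vanish on the boundary. -/
theorem integral_pd_eq_zero {Ω : Set V3} (hΩ : IsOpen Ω)
    (hb : Bornology.IsBounded Ω) {W : V3 → ℝ} (hW : ContDiff ℝ 1 W)
    (h0 : ∀ x ∈ frontier Ω, W x = 0) (j : Fin 3) : ∫ x in Ω, pd j W x = 0 := by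
  obtain ⟨Wn, h1, h2, ⟨C, hC⟩, h4⟩ := exists_compactly_supported_approx hΩ hb hW h0
  have hz : ∀ n, ∫ x in Ω, pd j (Wn n) x = 0 := by
    intro n
    obtain ⟨K, hK, hKΩ, hKz⟩ := h2 n
    rw [setIntegral_eq_integral_of_forall_compl_eq_zero]
    · exact integral_pd_eq_zero_of_compact (h1 n)
        (HasCompactSupport.intro hK hKz) j
    · intro x hx
      have : Wn n =ᶠ[𝓝 x] fun _ => 0 := by
        filter_upwards [hK.isClosed.isOpen_compl.mem_nhds (fun h => hx (hKΩ h))] with y hy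
        exact hKz y hy
      rw [pd_congr this, pd_const]
  have hfin : volume Ω ≠ ⊤ := hb.measure_lt_top.ne
  have hlim := tendsto_integral_of_dominated_convergence (μ := volume.restrict Ω)
    (F := fun n x => pd j (Wn n) x) (f := fun x => pd j W x) (fun _ => C)
    (fun n => (((h1 n).continuous_fderiv one_ne_zero).clm_apply
      continuous_const).aestronglyMeasurable)
    (integrableOn_const hfin)
    (fun n => by
      filter_upwards [ae_restrict_mem hΩ.measurableSet] with x hx
      exact hC n x hx j)
    (by filter_upwards [h4] with x hx using hx j)
  simp only [hz] at hlim
  exact tendsto_nhds_unique hlim tendsto_const_nhds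

/-! ### Localisation in time -/

/-- Bernstein's theorem rescaled to [0,T]. Its use is that only the values at countably many fixed
nodes enter, so that countably many null sets of times have to be discarded. -/
theorem tendsto_bernstein_sum {f : ℝ → ℝ} (hf : Continuous f) {T : ℝ} (hT : 0 < T) {t : ℝ}
    (ht : t ∈ Icc 0 T) :
    Tendsto (fun n : ℕ => ∑ m : Fin (n + 1),
      bernstein n m ⟨t / T, div_nonneg ht.1 hT.le, div_le_one_of_le₀ ht.2 hT.le⟩
        * f (T * (bernstein.z m : ℝ))) atTop (𝓝 (f t)) := by
  let x : unitInterval := ⟨t / T, div_nonneg ht.1 hT.le, div_le_one_of_le₀ ht.2 hT.le⟩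
  let g : C(unitInterval, ℝ) := ⟨fun s => f (T * s), by fun_prop⟩
  have h := bernsteinApproximation_uniform g
  have h2 := ((continuous_eval_const (F := C(unitInterval, ℝ)) x).tendsto g).comp h
  have hx : g x = f t := by
    simp only [g, x, ContinuousMap.coe_mk]
    congr 1
    field_simp
  rw [hx] at h2
  refine h2.congr fun n => ?_
  simp only [Function.comp, bernsteinApproximation.apply, smul_eq_mul]
  rfl

theorem setIntegral_prod_slices {Ω : Set V3} {T τ : ℝ} (hτ : τ ≤ T) {f : ℝ × V3 → ℝ}
    (hf : Integrable f (volume.restrict (Ioo 0 T ×ˢ Ω))) :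
    ∫ q in Ioo 0 τ ×ˢ Ω, f q = ∫ t in Ioo 0 τ, ∫ x in Ω, f (t, x) :=
  setIntegral_prod f
    (IntegrableOn.mono_set hf (prod_mono (Ioo_subset_Ioo_right hτ) Subset.rfl))

theorem ae_integrable_slice {Ω : Set V3} {I : Set ℝ} {f : ℝ × V3 → ℝ}
    (hf : Integrable f (volume.restrict (I ×ˢ Ω))) :
    ∀ᵐ t ∂volume.restrict I, Integrable (fun x => f (t, x)) (volume.restrict Ω) := by
  rw [Measure.volume_eq_prod, ← Measure.prod_restrict] at hf
  exact hf.prod_right_ae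

theorem integrable_slice_integral {Ω : Set V3} {I : Set ℝ} {f : ℝ × V3 → ℝ}
    (hf : Integrable f (volume.restrict (I ×ˢ Ω))) :
    Integrable (fun t => ∫ x in Ω, f (t, x)) (volume.restrict I) := by
  rw [Measure.volume_eq_prod, ← Measure.prod_restrict] at hf
  exact hf.integral_prod_left

/-- Products of an integrable function with a continuous coefficient on a bounded cylinder. -/
theorem integrable_mul_continuous {Ω : Set V3} (hb : Bornology.IsBounded Ω)
    {T : ℝ} {μ : Measure (ℝ × V3)} {a b : ℝ × V3 → ℝ}
    (hμ : ∀ᵐ q ∂μ, q ∈ Ioo 0 T ×ˢ Ω) (ha : Integrable a μ) (hc : Continuous b) :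
    Integrable (fun q => a q * b q) μ := by
  obtain ⟨C, hC⟩ := (isCompact_Icc.prod hb.isCompact_closure).exists_bound_of_continuousOn
    (s := Icc 0 T ×ˢ closure Ω) hc.continuousOn
  refine ha.mul_bdd (c := C) hc.aestronglyMeasurable ?_
  filter_upwards [hμ] with q hq
  exact hC q ⟨Ioo_subset_Icc_self hq.1, subset_closure hq.2⟩

/-- A linear relation that holds for products of a test function of time with frozen coefficients
holds for time dependent coefficients, on every time interval. -/
theorem integral_eq_zero_of_frozen {Ω : Set V3} (hΩ : IsOpen Ω) (hb : Bornology.IsBounded Ω)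
    {T : ℝ} (hT : 0 < T) {κ : Type*} [Fintype κ] {a : κ → ℝ × V3 → ℝ}
    (ha : ∀ k, Integrable (a k) (volume.restrict (Ioo 0 T ×ˢ Ω)))
    {z : κ → ℝ → V3 → ℝ} (hz : ∀ k, Continuous fun q : ℝ × V3 => z k q.1 q.2)
    (h : ∀ s ∈ Icc 0 T, ∀ φ : ℝ → ℝ, ContDiff ℝ ∞ φ →
      ∫ q in Ioo 0 T ×ˢ Ω, φ q.1 * ∑ k, a k q * z k s q.2 = 0)
    {τ : ℝ} (hτ : τ ≤ T) :
    ∫ q in Ioo 0 τ ×ˢ Ω, ∑ k, a k q * z k q.1 q.2 = 0 := by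
  have hmem : ∀ᵐ q ∂(volume : Measure (ℝ × V3)).restrict (Ioo 0 T ×ˢ Ω), q ∈ Ioo 0 T ×ˢ Ω :=
    ae_restrict_mem (measurableSet_Ioo.prod hΩ.measurableSet)
  have hint : ∀ k, ∀ b : ℝ × V3 → ℝ, Continuous b →
      Integrable (fun q => a k q * b q) (volume.restrict (Ioo 0 T ×ˢ Ω)) :=
    fun k b hc => integrable_mul_continuous hb hmem (ha k) hc
  have hzs : ∀ k s, Continuous fun q : ℝ × V3 => z k s q.2 := fun k s =>
    (hz k).comp (by fun_prop : Continuous fun q : ℝ × V3 => (s, q.2))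
  -- For fixed s, varying φ localises the relation in time. The exceptional null set of times
  -- depends on s.
  have frozen : ∀ s ∈ Icc 0 T, ∀ᵐ t ∂volume.restrict (Ioo 0 T),
      ∫ x in Ω, ∑ k, a k (t, x) * z k s x = 0 := by
    intro s hs
    have hi : Integrable (fun q : ℝ × V3 => ∑ k, a k q * z k s q.2)
        (volume.restrict (Ioo 0 T ×ˢ Ω)) :=
      integrable_finsetSum _ fun k _ => hint k _ (hzs k s)
    have hF := integrable_slice_integral hi
    rw [ae_restrict_iff' measurableSet_Ioo]
    refine isOpen_Ioo.ae_eq_zero_of_integral_contDiff_smul_eq_zero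
      (IntegrableOn.locallyIntegrableOn hF) ?_
    intro φ hφ hφc hφs
    have h1 := h s hs φ hφ
    have hi2 : Integrable (fun q : ℝ × V3 => φ q.1 * ∑ k, a k q * z k s q.2)
        (volume.restrict (Ioo 0 T ×ˢ Ω)) := by
      have := integrable_mul_continuous hb hmem hi
        (hφ.continuous.comp continuous_fst : Continuous fun q : ℝ × V3 => φ q.1)
      exact this.congr (ae_of_all _ fun q => mul_comm _ _)
    rw [setIntegral_prod_slices le_rfl hi2] at h1
    simp only [integral_const_mul] at h1
    rw [← h1, setIntegral_eq_integral_of_forall_compl_eq_zero]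
    · rfl
    · intro t ht
      rw [image_eq_zero_of_notMem_tsupport (fun h' => ht (hφs h')), zero_mul]
  -- Restricting s to the Bernstein nodes leaves countably many exceptional sets, so a single null
  -- set serves all of them.
  have frozen_all : ∀ᵐ t ∂volume.restrict (Ioo 0 T), ∀ n : ℕ, ∀ m : Fin (n + 1),
      ∫ x in Ω, ∑ k, a k (t, x) * z k (T * (bernstein.z m : ℝ)) x = 0 := by
    rw [ae_all_iff]; intro n
    rw [ae_all_iff]; intro m
    refine frozen _ ⟨mul_nonneg hT.le (bernstein.z m).2.1, ?_⟩
    exact mul_le_of_le_one_right hT.le (bernstein.z m).2.2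
  have hslice : ∀ᵐ t ∂volume.restrict (Ioo 0 T), ∀ k,
      Integrable (fun x => a k (t, x)) (volume.restrict Ω) :=
    ae_all_iff.2 fun k => ae_integrable_slice (ha k)
  have main : ∀ᵐ t ∂volume.restrict (Ioo 0 T), ∫ x in Ω, ∑ k, a k (t, x) * z k t x = 0 := by
    filter_upwards [frozen_all, hslice, ae_restrict_mem measurableSet_Ioo] with t h1 h2 ht
    have ht' : t ∈ Icc 0 T := Ioo_subset_Icc_self ht
    let y : unitInterval := ⟨t / T, div_nonneg ht'.1 hT.le, div_le_one_of_le₀ ht'.2 hT.le⟩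
    have hbd : ∀ k, ∃ C, ∀ q ∈ Icc 0 T ×ˢ closure Ω, ‖z k q.1 q.2‖ ≤ C := fun k =>
      (isCompact_Icc.prod hb.isCompact_closure).exists_bound_of_continuousOn (hz k).continuousOn
    choose C hC using hbd
    have hIn : ∀ s, ∀ k, Integrable (fun x => a k (t, x) * z k s x) (volume.restrict Ω) := by
      intro s k
      obtain ⟨D, hD⟩ := hb.isCompact_closure.exists_bound_of_continuousOn
        (f := z k s) ((hz k).comp (by fun_prop : Continuous fun x : V3 => (s, x))).continuousOn
      refine (h2 k).mul_bdd (c := D) ((hz k).comp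
        (by fun_prop : Continuous fun x : V3 => (s, x))).aestronglyMeasurable ?_
      filter_upwards [ae_restrict_mem hΩ.measurableSet] with x hx
      exact hD x (subset_closure hx)
    -- At a good time t, a linear combination of the frozen relations with weights independent of x
    -- gives the relation for the Bernstein approximation of the coefficients at time t.
    have hn : ∀ n : ℕ, ∫ x in Ω, ∑ k, a k (t, x) * ∑ m : Fin (n + 1),
        bernstein n m y * z k (T * (bernstein.z m : ℝ)) x = 0 := by
      intro n
      have : ∀ x, ∑ k, a k (t, x) * ∑ m : Fin (n + 1),
          bernstein n m y * z k (T * (bernstein.z m : ℝ)) x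
          = ∑ m : Fin (n + 1), bernstein n m y *
            ∑ k, a k (t, x) * z k (T * (bernstein.z m : ℝ)) x := by
        intro x
        simp only [Finset.mul_sum]
        rw [Finset.sum_comm]
        exact Finset.sum_congr rfl fun _ _ => Finset.sum_congr rfl fun _ _ => by ring
      simp only [this]
      rw [integral_finsetSum]
      · simp only [integral_const_mul, h1, mul_zero, Finset.sum_const_zero]
      · intro m _
        exact (integrable_finsetSum _ fun k _ => hIn _ k).const_mul _
    have hlim := tendsto_integral_of_dominated_convergence (μ := volume.restrict Ω)
      (F := fun (n : ℕ) x => ∑ k, a k (t, x) * ∑ m : Fin (n + 1),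
        bernstein n m y * z k (T * (bernstein.z m : ℝ)) x)
      (f := fun x => ∑ k, a k (t, x) * z k t x)
      (fun x => ∑ k, ‖a k (t, x)‖ * C k) ?_ ?_ ?_ ?_
    · simp only [hn] at hlim
      exact tendsto_nhds_unique hlim tendsto_const_nhds
    · intro n
      refine Finset.aestronglyMeasurable_fun_sum _ fun k _ =>
        (h2 k).aestronglyMeasurable.mul (Continuous.aestronglyMeasurable ?_)
      refine continuous_finsetSum _ fun m _ => continuous_const.mul ?_
      exact (hz k).comp (by fun_prop : Continuous fun x : V3 => (T * (bernstein.z m : ℝ), x))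
    · exact integrable_finsetSum _ fun k _ => (h2 k).norm.mul_const _
    · intro n
      filter_upwards [ae_restrict_mem hΩ.measurableSet] with x hx
      refine (norm_sum_le _ _).trans (Finset.sum_le_sum fun k _ => ?_)
      rw [norm_mul]
      gcongr
      calc _ ≤ ∑ m : Fin (n + 1), bernstein n m y * C k := by
            refine (norm_sum_le _ _).trans (Finset.sum_le_sum fun m _ => ?_)
            rw [norm_mul, Real.norm_of_nonneg bernstein_nonneg]
            gcongr
            exact hC k (_, x) ⟨⟨mul_nonneg hT.le (bernstein.z m).2.1,
                mul_le_of_le_one_right hT.le (bernstein.z m).2.2⟩, subset_closure hx⟩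
        _ = C k := by rw [← Finset.sum_mul, bernstein.probability, one_mul]
    · refine ae_of_all _ fun x => tendsto_finsetSum _ fun k _ => tendsto_const_nhds.mul ?_
      exact tendsto_bernstein_sum (f := fun s => z k s x)
        ((hz k).comp (by fun_prop : Continuous fun s : ℝ => (s, x))) hT ht'
  have hi : Integrable (fun q : ℝ × V3 => ∑ k, a k q * z k q.1 q.2)
      (volume.restrict (Ioo 0 T ×ˢ Ω)) :=
    integrable_finsetSum _ fun k _ => hint k _ (hz k)
  rw [setIntegral_prod_slices hτ hi]
  have : ∀ᵐ t ∂volume.restrict (Ioo 0 τ), ∫ x in Ω, ∑ k, a k (t, x) * z k t x = 0 :=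
    ae_mono (Measure.restrict_mono (Ioo_subset_Ioo_right hτ) le_rfl) main
  rw [integral_congr_ae this, integral_zero]

/-! ### Constitutive functions -/

/-- The derivative of a constitutive function with respect to the density. -/
noncomputable def d1 (f : ℝ → ℝ → ℝ) (ρ θ : ℝ) : ℝ :=
  fderiv ℝ (fun q : ℝ × ℝ => f q.1 q.2) (ρ, θ) (1, 0)

/-- The derivative of a constitutive function with respect to the temperature. -/
noncomputable def d2 (f : ℝ → ℝ → ℝ) (ρ θ : ℝ) : ℝ :=
  fderiv ℝ (fun q : ℝ × ℝ => f q.1 q.2) (ρ, θ) (0, 1)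

theorem isOpen_quadrant : IsOpen quadrant := isOpen_Ioi.prod isOpen_Ioi

section

variable {f : ℝ → ℝ → ℝ}

theorem C1Quad.hasFDerivAt (hf : C1Quad f) {ρ θ : ℝ} (hρ : 0 < ρ) (hθ : 0 < θ) :
    HasFDerivAt (fun q : ℝ × ℝ => f q.1 q.2)
      (fderiv ℝ (fun q : ℝ × ℝ => f q.1 q.2) (ρ, θ)) (ρ, θ) :=
  ((ContDiffOn.contDiffAt hf (isOpen_quadrant.mem_nhds
    (show (ρ, θ) ∈ quadrant from ⟨hρ, hθ⟩))).differentiableAt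
    one_ne_zero).hasFDerivAt

theorem C1Quad.fderiv_apply (f : ℝ → ℝ → ℝ) (ρ θ a b : ℝ) :
    fderiv ℝ (fun q : ℝ × ℝ => f q.1 q.2) (ρ, θ) (a, b) = d1 f ρ θ * a + d2 f ρ θ * b := by
  have : ((a, b) : ℝ × ℝ) = a • (1, 0) + b • (0, 1) := by ext <;> simp
  rw [this, map_add, map_smul, map_smul, d1, d2]
  simp [mul_comm]

theorem C1Quad.hasDerivAt_fst (hf : C1Quad f) {ρ θ : ℝ} (hρ : 0 < ρ) (hθ : 0 < θ) :
    HasDerivAt (fun ρ => f ρ θ) (d1 f ρ θ) ρ :=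
  (HasFDerivAt.comp (f := fun ρ : ℝ => (ρ, θ)) ρ (hf.hasFDerivAt hρ hθ)
    (hasFDerivAt_prodMk_left ρ θ)).hasDerivAt.congr_deriv (by simp [d1])

theorem C1Quad.hasDerivAt_snd (hf : C1Quad f) {ρ θ : ℝ} (hρ : 0 < ρ) (hθ : 0 < θ) :
    HasDerivAt (fun θ => f ρ θ) (d2 f ρ θ) θ :=
  (HasFDerivAt.comp (f := fun θ : ℝ => (ρ, θ)) θ (hf.hasFDerivAt hρ hθ)
    (hasFDerivAt_prodMk_right ρ θ)).hasDerivAt.congr_deriv (by simp [d2])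

theorem C1Quad.continuousOn_fderiv (hf : C1Quad f) :
    ContinuousOn (fderiv ℝ fun q : ℝ × ℝ => f q.1 q.2) quadrant :=
  ContDiffOn.continuousOn_fderiv_of_isOpen hf isOpen_quadrant le_rfl

theorem C1Quad.continuousOn_d1 (hf : C1Quad f) :
    ContinuousOn (fun q : ℝ × ℝ => d1 f q.1 q.2) quadrant :=
  hf.continuousOn_fderiv.clm_apply continuousOn_const

theorem C1Quad.continuousOn_d2 (hf : C1Quad f) :
    ContinuousOn (fun q : ℝ × ℝ => d2 f q.1 q.2) quadrant :=
  hf.continuousOn_fderiv.clm_apply continuousOn_const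

/-- A compact rectangle of densities and temperatures. -/
def box (a b c d : ℝ) : Set (ℝ × ℝ) := Icc a b ×ˢ Icc c d

variable {a b c d : ℝ}

theorem isCompact_box : IsCompact (box a b c d) := isCompact_Icc.prod isCompact_Icc

theorem convex_box : Convex ℝ (box a b c d) := (convex_Icc a b).prod (convex_Icc c d)

theorem box_subset (ha : 0 < a) (hc : 0 < c) : box a b c d ⊆ quadrant :=
  fun _ hq => ⟨ha.trans_le hq.1.1, hc.trans_le hq.2.1⟩

theorem C1Quad.exists_bound (hf : C1Quad f) (ha : 0 < a) (hc : 0 < c) :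
    ∃ N, 0 ≤ N ∧ ∀ ρ θ, (ρ, θ) ∈ box a b c d → |f ρ θ| ≤ N := by
  obtain ⟨N, hN⟩ := (isCompact_box (a := a) (b := b) (c := c) (d := d)).exists_bound_of_continuousOn
    (f := fun q : ℝ × ℝ => f q.1 q.2) ((ContDiffOn.continuousOn hf).mono (box_subset ha hc))
  exact ⟨|N|, abs_nonneg _, fun ρ θ h => (hN (ρ, θ) h).trans (le_abs_self _)⟩

theorem exists_pos_lower_bound {g : ℝ → ℝ → ℝ}
    (hg : ContinuousOn (fun q : ℝ × ℝ => g q.1 q.2) quadrant)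
    (hpos : ∀ ρ θ, 0 < ρ → 0 < θ → 0 < g ρ θ) (ha : 0 < a) (hc : 0 < c) :
    ∃ m, 0 < m ∧ ∀ ρ θ, (ρ, θ) ∈ box a b c d → m ≤ g ρ θ := by
  by_cases hne : (box a b c d).Nonempty
  · obtain ⟨q, hq, hmin⟩ := isCompact_box.exists_isMinOn hne (hg.mono (box_subset ha hc))
    exact ⟨g q.1 q.2, hpos _ _ (box_subset ha hc hq).1 (box_subset ha hc hq).2,
      fun ρ θ h => hmin h⟩
  -- An empty rectangle imposes nothing; 1 is a default.
  · exact ⟨1, one_pos, fun ρ θ h => absurd ⟨_, h⟩ hne⟩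

theorem C1Quad.exists_lipschitz (hf : C1Quad f) (ha : 0 < a) (hc : 0 < c) :
    ∃ L, 0 ≤ L ∧ ∀ ρ θ ρ' θ', (ρ, θ) ∈ box a b c d → (ρ', θ') ∈ box a b c d →
      |f ρ θ - f ρ' θ'| ≤ L * (|ρ - ρ'| + |θ - θ'|) := by
  obtain ⟨L, hL⟩ := ContDiffOn.exists_lipschitzOnWith
    (ContDiffOn.mono hf (box_subset (b := b) (d := d) ha hc)) one_ne_zero convex_box isCompact_box
  refine ⟨L, L.2, fun ρ θ ρ' θ' h h' => ?_⟩
  have := hL.norm_sub_le h h'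
  refine this.trans (mul_le_mul_of_nonneg_left ?_ L.2)
  rw [Prod.mk_sub_mk, Prod.norm_mk]
  exact max_le (le_add_of_nonneg_right (abs_nonneg _)) (le_add_of_nonneg_left (abs_nonneg _))

/-- First order Taylor expansion with quadratic remainder. -/
theorem C1Quad.exists_taylor (hf : C1Quad f) (hl : LipDerivQuad f) (ha : 0 < a) (hc : 0 < c) :
    ∃ L, 0 ≤ L ∧ ∀ ρ θ ρ' θ', (ρ, θ) ∈ box a b c d → (ρ', θ') ∈ box a b c d →
      |f ρ θ - f ρ' θ' - d1 f ρ' θ' * (ρ - ρ') - d2 f ρ' θ' * (θ - θ')|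
        ≤ L * ((ρ - ρ') ^ 2 + (θ - θ') ^ 2) := by
  obtain ⟨L, hL⟩ := LocallyLipschitzOn.exists_lipschitzOnWith_of_compact isCompact_box
    (LocallyLipschitzOn.mono hl (box_subset (b := b) (d := d) ha hc))
  refine ⟨L, L.2, fun ρ θ ρ' θ' h h' => ?_⟩
  have hseg : segment ℝ ((ρ', θ') : ℝ × ℝ) (ρ, θ) ⊆ box a b c d := convex_box.segment_subset h' h
  -- Mean value inequality for `f` minus its linear part at the base point: along the segment the
  -- derivative differs from that at the base point by at most `L` times the length, which makes the
  -- remainder quadratic.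
  have key := (convex_segment ((ρ', θ') : ℝ × ℝ) (ρ, θ)).norm_image_sub_le_of_norm_hasFDerivWithin_le'
    (𝕜 := ℝ) (f := fun q : ℝ × ℝ => f q.1 q.2) (f' := fderiv ℝ (fun q : ℝ × ℝ => f q.1 q.2))
    (φ := fderiv ℝ (fun q : ℝ × ℝ => f q.1 q.2) (ρ', θ'))
    (C := L * ‖((ρ, θ) : ℝ × ℝ) - (ρ', θ')‖)
    (fun q hq => (hf.hasFDerivAt (box_subset ha hc (hseg hq)).1
      (box_subset ha hc (hseg hq)).2).hasFDerivWithinAt)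
    (fun q hq => (hL.norm_sub_le (hseg hq) h').trans
      (mul_le_mul_of_nonneg_left (norm_sub_le_of_mem_segment hq) L.2))
    (left_mem_segment ℝ _ _) (right_mem_segment ℝ _ _)
  rw [Prod.mk_sub_mk, C1Quad.fderiv_apply, Prod.norm_mk, Real.norm_eq_abs, Real.norm_eq_abs,
    Real.norm_eq_abs, ← sub_sub] at key
  refine key.trans ?_
  rw [mul_assoc]
  refine mul_le_mul_of_nonneg_left ?_ L.2
  have h1 := sq_nonneg (ρ - ρ')
  have h2 := sq_nonneg (θ - θ')
  rcases max_choice |ρ - ρ'| |θ - θ'| with hm | hm <;> rw [hm, abs_mul_abs_self] <;> nlinarith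

end

/-- Sign of a function whose derivative has the sign of `x - r`. -/
theorem nonneg_of_deriv_sign {a b r : ℝ} {φ φ' : ℝ → ℝ} (hd : ∀ x ∈ Icc a b, HasDerivAt φ (φ' x) x)
    (hr : r ∈ Icc a b) (h0 : φ r = 0) (hs : ∀ x ∈ Icc a b, 0 ≤ (x - r) * φ' x) {x : ℝ}
    (hx : x ∈ Icc a b) : 0 ≤ φ x := by
  rcases lt_trichotomy r x with h | h | h
  · have hsub : Icc r x ⊆ Icc a b := Icc_subset_Icc hr.1 hx.2
    obtain ⟨ξ, hξ, he⟩ := exists_hasDerivAt_eq_slope φ φ' h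
      (fun y hy => (hd y (hsub hy)).continuousAt.continuousWithinAt)
      (fun y hy => hd y (hsub (Ioo_subset_Icc_self hy)))
    have hp := hs ξ (hsub (Ioo_subset_Icc_self hξ))
    have h1 : 0 ≤ φ' ξ := nonneg_of_mul_nonneg_right hp (sub_pos.2 hξ.1)
    rw [he, h0, sub_zero] at h1
    by_contra hn
    have := div_neg_of_neg_of_pos (not_le.1 hn) (sub_pos.2 h)
    linarith
  · rw [← h, h0]
  · have hsub : Icc x r ⊆ Icc a b := Icc_subset_Icc hx.1 hr.2
    obtain ⟨ξ, hξ, he⟩ := exists_hasDerivAt_eq_slope φ φ' h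
      (fun y hy => (hd y (hsub hy)).continuousAt.continuousWithinAt)
      (fun y hy => hd y (hsub (Ioo_subset_Icc_self hy)))
    have hp := hs ξ (hsub (Ioo_subset_Icc_self hξ))
    have h1 : φ' ξ ≤ 0 := by
      by_contra hn
      have := mul_neg_of_neg_of_pos (sub_neg.2 hξ.2) (not_le.1 hn)
      linarith
    rw [he, h0, zero_sub] at h1
    by_contra hn
    have := div_pos (neg_pos.2 (not_le.1 hn)) (sub_pos.2 h)
    linarith

/-! ### Gibbs' equation, Maxwell's relation and coercivity of the thermal energy -/

section Thermodynamics

variable {fl : Fluid}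

theorem hasFDerivAt_one_div_fst {ρ : ℝ} (hρ : 0 < ρ) (θ : ℝ) :
    HasFDerivAt (fun q : ℝ × ℝ => 1 / q.1)
      ((-(ρ ^ 2)⁻¹ : ℝ) • ContinuousLinearMap.fst ℝ ℝ ℝ) (ρ, θ) := by
  simp only [one_div]
  exact HasDerivAt.comp_hasFDerivAt (h₂ := fun x : ℝ => x⁻¹) (f := Prod.fst) (ρ, θ)
    (hasDerivAt_inv hρ.ne') hasFDerivAt_fst

theorem Fluid.Gibbs.d1_eq (hG : fl.Gibbs) {ρ θ : ℝ} (hρ : 0 < ρ) (hθ : 0 < θ) :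
    θ * d1 fl.s ρ θ = d1 fl.e ρ θ - fl.p ρ θ / ρ ^ 2 := by
  have h := congrArg (fun L : ℝ × ℝ →L[ℝ] ℝ => L (1, 0)) (hG (ρ, θ) ⟨hρ, hθ⟩)
  rw [(hasFDerivAt_one_div_fst hρ θ).fderiv] at h
  simp only [_root_.smul_apply, _root_.add_apply, smul_eq_mul,
    ContinuousLinearMap.coe_fst'] at h
  rw [d1, d1, h]
  ring

theorem Fluid.Gibbs.d2_eq (hG : fl.Gibbs) {ρ θ : ℝ} (hρ : 0 < ρ) (hθ : 0 < θ) :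
    θ * d2 fl.s ρ θ = d2 fl.e ρ θ := by
  have h := congrArg (fun L : ℝ × ℝ →L[ℝ] ℝ => L (0, 1)) (hG (ρ, θ) ⟨hρ, hθ⟩)
  rw [(hasFDerivAt_one_div_fst hρ θ).fderiv] at h
  simp only [_root_.smul_apply, _root_.add_apply, smul_eq_mul,
    ContinuousLinearMap.coe_fst'] at h
  rw [d2, d2, h]
  ring

/-- Maxwell's relation `∂s/∂ϱ = - ϱ⁻² ∂p/∂ϑ`. -/
theorem Fluid.Gibbs.maxwell (hG : fl.Gibbs) (hp : C1Quad fl.p) (he : C1Quad fl.e)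
    (hs : C1Quad fl.s) {ρ θ : ℝ} (hρ : 0 < ρ) (hθ : 0 < θ) :
    d1 fl.s ρ θ = -(d2 fl.p ρ θ / ρ ^ 2) := by
  let F1 : ℝ × ℝ →L[ℝ] ℝ := ContinuousLinearMap.fst ℝ ℝ ℝ
  let F2 : ℝ × ℝ →L[ℝ] ℝ := ContinuousLinearMap.snd ℝ ℝ ℝ
  -- By Gibbs' equation the free energy e − θs has gradient (p/ϱ², −s). This gradient is itself
  -- differentiable since p and s are `C¹`, and symmetry of the second derivative is Maxwell's
  -- relation. No second derivative of e or s is needed separately.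
  let f' : ℝ × ℝ → ℝ × ℝ →L[ℝ] ℝ := fun q =>
    (fl.p q.1 q.2 * (q.1 ^ 2)⁻¹) • F1 - fl.s q.1 q.2 • F2
  have hf : ∀ᶠ q in 𝓝 ((ρ, θ) : ℝ × ℝ),
      HasFDerivAt (fun q : ℝ × ℝ => fl.e q.1 q.2 - q.2 * fl.s q.1 q.2) (f' q) q := by
    filter_upwards [isOpen_quadrant.mem_nhds (show (ρ, θ) ∈ quadrant from ⟨hρ, hθ⟩)]
      with q hq
    obtain ⟨x, y⟩ := q
    have hx : 0 < x := hq.1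
    have hy : 0 < y := hq.2
    have h1 := (he.hasFDerivAt hx hy).fun_sub
      ((hasFDerivAt_snd (𝕜 := ℝ) (p := (x, y))).fun_mul (hs.hasFDerivAt hx hy))
    refine h1.congr_fderiv (ContinuousLinearMap.ext fun v => ?_)
    obtain ⟨v1, v2⟩ := v
    have g1 := hG.d1_eq hx hy
    have g2 := hG.d2_eq hx hy
    simp only [_root_.sub_apply, _root_.add_apply,
      _root_.smul_apply, C1Quad.fderiv_apply, smul_eq_mul, f', F1, F2,
      ContinuousLinearMap.coe_fst', ContinuousLinearMap.coe_snd', ← div_eq_mul_inv]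
    linear_combination (-v1) * g1 - v2 * g2
  have hinv : HasFDerivAt (fun q : ℝ × ℝ => (q.1 ^ 2)⁻¹)
      ((-(2 * ρ) / (ρ ^ 2) ^ 2 : ℝ) • F1) (ρ, θ) := by
    have h1 : HasDerivAt (fun x : ℝ => (x ^ 2)⁻¹) (-(2 * ρ) / (ρ ^ 2) ^ 2) ρ := by
      refine ((hasDerivAt_pow 2 ρ).fun_inv (by positivity)).congr_deriv ?_
      norm_num
    exact HasDerivAt.comp_hasFDerivAt (h₂ := fun x : ℝ => (x ^ 2)⁻¹) (f := Prod.fst) (ρ, θ) h1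
      hasFDerivAt_fst
  have hx := (((hp.hasFDerivAt hρ hθ).fun_mul hinv).smul_const F1).fun_sub
    ((hs.hasFDerivAt hρ hθ).smul_const F2)
  have sym := second_derivative_symmetric_of_eventually_of_real hf hx (1, 0) (0, 1)
  simp only [_root_.sub_apply, _root_.add_apply,
    _root_.smul_apply, ContinuousLinearMap.smulRight_apply, C1Quad.fderiv_apply,
    smul_eq_mul, F1, F2, ContinuousLinearMap.coe_fst', ContinuousLinearMap.coe_snd'] at sym
  have hρ2 : ρ ^ 2 ≠ 0 := by positivity
  rw [div_eq_mul_inv]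
  linarith

/-- The thermal part of the relative energy. -/
noncomputable def Fluid.relThermal (fl : Fluid) (r Θ ρ θ : ℝ) : ℝ :=
  ρ * fl.e ρ θ - Θ * (ρ * fl.s ρ θ) - ρ * (fl.e r Θ - Θ * fl.s r Θ + fl.p r Θ / r) + fl.p r Θ

theorem Fluid.relThermal_self (fl : Fluid) {r : ℝ} (hr : 0 < r) (Θ : ℝ) :
    fl.relThermal r Θ r Θ = 0 := by
  rw [Fluid.relThermal]; field_simp; ring

/-- Move first in the density at temperature Θ, then in the temperature at density ϱ. On the first
leg the derivative of ϱ(e−Θs) is e−Θs+p/ϱ, whose own derivative is ∂_ϱp/ϱ > 0. On the second leg the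
derivative is ϱ∂_θe·(θ−Θ)/θ, which has the sign of θ−Θ. Compactness of the rectangle makes both
positivities uniform. -/
theorem Fluid.exists_relThermal_coercive (hG : fl.Gibbs) (hst : fl.ThermodynamicallyStable)
    (hp : C1Quad fl.p) (he : C1Quad fl.e) (hs : C1Quad fl.s) {a b c d : ℝ} (ha : 0 < a)
    (hc : 0 < c) :
    ∃ m, 0 < m ∧ ∀ ρ θ r Θ, (ρ, θ) ∈ box a b c d → (r, Θ) ∈ box a b c d →
      m * ((ρ - r) ^ 2 + (θ - Θ) ^ 2) ≤ fl.relThermal r Θ ρ θ := by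
  obtain ⟨m1, hm1, h1⟩ := exists_pos_lower_bound (a := a) (b := b) (c := c) (d := d)
    (g := fun ρ θ => d1 fl.p ρ θ / ρ)
    (hp.continuousOn_d1.div continuousOn_fst (fun q hq => (show 0 < q.1 from hq.1).ne'))
    (fun ρ θ hρ hθ => div_pos ((hp.hasDerivAt_fst hρ hθ).deriv ▸ (hst ρ θ hρ hθ).1) hρ) ha hc
  obtain ⟨m2, hm2, h2⟩ := exists_pos_lower_bound (a := a) (b := b) (c := c) (d := d)
    (g := fun ρ θ => ρ * d2 fl.e ρ θ / θ)
    ((continuousOn_fst.mul he.continuousOn_d2).div continuousOn_snd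
      (fun q hq => (show 0 < q.2 from hq.2).ne'))
    (fun ρ θ hρ hθ => div_pos (mul_pos hρ
      ((he.hasDerivAt_snd hρ hθ).deriv ▸ (hst ρ θ hρ hθ).2)) hθ) ha hc
  refine ⟨min (m1 / 2) (m2 / 2), lt_min (half_pos hm1) (half_pos hm2), ?_⟩
  intro ρ θ r Θ hK hK'
  have pos : ∀ {x y}, (x, y) ∈ box a b c d → 0 < x ∧ 0 < y := fun h => box_subset ha hc h
  -- convexity in the density
  let g : ℝ → ℝ := fun x => fl.e x Θ - Θ * fl.s x Θ + fl.p x Θ / x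
  have hg : ∀ x ∈ Icc a b, HasDerivAt g (d1 fl.p x Θ / x) x := by
    intro x hx
    obtain ⟨hx0, hΘ0⟩ := pos (show (x, Θ) ∈ box a b c d from ⟨hx, hK'.2⟩)
    have := ((he.hasDerivAt_fst hx0 hΘ0).fun_sub ((hs.hasDerivAt_fst hx0 hΘ0).const_mul Θ)).fun_add
      ((hp.hasDerivAt_fst hx0 hΘ0).fun_div (hasDerivAt_id x) hx0.ne')
    refine this.congr_deriv ?_
    have g1 := hG.d1_eq hx0 hΘ0
    rw [g1]
    simp only [id]
    field_simp
    ring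
  -- Strong monotonicity of `g` from the mean value theorem. The factor x − r turns the two
  -- one-sided inequalities into the sign condition on the derivative of the convexity defect.
  have hgm : ∀ x ∈ Icc a b, 0 ≤ (x - r) * (g x - g r - m1 * (x - r)) := by
    intro x hx
    rcases lt_trichotomy r x with h | h | h
    · have hsub : Icc r x ⊆ Icc a b := Icc_subset_Icc hK'.1.1 hx.2
      obtain ⟨ξ, hξ, e⟩ := exists_hasDerivAt_eq_slope g _ h
        (fun y hy => (hg y (hsub hy)).continuousAt.continuousWithinAt)
        (fun y hy => hg y (hsub (Ioo_subset_Icc_self hy)))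
      have hb := h1 ξ Θ ⟨hsub (Ioo_subset_Icc_self hξ), hK'.2⟩
      rw [e, le_div_iff₀ (sub_pos.2 h)] at hb
      exact mul_nonneg (sub_pos.2 h).le (by linarith)
    · simp [h]
    · have hsub : Icc x r ⊆ Icc a b := Icc_subset_Icc hx.1 hK'.1.2
      obtain ⟨ξ, hξ, e⟩ := exists_hasDerivAt_eq_slope g _ h
        (fun y hy => (hg y (hsub hy)).continuousAt.continuousWithinAt)
        (fun y hy => hg y (hsub (Ioo_subset_Icc_self hy)))
      have hb := h1 ξ Θ ⟨hsub (Ioo_subset_Icc_self hξ), hK'.2⟩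
      rw [e, le_div_iff₀ (sub_pos.2 h)] at hb
      exact mul_nonneg_of_nonpos_of_nonpos (sub_neg.2 h).le (by linarith)
  have hA : m1 / 2 * (ρ - r) ^ 2 ≤ fl.relThermal r Θ ρ Θ := by
    have := nonneg_of_deriv_sign (a := a) (b := b) (r := r)
      (φ := fun x => x * fl.e x Θ - Θ * (x * fl.s x Θ) - x * g r + fl.p r Θ - m1 / 2 * (x - r) ^ 2)
      (φ' := fun x => g x - g r - m1 * (x - r)) ?_ hK'.1 ?_ hgm hK.1
    · have hu : fl.relThermal r Θ ρ Θ
          = ρ * fl.e ρ Θ - Θ * (ρ * fl.s ρ Θ) - ρ * g r + fl.p r Θ := rfl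
      linarith
    · intro x hx
      obtain ⟨hx0, hΘ0⟩ := pos (show (x, Θ) ∈ box a b c d from ⟨hx, hK'.2⟩)
      have hid := hasDerivAt_id' x
      have := (((hid.fun_mul (he.hasDerivAt_fst hx0 hΘ0)).fun_sub
        ((hid.fun_mul (hs.hasDerivAt_fst hx0 hΘ0)).const_mul Θ)).fun_sub (hid.mul_const (g r))).add_const
          (fl.p r Θ) |>.fun_sub (((hid.sub_const r).fun_pow 2).const_mul (m1 / 2))
      refine this.congr_deriv ?_
      have g1 := hG.d1_eq hx0 hΘ0
      have : x * (Θ * d1 fl.s x Θ) = x * d1 fl.e x Θ - fl.p x Θ / x := by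
        rw [g1]; field_simp
      simp only [g]
      push_cast
      linear_combination (-1) * this
    · have hr0 := (pos hK').1
      simp only [g]
      field_simp
      ring
  -- convexity in the temperature
  have hB : m2 / 2 * (θ - Θ) ^ 2 ≤ fl.relThermal r Θ ρ θ - fl.relThermal r Θ ρ Θ := by
    have := nonneg_of_deriv_sign (a := c) (b := d) (r := Θ)
      (φ := fun y => ρ * fl.e ρ y - Θ * (ρ * fl.s ρ y) - (ρ * fl.e ρ Θ - Θ * (ρ * fl.s ρ Θ))
        - m2 / 2 * (y - Θ) ^ 2)
      (φ' := fun y => (y - Θ) * (ρ * d2 fl.e ρ y / y - m2)) ?_ hK'.2 ?_ ?_ hK.2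
    · simp only [Fluid.relThermal]
      linarith
    · intro y hy
      obtain ⟨hρ0, hy0⟩ := pos (show (ρ, y) ∈ box a b c d from ⟨hK.1, hy⟩)
      have hid := hasDerivAt_id' y
      have := ((((he.hasDerivAt_snd hρ0 hy0).const_mul ρ).fun_sub
        (((hs.hasDerivAt_snd hρ0 hy0).const_mul ρ).const_mul Θ)).sub_const
          (ρ * fl.e ρ Θ - Θ * (ρ * fl.s ρ Θ))).fun_sub
          (((hid.sub_const Θ).fun_pow 2).const_mul (m2 / 2))
      refine this.congr_deriv ?_
      have g2 := hG.d2_eq hρ0 hy0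
      have : d2 fl.s ρ y = d2 fl.e ρ y / y := by
        rw [← g2]; field_simp
      rw [this]
      push_cast
      field_simp
    · ring
    · intro y hy
      have := h2 ρ y ⟨hK.1, hy⟩
      have h3 := sq_nonneg (y - Θ)
      nlinarith
  have q1 := sq_nonneg (ρ - r)
  have q2 := sq_nonneg (θ - Θ)
  have e1 := min_le_left (m1 / 2) (m2 / 2)
  have e2 := min_le_right (m1 / 2) (m2 / 2)
  nlinarith

end Thermodynamics

/-! ### The relative energy integrand at a point -/

/-- The values and derivatives of a strong solution at a point of space-time; `divS`, `curlE`,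
`divψ` stand for `div 𝕊`, `curl (ζ curl H)` and `div (κ∇Θ/Θ)`. -/
structure StrongPoint where
  r : ℝ
  rt : ℝ
  gr : V3
  Θ : ℝ
  Θt : ℝ
  gΘ : V3
  U : V3
  Ut : V3
  JU : M3
  H : V3
  Ht : V3
  JH : M3
  divS : V3
  curlE : V3
  divψ : ℝ

namespace StrongPoint

variable (fl : Fluid) (P : StrongPoint)

/-- `curl H`. -/
def Y : V3 := ![P.JH 2 1 - P.JH 1 2, P.JH 0 2 - P.JH 2 0, P.JH 1 0 - P.JH 0 1]

/-- `𝔻(U)`. -/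
noncomputable def D : M3 := symPart P.JU

/-- The time derivative of `f(r,Θ)`. -/
noncomputable def ct (f : ℝ → ℝ → ℝ) : ℝ := d1 f P.r P.Θ * P.rt + d2 f P.r P.Θ * P.Θt

/-- The gradient of `f(r,Θ)`. -/
noncomputable def cg (f : ℝ → ℝ → ℝ) (j : Fin 3) : ℝ :=
  d1 f P.r P.Θ * P.gr j + d2 f P.r P.Θ * P.gΘ j

/-- The equations of a strong solution at a point, in non-conservative form. -/
structure Eqs : Prop where
  continuity : P.rt + (∑ j, P.U j * P.gr j) + P.r * P.JU.trace = 0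
  momentum : ∀ i, P.r * (P.Ut i + ∑ j, P.JU i j * P.U j) + P.cg fl.p i
    = P.divS i + (P.Y ⨯₃ P.H) i
  induction : ∀ i, P.Ht i + (P.H i * P.JU.trace + (∑ j, P.JH i j * P.U j)
    - ∑ j, P.JU i j * P.H j) + P.curlE i = 0
  solenoidal : P.JH.trace = 0
  entropy : P.r * (P.ct fl.s + ∑ j, P.U j * P.cg fl.s j) - P.divψ
    = fl.production P.r P.Θ P.D P.JU P.gΘ P.Y

/-- The time derivative of the test function `|U|²/2 - (e - Θs + p/r)`. -/
noncomputable def φt : ℝ :=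
  P.U ⬝ᵥ P.Ut - (P.ct fl.p / P.r - fl.s P.r P.Θ * P.Θt)

/-- The gradient of the test function `|U|²/2 - (e - Θs + p/r)`. -/
noncomputable def gφ : V3 := fun j =>
  (∑ i, P.U i * P.JU i j) - (P.cg fl.p j / P.r - fl.s P.r P.Θ * P.gΘ j)

/-- The gradient of `H·U`. -/
def gHU : V3 := fun j => ∑ i, (P.H i * P.JU i j + P.U i * P.JH i j)

/-- The divergence of `(p + |H|²/2) U - 𝕊 U`. -/
noncomputable def divF : ℝ :=
  (fl.p P.r P.Θ + 1 / 2 * normSq P.H) * P.JU.trace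
    + (∑ j, P.U j * (P.cg fl.p j + ∑ i, P.H i * P.JH i j))
    - (P.U ⬝ᵥ P.divS + frob P.JU (fl.stress P.r P.Θ P.D))

/-- The integrand of the relative energy inequality before any cancellation. -/
noncomputable def raw (z : Phase) : ℝ :=
  -(fl.entropyObs z * P.Θt + fl.entropyFluxObs z ⬝ᵥ P.gΘ)
    - (z.B ⬝ᵥ P.Ht - fl.inductionObs z ⬝ᵥ P.Y) - fl.productionObs z * P.Θ
    - ((z.ρ • z.u) ⬝ᵥ P.Ut - frob (fl.stressObs z) P.JU)
    - (frob (convObs z) P.JU + fl.pressureObs z * P.JU.trace)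
    + (z.ρ * P.φt fl + (z.ρ • z.u) ⬝ᵥ P.gφ fl)
    + (P.ct fl.p + P.H ⬝ᵥ P.Ht)
    + (z.u ⬝ᵥ P.divS + frob z.Du (fl.stress P.r P.Θ P.D))
    + ((z.θ - P.Θ) * P.divψ + (z.Dθ - P.gΘ) ⬝ᵥ ((fl.κ P.r P.Θ / P.Θ) • P.gΘ))
    - ((z.B - P.H) ⬝ᵥ P.curlE - (fl.ζ P.r P.Θ • P.Y) ⬝ᵥ (z.CB - P.Y))
    - z.B ⬝ᵥ P.gHU + P.divF fl

/-- The dissipative quadratic terms: `X`, `Y` are the true and the reference gradients, `k`, `l` the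
corresponding coefficients. -/
noncomputable def dissForm (Θ θ k l XX XY YY : ℝ) : ℝ :=
  -(Θ / θ * k * XX) + k * XY + l * (XY - YY) - (θ - Θ) / Θ * l * YY

/-- Material derivative of the temperature. -/
def DΘ : ℝ := P.Θt + ∑ j, P.U j * P.gΘ j

/-! ### Algebraic identities that remove the first-order terms -/

theorem frob_comm (A B : M3) : frob A B = frob B A := by
  simp only [frob, mul_comm]

theorem frob_symPart {A : M3} (hA : A.IsSymm) (B : M3) : frob A (symPart B) = frob A B := by
  have h := fun i j => hA.apply i j
  simp only [frob, symPart, Matrix.smul_apply, Matrix.add_apply, Matrix.transpose_apply,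
    Fin.sum_univ_three, smul_eq_mul]
  rw [h 0 1, h 0 2, h 1 2]
  ring

theorem isSymm_stress {ρ θ : ℝ} {A : M3} (hA : A.IsSymm) : (fl.stress ρ θ A).IsSymm := by
  ext i j
  have h := hA.apply i j
  simp only [Fluid.stress, Matrix.transpose_apply, Matrix.add_apply, Matrix.smul_apply,
    Matrix.sub_apply, smul_eq_mul, h, Matrix.one_apply, eq_comm (a := j) (b := i)]

theorem isSymm_symPart (A : M3) : (symPart A).IsSymm := by
  ext i j
  simp [symPart]
  ring

theorem frob_stress (ρ θ : ℝ) (A B : M3) : frob (fl.stress ρ θ A) B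
    = fl.μ ρ θ * (2 * frob A B - A.trace * B.trace / 3)
      + fl.η ρ θ / 3 * (A.trace * B.trace) := by
  simp only [frob, Fluid.stress, Matrix.add_apply, Matrix.smul_apply, Matrix.sub_apply,
    smul_eq_mul, Matrix.one_apply, Fin.sum_univ_three, Matrix.trace, Matrix.diag]
  simp
  ring

/-- The momentum terms. -/
theorem kinetic_identity (ρ : ℝ) (u : V3) :
    -((ρ • u) ⬝ᵥ P.Ut) - frob (ρ • tensor u u) P.JU + ρ * (P.U ⬝ᵥ P.Ut)
      + (ρ • u) ⬝ᵥ (fun j => ∑ i, P.U i * P.JU i j)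
    = -(∑ i, ρ * (u i - P.U i) * (P.Ut i + ∑ j, P.JU i j * P.U j))
      - ρ * ∑ i, ∑ j, (u i - P.U i) * (u j - P.U j) * P.JU i j := by
  simp only [dotProduct, frob, tensor, Matrix.smul_apply, Matrix.of_apply, Fin.sum_univ_three,
    Pi.smul_apply, smul_eq_mul]
  ring

/-- The magnetic terms. -/
theorem magnetic_identity (u B : V3) :
    (B ⨯₃ u) ⬝ᵥ P.Y + frob (tensor B B) P.JU - 1 / 2 * normSq B * P.JU.trace
      + (∑ i, (B i - P.H i) * (P.H i * P.JU.trace + (∑ j, P.JH i j * P.U j)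
        - ∑ j, P.JU i j * P.H j)) - B ⬝ᵥ P.gHU
      + (1 / 2 * normSq P.H * P.JU.trace + ∑ j, P.U j * ∑ i, P.H i * P.JH i j)
    = (∑ i, (u i - P.U i) * (P.Y ⨯₃ P.H) i)
      + (∑ i, ∑ j, (B i - P.H i) * (B j - P.H j) * P.JU i j)
      - 1 / 2 * normSq (B - P.H) * P.JU.trace + ((B - P.H) ⨯₃ (u - P.U)) ⬝ᵥ P.Y := by
  simp only [dotProduct, frob, tensor, gHU, normSq, Y, Matrix.trace, Matrix.diag, Matrix.of_apply,
    Fin.sum_univ_three, Pi.sub_apply, cross_apply]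
  simp
  ring

/-- The thermal terms. -/
theorem thermal_identity {P : StrongPoint} {fl : Fluid} (hP : P.Eqs fl) (hr : 0 < P.r)
    (hmax : d1 fl.s P.r P.Θ = -(d2 fl.p P.r P.Θ / P.r ^ 2)) (ρ θ s p : ℝ) (u : V3) :
    -(ρ * s * (P.Θt + u ⬝ᵥ P.gΘ)) + ρ * fl.s P.r P.Θ * (P.Θt + u ⬝ᵥ P.gΘ)
      - (p - fl.p P.r P.Θ) * P.JU.trace + (1 - ρ / P.r) * (P.ct fl.p + ∑ j, P.U j * P.cg fl.p j)
    = -(ρ * (s - fl.s P.r P.Θ) * ((u - P.U) ⬝ᵥ P.gΘ))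
      - (ρ - P.r) * (s - fl.s P.r P.Θ) * P.DΘ
      - P.r * (s - fl.s P.r P.Θ - d1 fl.s P.r P.Θ * (ρ - P.r) - d2 fl.s P.r P.Θ * (θ - P.Θ)) * P.DΘ
      - (p - fl.p P.r P.Θ - d1 fl.p P.r P.Θ * (ρ - P.r) - d2 fl.p P.r P.Θ * (θ - P.Θ))
        * P.JU.trace
      - (θ - P.Θ) * (P.r * (P.ct fl.s + ∑ j, P.U j * P.cg fl.s j)) := by
  have hc := hP.continuity
  have hrt : P.rt = -(∑ j, P.U j * P.gr j) - P.r * P.JU.trace := by linarith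
  -- The continuity equation reads Dr = −r div U along the flow. Of the linear pressure terms, those
  -- with ∂_ϱp then cancel; by Maxwell's relation those with ∂_θp turn into ∂_ϱs and complete the
  -- material derivative of s(r,Θ) on the right-hand side.
  simp only [dotProduct, ct, cg, DΘ, Fin.sum_univ_three, Pi.sub_apply, hmax] at hrt ⊢
  rw [hrt]
  field_simp
  ring

/-- The material derivative of U is eliminated through the momentum equation, and ϱ/r is split as 1
+ (ϱ−r)/r in the force terms. The part with ϱ−r is quadratic in the differences. The part with 1 is
first order and is cancelled by the viscous compatibility term and by the Lorentz term of
`magnetic_identity`. -/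
theorem momentum_substitution {P : StrongPoint} {fl : Fluid} (hP : P.Eqs fl) (hr : 0 < P.r)
    (ρ : ℝ) (w : V3) :
    -(∑ i, ρ * w i * (P.Ut i + ∑ j, P.JU i j * P.U j))
      = -(∑ i, (ρ - P.r) / P.r * w i * (P.divS i + (P.Y ⨯₃ P.H) i)) - w ⬝ᵥ P.divS
        - (∑ i, w i * (P.Y ⨯₃ P.H) i) + ρ / P.r * ∑ j, w j * P.cg fl.p j := by
  have h : ∀ i, P.Ut i + ∑ j, P.JU i j * P.U j
      = (P.divS i + (P.Y ⨯₃ P.H) i - P.cg fl.p i) / P.r := by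
    intro i
    rw [eq_div_iff hr.ne']
    linarith [hP.momentum i]
  simp only [h]
  simp only [dotProduct, Fin.sum_univ_three]
  field_simp
  ring

/-- The quadratic form of the shear viscosity. -/
noncomputable def shear (A B : M3) : ℝ := 2 * frob A B - A.trace * B.trace / 3

/-- The relative energy integrand is a sum of terms that are quadratic in the differences. -/
theorem raw_eq {P : StrongPoint} {fl : Fluid} (hP : P.Eqs fl) (hr : 0 < P.r)
    (hmax : d1 fl.s P.r P.Θ = -(d2 fl.p P.r P.Θ / P.r ^ 2)) (z : Phase)
    (hz : z.Du.IsSymm) :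
    P.raw fl z =
      -(∑ i, (z.ρ - P.r) / P.r * (z.u - P.U) i * (P.divS i + (P.Y ⨯₃ P.H) i))
      - z.ρ * (∑ i, ∑ j, (z.u - P.U) i * (z.u - P.U) j * P.JU i j)
      + (∑ i, ∑ j, (z.B - P.H) i * (z.B - P.H) j * P.JU i j)
      - 1 / 2 * normSq (z.B - P.H) * P.JU.trace + ((z.B - P.H) ⨯₃ (z.u - P.U)) ⬝ᵥ P.Y
      - z.ρ * (fl.s z.ρ z.θ - fl.s P.r P.Θ) * ((z.u - P.U) ⬝ᵥ P.gΘ)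
      - (z.ρ - P.r) * (fl.s z.ρ z.θ - fl.s P.r P.Θ) * P.DΘ
      - P.r * (fl.s z.ρ z.θ - fl.s P.r P.Θ - d1 fl.s P.r P.Θ * (z.ρ - P.r)
          - d2 fl.s P.r P.Θ * (z.θ - P.Θ)) * P.DΘ
      - (fl.p z.ρ z.θ - fl.p P.r P.Θ - d1 fl.p P.r P.Θ * (z.ρ - P.r)
          - d2 fl.p P.r P.Θ * (z.θ - P.Θ)) * P.JU.trace
      + (dissForm P.Θ z.θ (fl.μ z.ρ z.θ) (fl.μ P.r P.Θ) (shear z.Du z.Du) (shear z.Du P.D)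
          (shear P.D P.D)
        + dissForm P.Θ z.θ (fl.η z.ρ z.θ / 3) (fl.η P.r P.Θ / 3) (z.Du.trace * z.Du.trace)
          (z.Du.trace * P.D.trace) (P.D.trace * P.D.trace)
        + dissForm P.Θ z.θ (fl.κ z.ρ z.θ / z.θ) (fl.κ P.r P.Θ / P.Θ) (normSq z.Dθ)
          (z.Dθ ⬝ᵥ P.gΘ) (normSq P.gΘ)
        + dissForm P.Θ z.θ (fl.ζ z.ρ z.θ) (fl.ζ P.r P.Θ) (normSq z.CB)
          (z.CB ⬝ᵥ P.Y) (normSq P.Y)) := by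
  have hK := P.kinetic_identity z.ρ z.u
  have hS := momentum_substitution hP hr z.ρ (z.u - P.U)
  have hM := P.magnetic_identity z.u z.B
  have hT := thermal_identity hP hr hmax z.ρ z.θ (fl.s z.ρ z.θ) (fl.p z.ρ z.θ) z.u
  have hE := hP.entropy
  -- The stress is symmetric, so ∇U may be replaced by its symmetric part.
  have e1 : frob (fl.stressObs z) P.JU = fl.μ z.ρ z.θ * shear z.Du P.D
      + fl.η z.ρ z.θ / 3 * (z.Du.trace * P.D.trace) := by
    rw [Fluid.stressObs, ← frob_symPart (isSymm_stress fl hz), frob_stress]; rfl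
  have e2 : frob (fl.stressObs z) z.Du = fl.μ z.ρ z.θ * shear z.Du z.Du
      + fl.η z.ρ z.θ / 3 * (z.Du.trace * z.Du.trace) := frob_stress _ _ _ _ _
  have e3 : frob (fl.stress P.r P.Θ P.D) P.JU = fl.μ P.r P.Θ * shear P.D P.D
      + fl.η P.r P.Θ / 3 * (P.D.trace * P.D.trace) := by
    have hD : P.D.IsSymm := isSymm_symPart P.JU
    rw [← frob_symPart (isSymm_stress fl hD), frob_stress]; rfl
  have e4 : frob z.Du (fl.stress P.r P.Θ P.D) = fl.μ P.r P.Θ * shear z.Du P.D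
      + fl.η P.r P.Θ / 3 * (z.Du.trace * P.D.trace) := by
    rw [frob_comm, frob_stress, frob_comm, shear, mul_comm P.D.trace]
  have e5 : frob (convObs z) P.JU = frob (z.ρ • tensor z.u z.u) P.JU
      - frob (tensor z.B z.B) P.JU := by
    simp only [frob, convObs, Matrix.sub_apply, Fin.sum_univ_three]; ring
  have e6 : fl.entropyFluxObs z ⬝ᵥ P.gΘ = z.ρ * fl.s z.ρ z.θ * (z.u ⬝ᵥ P.gΘ)
      - fl.κ z.ρ z.θ / z.θ * (z.Dθ ⬝ᵥ P.gΘ) := by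
    simp [Fluid.entropyFluxObs, sub_dotProduct, smul_dotProduct]
  have e7 : fl.inductionObs z ⬝ᵥ P.Y = (z.B ⨯₃ z.u) ⬝ᵥ P.Y + fl.ζ z.ρ z.θ * (z.CB ⬝ᵥ P.Y) := by
    simp [Fluid.inductionObs, add_dotProduct, smul_dotProduct]
  have e8 : (z.ρ • z.u) ⬝ᵥ P.gφ fl = (z.ρ • z.u) ⬝ᵥ (fun j => ∑ i, P.U i * P.JU i j)
      - z.ρ / P.r * (∑ j, z.u j * P.cg fl.p j) + z.ρ * fl.s P.r P.Θ * (z.u ⬝ᵥ P.gΘ) := by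
    simp only [gφ, dotProduct, Fin.sum_univ_three, Pi.smul_apply, smul_eq_mul]; ring
  have e9 : (∑ j, P.U j * (P.cg fl.p j + ∑ i, P.H i * P.JH i j))
      = (∑ j, P.U j * P.cg fl.p j) + ∑ j, P.U j * ∑ i, P.H i * P.JH i j := by
    simp only [mul_add, Finset.sum_add_distrib]
  have e10 : (∑ j, (z.u - P.U) j * P.cg fl.p j)
      = (∑ j, z.u j * P.cg fl.p j) - ∑ j, P.U j * P.cg fl.p j := by
    simp only [Pi.sub_apply, sub_mul, Finset.sum_sub_distrib]
  -- The induction equation trades the time derivative of H for transport terms, which enter the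
  -- magnetic identity, and for curl(ζ curl H), which cancels against the magnetic compatibility
  -- term.
  have e11 : z.B ⬝ᵥ P.Ht - P.H ⬝ᵥ P.Ht = -(∑ i, (z.B i - P.H i) * (P.H i * P.JU.trace
      + (∑ j, P.JH i j * P.U j) - ∑ j, P.JU i j * P.H j)) - (z.B - P.H) ⬝ᵥ P.curlE := by
    have : ∀ i, P.Ht i = -(P.H i * P.JU.trace + (∑ j, P.JH i j * P.U j)
        - ∑ j, P.JU i j * P.H j) - P.curlE i := fun i => by linarith [hP.induction i]
    simp only [dotProduct, this, Fin.sum_univ_three, Pi.sub_apply]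
    ring
  have e12 : (z.u - P.U) ⬝ᵥ P.divS = z.u ⬝ᵥ P.divS - P.U ⬝ᵥ P.divS := sub_dotProduct _ _ _
  simp only [Fluid.production, Fluid.heatFlux, neg_dotProduct, smul_dotProduct, e3] at hE
  simp only [Pi.sub_apply] at hS e10
  simp only [raw, divF, φt, Fluid.productionObs, Fluid.pressureObs, Fluid.entropyObs, e1, e2, e4,
    e5, e6, e7, e8, e9, frob_comm P.JU, e3, dissForm, smul_dotProduct, dotProduct_smul,
    sub_dotProduct, dotProduct_sub, dotProduct_comm P.Y z.CB, smul_eq_mul, Pi.sub_apply] at *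
  simp only [normSq] at hM hE ⊢
  -- The entropy equation enters with the weight −(θ−Θ): it removes div(κ∇Θ/Θ) and leaves the terms
  -- (θ−Θ)/Θ of the four dissipative forms.
  linear_combination hK + hS + hM + hT - e11 + z.ρ / P.r * e10 - (z.θ - P.Θ) * hE

end StrongPoint

/-! ### Pointwise estimate of the relative energy integrand -/

theorem abs_mul_le_mul {x y X Y : ℝ} (hx : |x| ≤ X) (hy : |y| ≤ Y) : |x * y| ≤ X * Y := by
  rw [abs_mul]
  exact mul_le_mul hx hy (abs_nonneg _) ((abs_nonneg _).trans hx)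

theorem abs_add_le_add {x y X Y : ℝ} (hx : |x| ≤ X) (hy : |y| ≤ Y) : |x + y| ≤ X + Y :=
  (abs_add_le x y).trans (add_le_add hx hy)

theorem abs_sub_le_add {x y X Y : ℝ} (hx : |x| ≤ X) (hy : |y| ≤ Y) : |x - y| ≤ X + Y :=
  (abs_sub x y).trans (add_le_add hx hy)

theorem abs_sum_three_le {f : Fin 3 → ℝ} {X : ℝ} (h : ∀ i, |f i| ≤ X) : |∑ i, f i| ≤ 3 * X := by
  rw [Fin.sum_univ_three]
  have h1 := abs_add_le (f 0 + f 1) (f 2)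
  have h2 := abs_add_le (f 0) (f 1)
  linarith [h 0, h 1, h 2]

theorem normSq_eq (v : V3) : normSq v = v 0 ^ 2 + v 1 ^ 2 + v 2 ^ 2 := by
  simp only [normSq, dotProduct, Fin.sum_univ_three]; ring

theorem normSq_nonneg (v : V3) : 0 ≤ normSq v := by
  rw [normSq_eq]; positivity

theorem frob_self_nonneg (A : M3) : 0 ≤ frob A A :=
  Finset.sum_nonneg fun _ _ => Finset.sum_nonneg fun _ _ => mul_self_nonneg _

theorem abs_apply_le_sqrt (v : V3) (i : Fin 3) : |v i| ≤ √(normSq v) := by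
  refine Real.abs_le_sqrt ?_
  rw [normSq_eq]
  fin_cases i <;> simp <;> nlinarith [sq_nonneg (v 0), sq_nonneg (v 1), sq_nonneg (v 2)]

theorem sq_apply_le_frob (A : M3) (i j : Fin 3) : A i j ^ 2 ≤ frob A A := by
  rw [sq]
  calc A i j * A i j ≤ ∑ k, A i k * A i k :=
        Finset.single_le_sum (f := fun k => A i k * A i k) (fun k _ => mul_self_nonneg _)
          (Finset.mem_univ j)
    _ ≤ _ := Finset.single_le_sum (f := fun l => ∑ k, A l k * A l k)
          (fun l _ => Finset.sum_nonneg fun k _ => mul_self_nonneg _) (Finset.mem_univ i)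

theorem abs_apply_le_sqrt_frob (A : M3) (i j : Fin 3) : |A i j| ≤ √(frob A A) :=
  Real.abs_le_sqrt (sq_apply_le_frob A i j)

theorem abs_dotProduct_le {v w : V3} {X Y : ℝ} (hv : ∀ i, |v i| ≤ X) (hw : ∀ i, |w i| ≤ Y) :
    |v ⬝ᵥ w| ≤ 3 * (X * Y) :=
  abs_sum_three_le fun i => abs_mul_le_mul (hv i) (hw i)

theorem abs_frob_le {A B : M3} {X Y : ℝ} (hA : ∀ i j, |A i j| ≤ X) (hB : ∀ i j, |B i j| ≤ Y) :
    |frob A B| ≤ 9 * (X * Y) := by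
  have : |frob A B| ≤ 3 * (3 * (X * Y)) :=
    abs_sum_three_le fun i => abs_sum_three_le fun j => abs_mul_le_mul (hA i j) (hB i j)
  linarith

theorem abs_trace_le {A : M3} {X : ℝ} (hA : ∀ i j, |A i j| ≤ X) : |A.trace| ≤ 3 * X :=
  abs_sum_three_le fun i => hA i i

theorem abs_cross_le {v w : V3} {X Y : ℝ} (hv : ∀ i, |v i| ≤ X) (hw : ∀ i, |w i| ≤ Y)
    (i : Fin 3) : |(v ⨯₃ w) i| ≤ 2 * (X * Y) := by
  have h : ∀ a b c d : Fin 3, |v a * w b - v c * w d| ≤ 2 * (X * Y) := fun a b c d => by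
    have := abs_sub_le_add (abs_mul_le_mul (hv a) (hw b)) (abs_mul_le_mul (hv c) (hw d))
    linarith
  fin_cases i <;> simp [cross_apply] <;> apply h

theorem abs_bilin_le {v w : V3} {M : M3} {X Y N : ℝ} (hv : ∀ i, |v i| ≤ X) (hw : ∀ i, |w i| ≤ Y)
    (hM : ∀ i j, |M i j| ≤ N) : |∑ i, ∑ j, v i * w j * M i j| ≤ 9 * (X * Y * N) := by
  have : |∑ i, ∑ j, v i * w j * M i j| ≤ 3 * (3 * (X * Y * N)) :=
    abs_sum_three_le fun i => abs_sum_three_le fun j =>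
      abs_mul_le_mul (abs_mul_le_mul (hv i) (hw j)) (hM i j)
  linarith

/-- Cauchy–Schwarz on the diagonal. The constant 3 matches the factor 1/3 in `shear`: it makes 2|A|²
− (Tr A)²/3 at least |A|². -/
theorem trace_sq_le (A : M3) : A.trace ^ 2 ≤ 3 * frob A A := by
  simp only [Matrix.trace, Matrix.diag, frob, Fin.sum_univ_three]
  nlinarith [sq_nonneg (A 0 0 - A 1 1), sq_nonneg (A 0 0 - A 2 2), sq_nonneg (A 1 1 - A 2 2),
    sq_nonneg (A 0 1), sq_nonneg (A 0 2), sq_nonneg (A 1 0), sq_nonneg (A 1 2), sq_nonneg (A 2 0),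
    sq_nonneg (A 2 1)]

/-- Continuity of transport coefficients in the form needed for the dissipative terms. -/
theorem C1Quad.exists_transport_bound {k : ℝ → ℝ → ℝ} (hk : C1Quad k) {a b c d : ℝ} (ha : 0 < a)
    (hc : 0 < c) : ∃ A, 0 ≤ A ∧ ∀ ρ θ r Θ, (ρ, θ) ∈ box a b c d → (r, Θ) ∈ box a b c d →
      |k ρ θ - 2 * (Θ / θ) * k ρ θ + k r Θ| ≤ A * (|ρ - r| + |θ - Θ|) ∧
      |k ρ θ / θ - k r Θ / Θ| ≤ A * (|ρ - r| + |θ - Θ|) := by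
  obtain ⟨L, hL0, hL⟩ := hk.exists_lipschitz (b := b) (d := d) ha hc
  obtain ⟨N, hN0, hN⟩ := hk.exists_bound (b := b) (d := d) ha hc
  refine ⟨(L + 2 * N / c) + (L / c + N / c ^ 2), by positivity, fun ρ θ r Θ h h' => ?_⟩
  have hθ : c ≤ θ := h.2.1
  have hΘ : c ≤ Θ := h'.2.1
  have hθ0 := hc.trans_le hθ
  have hΘ0 := hc.trans_le hΘ
  set δ := |ρ - r| + |θ - Θ| with hδ
  have hδ0 : 0 ≤ δ := by positivity
  have hd : |θ - Θ| ≤ δ := le_add_of_nonneg_left (abs_nonneg _)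
  have hk1 := hL _ _ _ _ h h'
  have hiθ : |θ⁻¹| ≤ c⁻¹ := by
    rw [abs_of_pos (inv_pos.2 hθ0)]; exact inv_anti₀ hc hθ
  have hiΘ : |Θ⁻¹| ≤ c⁻¹ := by
    rw [abs_of_pos (inv_pos.2 hΘ0)]; exact inv_anti₀ hc hΘ
  constructor
  -- At equal states the coefficient is k − 2k + k = 0; the rewriting displays it as a combination
  -- of the differences of k and of the temperatures.
  · have e : k ρ θ - 2 * (Θ / θ) * k ρ θ + k r Θ
        = -(k ρ θ - k r Θ) + 2 * k ρ θ * ((θ - Θ) * θ⁻¹) := by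
      field_simp; ring
    have h1 : |2 * k ρ θ| ≤ 2 * N := by
      rw [abs_mul, abs_two]; linarith [hN _ _ h]
    rw [e]
    calc _ ≤ L * δ + 2 * N * (δ * c⁻¹) :=
          abs_add_le_add ((abs_neg _).trans_le hk1) (abs_mul_le_mul h1 (abs_mul_le_mul hd hiθ))
      _ = (L + 2 * N / c) * δ := by ring
      _ ≤ _ := mul_le_mul_of_nonneg_right (le_add_of_nonneg_right (by positivity)) hδ0
  · have e : k ρ θ / θ - k r Θ / Θ
        = (k ρ θ - k r Θ) * θ⁻¹ - k r Θ * ((θ - Θ) * (θ⁻¹ * Θ⁻¹)) := by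
      field_simp; ring
    rw [e]
    calc _ ≤ L * δ * c⁻¹ + N * (δ * (c⁻¹ * c⁻¹)) :=
          abs_sub_le_add (abs_mul_le_mul hk1 hiθ)
            (abs_mul_le_mul (hN _ _ h') (abs_mul_le_mul hd (abs_mul_le_mul hiθ hiΘ)))
      _ = (L / c + N / c ^ 2) * δ := by ring
      _ ≤ _ := mul_le_mul_of_nonneg_right (le_add_of_nonneg_left (by positivity)) hδ0

theorem C1Quad.div_const {k : ℝ → ℝ → ℝ} (hk : C1Quad k) (c : ℝ) :
    C1Quad fun ρ θ => k ρ θ / c := ContDiffOn.div_const hk c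

theorem C1Quad.div_temperature {k : ℝ → ℝ → ℝ} (hk : C1Quad k) : C1Quad fun ρ θ => k ρ θ / θ :=
  ContDiffOn.div hk contDiffOn_snd fun q hq => (show 0 < q.2 from hq.2).ne'

namespace StrongPoint

/-- Here the true gradient is the reference gradient plus a difference; `YY`, `YW`, `WW` are the
values of one symmetric bilinear form on reference and difference. In the expansion `WW` carries the
dissipation with a good sign, the coefficient of `YW` is of size δ, and `YY` is multiplied by a
product of two quantities of size δ. Young's inequality splits the mixed term, spending ε of the
dissipation and leaving O(δ²). -/
theorem dissForm_le {Θ θ k l YW WW YY A N₁ N₂ X δ m ε : ℝ} (hθ : θ ≠ 0) (hΘ : Θ ≠ 0)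
    (hε : 0 < ε)
    (h1 : |k - 2 * (Θ / θ) * k + l| ≤ A * δ) (h2 : |k / θ - l / Θ| ≤ A * δ) (h3 : |θ - Θ| ≤ δ)
    (h4 : |YW| ≤ N₁ * X) (h5 : |YY| ≤ N₂) (h6 : m * X ^ 2 ≤ Θ / θ * k * WW) :
    dissForm Θ θ k l (YY + 2 * YW + WW) (YY + YW) YY
      ≤ -(m * X ^ 2) + ε * X ^ 2 + ((A * N₁) ^ 2 / (4 * ε) + A * N₂) * δ ^ 2 := by
  have e : dissForm Θ θ k l (YY + 2 * YW + WW) (YY + YW) YY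
      = -(Θ / θ * k * WW) + (k - 2 * (Θ / θ) * k + l) * YW + (θ - Θ) * (k / θ - l / Θ) * YY := by
    rw [dissForm]; field_simp; ring
  have g1 : (k - 2 * (Θ / θ) * k + l) * YW ≤ A * δ * (N₁ * X) :=
    (le_abs_self _).trans (abs_mul_le_mul h1 h4)
  have g2 : (θ - Θ) * (k / θ - l / Θ) * YY ≤ δ * (A * δ) * N₂ :=
    (le_abs_self _).trans (abs_mul_le_mul (abs_mul_le_mul h3 h2) h5)
  have g3 : A * δ * (N₁ * X) ≤ ε * X ^ 2 + (A * N₁) ^ 2 / (4 * ε) * δ ^ 2 := by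
    have : ε * X ^ 2 + (A * N₁) ^ 2 / (4 * ε) * δ ^ 2 - A * δ * (N₁ * X)
        = ε * (X - A * N₁ * δ / (2 * ε)) ^ 2 := by
      field_simp; ring
    have h0 : 0 ≤ ε * (X - A * N₁ * δ / (2 * ε)) ^ 2 := by positivity
    linarith
  rw [e]
  linarith

/-- Bounds for the entries that enter the estimate. -/
structure BddBy (P : StrongPoint) (N : ℝ) : Prop where
  Θt : |P.Θt| ≤ N
  gΘ : ∀ i, |P.gΘ i| ≤ N
  U : ∀ i, |P.U i| ≤ N
  JU : ∀ i j, |P.JU i j| ≤ N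
  H : ∀ i, |P.H i| ≤ N
  JH : ∀ i j, |P.JH i j| ≤ N
  divS : ∀ i, |P.divS i| ≤ N

/-- The relative energy. -/
noncomputable def relEnergy (fl : Fluid) (P : StrongPoint) (z : Phase) : ℝ :=
  1 / 2 * z.ρ * normSq (z.u - P.U) + 1 / 2 * normSq (z.B - P.H)
    + fl.relThermal P.r P.Θ z.ρ z.θ

/-- The squared distance of the gradients. -/
noncomputable def diss (P : StrongPoint) (z : Phase) : ℝ :=
  frob (z.Du - P.D) (z.Du - P.D) + normSq (z.Dθ - P.gΘ) + normSq (z.CB - P.Y)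

/-- The squared distance of the states. -/
noncomputable def dist2 (P : StrongPoint) (z : Phase) : ℝ :=
  normSq (z.u - P.U) + normSq (z.B - P.H) + ((z.ρ - P.r) ^ 2 + (z.θ - P.Θ) ^ 2)

variable {fl : Fluid} {a b c d : ℝ}

/-- The lower bound `a` on the density makes the kinetic part control |u−U|² itself; without it,
velocities in near-vacuum would go unseen. The constant is the least of those of the kinetic,
magnetic and thermal parts. -/
theorem exists_relEnergy_coercive (hG : fl.Gibbs) (hst : fl.ThermodynamicallyStable)
    (hp : C1Quad fl.p) (he : C1Quad fl.e) (hs : C1Quad fl.s) (ha : 0 < a) (hc : 0 < c) :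
    ∃ m, 0 < m ∧ ∀ (P : StrongPoint) (z : Phase), (P.r, P.Θ) ∈ box a b c d →
      (z.ρ, z.θ) ∈ box a b c d → m * dist2 P z ≤ relEnergy fl P z := by
  obtain ⟨m, hm, h⟩ := Fluid.exists_relThermal_coercive (b := b) (d := d) hG hst hp he hs ha hc
  refine ⟨min m (min (a / 2) (1 / 2)), by positivity, fun P z hP hz => ?_⟩
  have h1 := h _ _ _ _ hz hP
  have l1 : min m (min (a / 2) (1 / 2)) ≤ m := min_le_left _ _
  have l2 : min m (min (a / 2) (1 / 2)) ≤ a / 2 := (min_le_right _ _).trans (min_le_left _ _)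
  have l3 : min m (min (a / 2) (1 / 2)) ≤ 1 / 2 := (min_le_right _ _).trans (min_le_right _ _)
  have hρ : a ≤ z.ρ := hz.1.1
  have q1 := normSq_nonneg (z.u - P.U)
  have q2 := normSq_nonneg (z.B - P.H)
  have q3 : 0 ≤ (z.ρ - P.r) ^ 2 + (z.θ - P.Θ) ^ 2 := by positivity
  have k1 := mul_le_mul_of_nonneg_right (l2.trans (by linarith : a / 2 ≤ 1 / 2 * z.ρ)) q1
  have k2 := mul_le_mul_of_nonneg_right l3 q2
  have k3 := mul_le_mul_of_nonneg_right l1 q3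
  rw [dist2, relEnergy]
  linarith

theorem shear_expand (X Y : M3) : shear X X = shear Y Y + 2 * shear Y (X - Y)
    + shear (X - Y) (X - Y) ∧ shear X Y = shear Y Y + shear Y (X - Y) := by
  constructor <;>
  · simp only [shear, frob, Matrix.trace_sub, Matrix.sub_apply, Fin.sum_univ_three]
    ring

theorem normSq_expand (X Y : V3) : normSq X = normSq Y + 2 * (Y ⬝ᵥ (X - Y)) + normSq (X - Y) ∧
    X ⬝ᵥ Y = normSq Y + Y ⬝ᵥ (X - Y) := by
  constructor <;>
  · simp only [normSq, dotProduct, Pi.sub_apply, Fin.sum_univ_three]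
    ring

theorem quadratic_bounds (x y δ : ℝ) : x * x ≤ x * x + y * y + δ * δ ∧
    y * y ≤ x * x + y * y + δ * δ ∧ δ * δ ≤ x * x + y * y + δ * δ ∧
    y * x ≤ x * x + y * y + δ * δ ∧ δ * x ≤ x * x + y * y + δ * δ := by
  have h1 := mul_self_nonneg x
  have h2 := mul_self_nonneg y
  have h3 := mul_self_nonneg δ
  have h4 := mul_self_nonneg (x - y)
  have h5 := mul_self_nonneg (x - δ)
  refine ⟨?_, ?_, ?_, ?_, ?_⟩ <;> nlinarith

/-- The quadratic terms without dissipation. -/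
theorem exists_convective_bound (hp : C1Quad fl.p) (hs : C1Quad fl.s) (hpl : LipDerivQuad fl.p)
    (hsl : LipDerivQuad fl.s) (ha : 0 < a) (hc : 0 < c) {N : ℝ} (hN : 0 ≤ N) :
    ∃ K, 0 ≤ K ∧ ∀ (P : StrongPoint) (z : Phase), P.BddBy N → (P.r, P.Θ) ∈ box a b c d →
      (z.ρ, z.θ) ∈ box a b c d →
      -(∑ i, (z.ρ - P.r) / P.r * (z.u - P.U) i * (P.divS i + (P.Y ⨯₃ P.H) i))
      - z.ρ * (∑ i, ∑ j, (z.u - P.U) i * (z.u - P.U) j * P.JU i j)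
      + (∑ i, ∑ j, (z.B - P.H) i * (z.B - P.H) j * P.JU i j)
      - 1 / 2 * normSq (z.B - P.H) * P.JU.trace + ((z.B - P.H) ⨯₃ (z.u - P.U)) ⬝ᵥ P.Y
      - z.ρ * (fl.s z.ρ z.θ - fl.s P.r P.Θ) * ((z.u - P.U) ⬝ᵥ P.gΘ)
      - (z.ρ - P.r) * (fl.s z.ρ z.θ - fl.s P.r P.Θ) * P.DΘ
      - P.r * (fl.s z.ρ z.θ - fl.s P.r P.Θ - d1 fl.s P.r P.Θ * (z.ρ - P.r)
          - d2 fl.s P.r P.Θ * (z.θ - P.Θ)) * P.DΘ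
      - (fl.p z.ρ z.θ - fl.p P.r P.Θ - d1 fl.p P.r P.Θ * (z.ρ - P.r)
          - d2 fl.p P.r P.Θ * (z.θ - P.Θ)) * P.JU.trace ≤ K * dist2 P z := by
  obtain ⟨L, hL0, hL⟩ := hs.exists_lipschitz (b := b) (d := d) ha hc
  obtain ⟨Ls, hLs0, hLs⟩ := hs.exists_taylor (b := b) (d := d) hsl ha hc
  obtain ⟨Lp, hLp0, hLp⟩ := hp.exists_taylor (b := b) (d := d) hpl ha hc
  -- One summand for each of the nine terms `t1`–`t9`, in order; the numerical factors count the
  -- entries of the sums over one or two indices and the two terms of each curl or cross product.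
  let K : ℝ := 3 * (a⁻¹ * (N + 2 * (2 * N * N))) + 9 * |b| * N + 9 * N + 3 / 2 * N + 12 * N
    + 3 * |b| * L * N + L * (N + 3 * (N * N)) + |b| * Ls * (N + 3 * (N * N)) + 3 * Lp * N
  have hK : 0 ≤ K := by positivity
  -- The factor 2 comes from (|ϱ−r| + |θ−Θ|)² ≤ 2((ϱ−r)² + (θ−Θ)²).
  refine ⟨2 * K, by positivity, fun P z hP hb hz => ?_⟩
  have hr : 0 < P.r := ha.trans_le hb.1.1
  have hρ : |z.ρ| ≤ |b| := by
    rw [abs_of_pos (ha.trans_le hz.1.1)]; exact hz.1.2.trans (le_abs_self b)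
  have hrb : |P.r| ≤ |b| := by
    rw [abs_of_pos hr]; exact hb.1.2.trans (le_abs_self b)
  have hir : |P.r⁻¹| ≤ a⁻¹ := by
    rw [abs_of_pos (inv_pos.2 hr)]; exact inv_anti₀ ha hb.1.1
  obtain ⟨x, hx⟩ : ∃ x, x = √(normSq (z.u - P.U)) := ⟨_, rfl⟩
  obtain ⟨y, hy⟩ : ∃ y, y = √(normSq (z.B - P.H)) := ⟨_, rfl⟩
  obtain ⟨δ, hδ⟩ : ∃ δ, δ = |z.ρ - P.r| + |z.θ - P.Θ| := ⟨_, rfl⟩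
  have hx0 : 0 ≤ x := hx ▸ Real.sqrt_nonneg _
  have hy0 : 0 ≤ y := hy ▸ Real.sqrt_nonneg _
  have hδ0 : 0 ≤ δ := hδ ▸ by positivity
  have hx2 : x * x = normSq (z.u - P.U) := hx ▸ Real.mul_self_sqrt (normSq_nonneg _)
  have hy2 : y * y = normSq (z.B - P.H) := hy ▸ Real.mul_self_sqrt (normSq_nonneg _)
  have hδ1 : |z.ρ - P.r| ≤ δ := hδ ▸ le_add_of_nonneg_right (abs_nonneg _)
  have hsq : (z.ρ - P.r) ^ 2 + (z.θ - P.Θ) ^ 2 ≤ δ * δ := by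
    rw [← sq_abs (z.ρ - P.r), ← sq_abs (z.θ - P.Θ), hδ]
    nlinarith [abs_nonneg (z.ρ - P.r), abs_nonneg (z.θ - P.Θ)]
  have hsq' : δ * δ ≤ 2 * ((z.ρ - P.r) ^ 2 + (z.θ - P.Θ) ^ 2) := by
    rw [← sq_abs (z.ρ - P.r), ← sq_abs (z.θ - P.Θ), hδ]
    nlinarith [sq_nonneg (|z.ρ - P.r| - |z.θ - P.Θ|)]
  obtain ⟨exx, eyy, edd, exy, exd⟩ := quadratic_bounds x y δ
  obtain ⟨E, hE⟩ : ∃ E, E = x * x + y * y + δ * δ := ⟨_, rfl⟩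
  rw [← hE] at exx eyy edd exy exd
  have hE0 : 0 ≤ E := hE ▸ by positivity
  have hEd : E ≤ 2 * dist2 P z := by
    have := normSq_nonneg (z.u - P.U)
    have := normSq_nonneg (z.B - P.H)
    rw [hE, dist2]; linarith
  have bw : ∀ i, |(z.u - P.U) i| ≤ x := hx ▸ abs_apply_le_sqrt _
  have bb : ∀ i, |(z.B - P.H) i| ≤ y := hy ▸ abs_apply_le_sqrt _
  have bY : ∀ i, |P.Y i| ≤ 2 * N := by
    have h : ∀ i j k l, |P.JH i j - P.JH k l| ≤ 2 * N := fun i j k l => by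
      have := abs_sub_le_add (hP.JH i j) (hP.JH k l); linarith
    intro i
    fin_cases i <;> simp [Y] <;> apply h
  have bD : |P.DΘ| ≤ N + 3 * (N * N) :=
    abs_add_le_add hP.Θt (abs_sum_three_le fun j => abs_mul_le_mul (hP.U j) (hP.gΘ j))
  have btr := abs_trace_le hP.JU
  have bs := hδ ▸ hL _ _ _ _ hz hb
  have bts := (hLs _ _ _ _ hz hb).trans (mul_le_mul_of_nonneg_left hsq hLs0)
  have btp := (hLp _ _ _ _ hz hb).trans (mul_le_mul_of_nonneg_left hsq hLp0)
  have t1 : |∑ i, (z.ρ - P.r) / P.r * (z.u - P.U) i * (P.divS i + (P.Y ⨯₃ P.H) i)|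
      ≤ 3 * (δ * a⁻¹ * x * (N + 2 * (2 * N * N))) :=
    abs_sum_three_le fun i => abs_mul_le_mul
      (abs_mul_le_mul (by rw [div_eq_mul_inv]; exact abs_mul_le_mul hδ1 hir) (bw i))
      (abs_add_le_add (hP.divS i) (abs_cross_le bY hP.H i))
  have t2 := abs_mul_le_mul hρ (abs_bilin_le bw bw hP.JU)
  have t3 := abs_bilin_le bb bb hP.JU
  have t4 : |1 / 2 * normSq (z.B - P.H) * P.JU.trace| ≤ 1 / 2 * (y * y) * (3 * N) := by
    refine abs_mul_le_mul ?_ btr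
    rw [hy2, abs_of_nonneg (by have := normSq_nonneg (z.B - P.H); positivity)]
  have t5 := abs_dotProduct_le (abs_cross_le bb bw) bY
  have t6 := abs_mul_le_mul (abs_mul_le_mul hρ bs) (abs_dotProduct_le bw hP.gΘ)
  have t7 := abs_mul_le_mul (abs_mul_le_mul hδ1 bs) bD
  have t8 := abs_mul_le_mul (abs_mul_le_mul hrb bts) bD
  have t9 := abs_mul_le_mul btp btr
  have f1 : 3 * (δ * a⁻¹ * x * (N + 2 * (2 * N * N))) ≤ 3 * (a⁻¹ * (N + 2 * (2 * N * N))) * E := by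
    calc _ = 3 * (a⁻¹ * (N + 2 * (2 * N * N))) * (δ * x) := by ring
      _ ≤ _ := by gcongr
  have f2 : |b| * (9 * (x * x * N)) ≤ 9 * |b| * N * E := by
    calc _ = 9 * |b| * N * (x * x) := by ring
      _ ≤ _ := by gcongr
  have f3 : 9 * (y * y * N) ≤ 9 * N * E := by
    calc _ = 9 * N * (y * y) := by ring
      _ ≤ _ := by gcongr
  have f4 : 1 / 2 * (y * y) * (3 * N) ≤ 3 / 2 * N * E := by
    calc _ = 3 / 2 * N * (y * y) := by ring
      _ ≤ _ := by gcongr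
  have f5 : 3 * (2 * (y * x) * (2 * N)) ≤ 12 * N * E := by
    calc _ = 12 * N * (y * x) := by ring
      _ ≤ _ := by gcongr
  have f6 : |b| * (L * δ) * (3 * (x * N)) ≤ 3 * |b| * L * N * E := by
    calc _ = 3 * |b| * L * N * (δ * x) := by ring
      _ ≤ _ := by gcongr
  have f7 : δ * (L * δ) * (N + 3 * (N * N)) ≤ L * (N + 3 * (N * N)) * E := by
    calc _ = L * (N + 3 * (N * N)) * (δ * δ) := by ring
      _ ≤ _ := by gcongr
  have f8 : |b| * (Ls * (δ * δ)) * (N + 3 * (N * N)) ≤ |b| * Ls * (N + 3 * (N * N)) * E := by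
    calc _ = |b| * Ls * (N + 3 * (N * N)) * (δ * δ) := by ring
      _ ≤ _ := by gcongr
  have f9 : Lp * (δ * δ) * (3 * N) ≤ 3 * Lp * N * E := by
    calc _ = 3 * Lp * N * (δ * δ) := by ring
      _ ≤ _ := by gcongr
  have fin : K * E ≤ 2 * K * dist2 P z := by
    calc K * E ≤ K * (2 * dist2 P z) := by gcongr
      _ = _ := by ring
  refine le_trans ?_ fin
  have s1 := (abs_le.1 t1).1
  have s2 := (abs_le.1 t2).1
  have s3 := (abs_le.1 t3).2
  have s4 := (abs_le.1 t4).1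
  have s5 := (abs_le.1 t5).2
  have s6 := (abs_le.1 t6).1
  have s7 := (abs_le.1 t7).1
  have s8 := (abs_le.1 t8).1
  have s9 := (abs_le.1 t9).1
  simp only [K, add_mul]
  linarith

/-- Both temperatures lie in [c,d], so their ratio is at least c/d; if d < c there is no admissible
Θ and the constant is a default. -/
theorem exists_diss_coercive {k : ℝ → ℝ → ℝ} (hk : C1Quad k)
    (hpos : ∀ ρ θ, 0 < ρ → 0 < θ → 0 < k ρ θ) (ha : 0 < a) (hc : 0 < c) :
    ∃ m, 0 < m ∧ ∀ ρ θ Θ, (ρ, θ) ∈ box a b c d → Θ ∈ Icc c d → m ≤ Θ / θ * k ρ θ := by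
  by_cases hd : c ≤ d
  · obtain ⟨m, hm, h⟩ := exists_pos_lower_bound (b := b) (d := d) (ContDiffOn.continuousOn hk)
      hpos ha hc
    have hd0 := hc.trans_le hd
    refine ⟨c / d * m, by positivity, fun ρ θ Θ hz hΘ => ?_⟩
    have hθ0 := hc.trans_le hz.2.1
    have h1 : c / d ≤ Θ / θ := div_le_div₀ (hc.le.trans hΘ.1) hΘ.1 hθ0 hz.2.2
    exact mul_le_mul h1 (h _ _ hz) hm.le (div_nonneg (hc.le.trans hΘ.1) hθ0.le)
  · exact ⟨1, one_pos, fun ρ θ Θ _ hΘ => absurd (hΘ.1.trans hΘ.2) hd⟩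

/-- The dissipative terms. -/
theorem exists_dissipative_bound (hμ : C1Quad fl.μ) (hη : C1Quad fl.η) (hκ : C1Quad fl.κ)
    (hζ : C1Quad fl.ζ) (hμ_pos : ∀ ρ θ : ℝ, 0 < ρ → 0 < θ → 0 < fl.μ ρ θ)
    (hη_nonneg : ∀ ρ θ : ℝ, 0 < ρ → 0 < θ → 0 ≤ fl.η ρ θ)
    (hκ_pos : ∀ ρ θ : ℝ, 0 < ρ → 0 < θ → 0 < fl.κ ρ θ)
    (hζ_pos : ∀ ρ θ : ℝ, 0 < ρ → 0 < θ → 0 < fl.ζ ρ θ)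
    (ha : 0 < a) (hc : 0 < c) {N : ℝ} :
    ∃ K m, 0 ≤ K ∧ 0 < m ∧ ∀ (P : StrongPoint) (z : Phase), P.BddBy N →
      (P.r, P.Θ) ∈ box a b c d → (z.ρ, z.θ) ∈ box a b c d →
      dissForm P.Θ z.θ (fl.μ z.ρ z.θ) (fl.μ P.r P.Θ) (shear z.Du z.Du) (shear z.Du P.D)
          (shear P.D P.D)
        + dissForm P.Θ z.θ (fl.η z.ρ z.θ / 3) (fl.η P.r P.Θ / 3) (z.Du.trace * z.Du.trace)
          (z.Du.trace * P.D.trace) (P.D.trace * P.D.trace)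
        + dissForm P.Θ z.θ (fl.κ z.ρ z.θ / z.θ) (fl.κ P.r P.Θ / P.Θ) (normSq z.Dθ)
          (z.Dθ ⬝ᵥ P.gΘ) (normSq P.gΘ)
        + dissForm P.Θ z.θ (fl.ζ z.ρ z.θ) (fl.ζ P.r P.Θ) (normSq z.CB)
          (z.CB ⬝ᵥ P.Y) (normSq P.Y) ≤ K * dist2 P z - m * diss P z := by
  obtain ⟨A1, hA1, B1⟩ := hμ.exists_transport_bound (b := b) (d := d) ha hc
  obtain ⟨A2, hA2, B2⟩ := (hη.div_const 3).exists_transport_bound (b := b) (d := d) ha hc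
  obtain ⟨A3, hA3, B3⟩ := hκ.div_temperature.exists_transport_bound (b := b) (d := d) ha hc
  obtain ⟨A4, hA4, B4⟩ := hζ.exists_transport_bound (b := b) (d := d) ha hc
  obtain ⟨m1, hm1, c1⟩ := exists_diss_coercive (b := b) (d := d) hμ hμ_pos ha hc
  obtain ⟨m3, hm3, c3⟩ := exists_diss_coercive (b := b) (d := d) hκ.div_temperature
    (fun ρ θ hρ hθ => div_pos (hκ_pos ρ θ hρ hθ) hθ) ha hc
  obtain ⟨m4, hm4, c4⟩ := exists_diss_coercive (b := b) (d := d) hζ hζ_pos ha hc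
  -- These are the constants of `dissForm_le` for shear, bulk, heat and magnetic dissipation. 21 =
  -- 2·9 + 3·3/3 bounds the shear form, 9 = 3·3 a product of traces, 3 a scalar product; curl H is
  -- bounded by 2N, which gives 6 and 12. Shear and bulk draw on the same `m1` and take a quarter
  -- each, so that half remains.
  let K1 := (A1 * (21 * N)) ^ 2 / (4 * (m1 / 4)) + A1 * (21 * N ^ 2)
  let K2 := (A2 * (9 * N)) ^ 2 / (4 * (m1 / 4)) + A2 * (9 * N ^ 2)
  let K3 := (A3 * (3 * N)) ^ 2 / (4 * (m3 / 2)) + A3 * (3 * N ^ 2)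
  let K4 := (A4 * (6 * N)) ^ 2 / (4 * (m4 / 2)) + A4 * (12 * N ^ 2)
  have hK : 0 ≤ K1 + K2 + K3 + K4 := by positivity
  refine ⟨2 * (K1 + K2 + K3 + K4), min (m1 / 2) (min (m3 / 2) (m4 / 2)), by positivity,
    by positivity, fun P z hP hb hz => ?_⟩
  obtain ⟨δ, hδ⟩ : ∃ δ, δ = |z.ρ - P.r| + |z.θ - P.Θ| := ⟨_, rfl⟩
  have hθ0 : z.θ ≠ 0 := (hc.trans_le hz.2.1).ne'
  have hΘ0 : P.Θ ≠ 0 := (hc.trans_le hb.2.1).ne'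
  have hδ1 : |z.θ - P.Θ| ≤ δ := hδ ▸ le_add_of_nonneg_left (abs_nonneg _)
  have hsq' : δ ^ 2 ≤ 2 * ((z.ρ - P.r) ^ 2 + (z.θ - P.Θ) ^ 2) := by
    rw [← sq_abs (z.ρ - P.r), ← sq_abs (z.θ - P.Θ), hδ]
    nlinarith [sq_nonneg (|z.ρ - P.r| - |z.θ - P.Θ|)]
  obtain ⟨X, hX⟩ : ∃ X, X = √(frob (z.Du - P.D) (z.Du - P.D)) := ⟨_, rfl⟩
  obtain ⟨Y, hY⟩ : ∃ Y, Y = √(normSq (z.Dθ - P.gΘ)) := ⟨_, rfl⟩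
  obtain ⟨Z, hZ⟩ : ∃ Z, Z = √(normSq (z.CB - P.Y)) := ⟨_, rfl⟩
  have hX2 : X ^ 2 = frob (z.Du - P.D) (z.Du - P.D) := hX ▸ Real.sq_sqrt (frob_self_nonneg _)
  have hY2 : Y ^ 2 = normSq (z.Dθ - P.gΘ) := hY ▸ Real.sq_sqrt (normSq_nonneg _)
  have hZ2 : Z ^ 2 = normSq (z.CB - P.Y) := hZ ▸ Real.sq_sqrt (normSq_nonneg _)
  have bX : ∀ i j, |(z.Du - P.D) i j| ≤ X := hX ▸ abs_apply_le_sqrt_frob _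
  have bY : ∀ i, |(z.Dθ - P.gΘ) i| ≤ Y := hY ▸ abs_apply_le_sqrt _
  have bZ : ∀ i, |(z.CB - P.Y) i| ≤ Z := hZ ▸ abs_apply_le_sqrt _
  have bD : ∀ i j, |P.D i j| ≤ N := fun i j => by
    have h1 : P.D i j = 1 / 2 * (P.JU i j + P.JU j i) := by simp [D, symPart]
    have h2 := abs_add_le_add (hP.JU i j) (hP.JU j i)
    rw [h1, abs_mul, abs_of_pos (by norm_num : (0 : ℝ) < 1 / 2)]
    linarith
  have bC : ∀ i, |P.Y i| ≤ 2 * N := by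
    have h : ∀ i j k l, |P.JH i j - P.JH k l| ≤ 2 * N := fun i j k l => by
      have := abs_sub_le_add (hP.JH i j) (hP.JH k l); linarith
    intro i
    fin_cases i <;> simp [StrongPoint.Y] <;> apply h
  have shear_le : ∀ {A B : M3} {S T : ℝ}, (∀ i j, |A i j| ≤ S) → (∀ i j, |B i j| ≤ T) →
      |shear A B| ≤ 21 * (S * T) := fun {A B S T} hA hB => by
    have h1 := abs_frob_le hA hB
    have h2 := abs_mul_le_mul (abs_trace_le hA) (abs_trace_le hB)
    have h3 : |shear A B| ≤ 2 * |frob A B| + |A.trace * B.trace| / 3 := by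
      have := abs_sub (2 * frob A B) (A.trace * B.trace / 3)
      rw [abs_mul, abs_two, abs_div, abs_of_pos (by norm_num : (0 : ℝ) < 3)] at this
      exact this
    linarith
  have f1 := dissForm_le (X := X) (m := m1) (ε := m1 / 4) (N₁ := 21 * N) (N₂ := 21 * N ^ 2) hθ0 hΘ0
    (by positivity) (hδ ▸ (B1 _ _ _ _ hz hb).1) (hδ ▸ (B1 _ _ _ _ hz hb).2) hδ1
    (YW := shear P.D (z.Du - P.D)) (YY := shear P.D P.D)
    (WW := shear (z.Du - P.D) (z.Du - P.D))
    (by linarith [shear_le bD bX]) (by linarith [shear_le bD bD]) (by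
      have h1 := c1 _ _ _ hz hb.2
      -- The shear form omits part of the trace, but in three dimensions it still dominates the full
      -- norm of the matrix; thus μ > 0 alone controls the whole symmetric gradient.
      have h2 : X ^ 2 ≤ shear (z.Du - P.D) (z.Du - P.D) := by
        have := trace_sq_le (z.Du - P.D)
        rw [hX2, shear, ← sq]; linarith
      exact mul_le_mul h1 h2 (sq_nonneg _) (hm1.le.trans h1))
  rw [← (shear_expand z.Du P.D).1, ← (shear_expand z.Du P.D).2] at f1
  -- Since η may vanish, bulk viscosity contributes only a sign, whence `m := 0`; its mixed term is
  -- absorbed by the shear dissipation.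
  have f2 := dissForm_le (X := X) (m := 0) (ε := m1 / 4) (N₁ := 9 * N) (N₂ := 9 * N ^ 2) hθ0 hΘ0
    (by positivity) (hδ ▸ (B2 _ _ _ _ hz hb).1) (hδ ▸ (B2 _ _ _ _ hz hb).2) hδ1
    (YW := P.D.trace * (z.Du - P.D).trace) (YY := P.D.trace * P.D.trace)
    (WW := (z.Du - P.D).trace * (z.Du - P.D).trace)
    (by linarith [abs_mul_le_mul (abs_trace_le bD) (abs_trace_le bX)])
    (by linarith [abs_mul_le_mul (abs_trace_le bD) (abs_trace_le bD)]) (by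
      have h1 : 0 ≤ fl.η z.ρ z.θ := hη_nonneg _ _ (ha.trans_le hz.1.1) (hc.trans_le hz.2.1)
      have h2 : 0 ≤ P.Θ / z.θ := div_nonneg (hc.le.trans hb.2.1) (hc.le.trans hz.2.1)
      rw [zero_mul]
      exact mul_nonneg (mul_nonneg h2 (by positivity)) (mul_self_nonneg _))
  have e2 : P.D.trace * P.D.trace + 2 * (P.D.trace * (z.Du - P.D).trace)
      + (z.Du - P.D).trace * (z.Du - P.D).trace = z.Du.trace * z.Du.trace := by
    rw [Matrix.trace_sub]; ring
  have e2' : P.D.trace * P.D.trace + P.D.trace * (z.Du - P.D).trace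
      = z.Du.trace * P.D.trace := by
    rw [Matrix.trace_sub]; ring
  rw [e2, e2'] at f2
  have f3 := dissForm_le (X := Y) (m := m3) (ε := m3 / 2) (N₁ := 3 * N) (N₂ := 3 * N ^ 2) hθ0 hΘ0
    (by positivity) (hδ ▸ (B3 _ _ _ _ hz hb).1) (hδ ▸ (B3 _ _ _ _ hz hb).2) hδ1
    (YW := P.gΘ ⬝ᵥ (z.Dθ - P.gΘ)) (YY := normSq P.gΘ) (WW := normSq (z.Dθ - P.gΘ))
    (by linarith [abs_dotProduct_le hP.gΘ bY])
    (by have := abs_dotProduct_le hP.gΘ hP.gΘ; rw [normSq]; linarith)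
    (by
      rw [← hY2]
      exact mul_le_mul_of_nonneg_right (c3 _ _ _ hz hb.2) (sq_nonneg _))
  rw [← (normSq_expand z.Dθ P.gΘ).1, ← (normSq_expand z.Dθ P.gΘ).2] at f3
  have f4 := dissForm_le (X := Z) (m := m4) (ε := m4 / 2) (N₁ := 6 * N) (N₂ := 12 * N ^ 2) hθ0 hΘ0
    (by positivity) (hδ ▸ (B4 _ _ _ _ hz hb).1) (hδ ▸ (B4 _ _ _ _ hz hb).2) hδ1
    (YW := P.Y ⬝ᵥ (z.CB - P.Y)) (YY := normSq P.Y) (WW := normSq (z.CB - P.Y))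
    (by linarith [abs_dotProduct_le bC bZ])
    (by have := abs_dotProduct_le bC bC; rw [normSq]; linarith)
    (by
      rw [← hZ2]
      exact mul_le_mul_of_nonneg_right (c4 _ _ _ hz hb.2) (sq_nonneg _))
  rw [← (normSq_expand z.CB P.Y).1, ← (normSq_expand z.CB P.Y).2] at f4
  have g1 : (K1 + K2 + K3 + K4) * δ ^ 2 ≤ 2 * (K1 + K2 + K3 + K4) * dist2 P z := by
    have := normSq_nonneg (z.u - P.U)
    have := normSq_nonneg (z.B - P.H)
    have h2 : δ ^ 2 ≤ 2 * dist2 P z := by rw [dist2]; linarith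
    calc _ ≤ (K1 + K2 + K3 + K4) * (2 * dist2 P z) := by gcongr
      _ = _ := by ring
  have g2 : min (m1 / 2) (min (m3 / 2) (m4 / 2)) * diss P z
      ≤ m1 / 2 * X ^ 2 + m3 / 2 * Y ^ 2 + m4 / 2 * Z ^ 2 := by
    rw [diss, ← hX2, ← hY2, ← hZ2]
    have l1 := mul_le_mul_of_nonneg_right (min_le_left (m1 / 2) (min (m3 / 2) (m4 / 2)))
      (sq_nonneg X)
    have l2 := mul_le_mul_of_nonneg_right ((min_le_right (m1 / 2) (min (m3 / 2) (m4 / 2))).trans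
      (min_le_left _ _)) (sq_nonneg Y)
    have l3 := mul_le_mul_of_nonneg_right ((min_le_right (m1 / 2) (min (m3 / 2) (m4 / 2))).trans
      (min_le_right _ _)) (sq_nonneg Z)
    linarith
  have g3 : (K1 + K2 + K3 + K4) * δ ^ 2 = K1 * δ ^ 2 + K2 * δ ^ 2 + K3 * δ ^ 2 + K4 * δ ^ 2 := by
    ring
  change _ ≤ _ + K1 * δ ^ 2 at f1
  change _ ≤ _ + K2 * δ ^ 2 at f2
  change _ ≤ _ + K3 * δ ^ 2 at f3
  change _ ≤ _ + K4 * δ ^ 2 at f4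
  linarith

/-- The relative energy integrand is controlled by the relative energy and dominates the
dissipation. -/
theorem exists_raw_bound (hμ : C1Quad fl.μ) (hη : C1Quad fl.η) (hκ : C1Quad fl.κ)
    (hζ : C1Quad fl.ζ) (hμ_pos : ∀ ρ θ : ℝ, 0 < ρ → 0 < θ → 0 < fl.μ ρ θ)
    (hη_nonneg : ∀ ρ θ : ℝ, 0 < ρ → 0 < θ → 0 ≤ fl.η ρ θ)
    (hκ_pos : ∀ ρ θ : ℝ, 0 < ρ → 0 < θ → 0 < fl.κ ρ θ)
    (hζ_pos : ∀ ρ θ : ℝ, 0 < ρ → 0 < θ → 0 < fl.ζ ρ θ)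
    (hp : C1Quad fl.p) (he : C1Quad fl.e) (hs : C1Quad fl.s)
    (hpl : LipDerivQuad fl.p) (hsl : LipDerivQuad fl.s)
    (hG : fl.Gibbs) (hst : fl.ThermodynamicallyStable)
    (ha : 0 < a) (hc : 0 < c) {N : ℝ} (hN : 0 ≤ N) :
    ∃ C m, 0 ≤ C ∧ 0 < m ∧ ∀ (P : StrongPoint) (z : Phase), P.Eqs fl → P.BddBy N →
      (P.r, P.Θ) ∈ box a b c d → (z.ρ, z.θ) ∈ box a b c d → z.Du.IsSymm →
      P.raw fl z ≤ C * relEnergy fl P z - m * diss P z := by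
  obtain ⟨m0, hm0, h0⟩ := exists_relEnergy_coercive (b := b) (d := d) hG hst hp he hs ha hc
  obtain ⟨K1, hK1, h1⟩ := exists_convective_bound (b := b) (d := d) hp hs hpl hsl ha hc hN
  obtain ⟨K2, m, hK2, hm, h2⟩ := exists_dissipative_bound (b := b) (d := d) hμ hη hκ hζ hμ_pos
    hη_nonneg hκ_pos hζ_pos ha hc (N := N)
  -- Both bounds are in terms of the squared distance of the states; division by the coercivity
  -- constant converts it into relative energy.
  refine ⟨(K1 + K2) / m0, m, by positivity, hm, fun P z hE hP hb hz hsym => ?_⟩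
  have hr : 0 < P.r := ha.trans_le hb.1.1
  rw [raw_eq hE hr (hG.maxwell hp he hs hr (hc.trans_le hb.2.1)) z hsym]
  have g1 := h1 P z hP hb hz
  have g2 := h2 P z hP hb hz
  have g3 : (K1 + K2) * dist2 P z ≤ (K1 + K2) / m0 * relEnergy fl P z := by
    have := mul_le_mul_of_nonneg_left (h0 P z hb hz) (by positivity : 0 ≤ (K1 + K2) / m0)
    calc _ = (K1 + K2) / m0 * (m0 * dist2 P z) := by field_simp
      _ ≤ _ := this
  linarith

end StrongPoint

/-! ### Positive extension of the density and the temperature -/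

theorem dt_congr {f g : ℝ → V3 → ℝ} {t : ℝ} {x : V3} (h : ∀ᶠ s in 𝓝 t, f s x = g s x) :
    dt f t x = dt g t x := EventuallyEq.deriv_eq h

theorem dtV_congr {f g : ℝ → V3 → V3} {t : ℝ} {x : V3} (h : ∀ᶠ s in 𝓝 t, f s x = g s x) :
    dtV f t x = dtV g t x := by
  funext i
  exact EventuallyEq.deriv_eq (h.mono fun s hs => congrFun hs i)

theorem grad_congr {f g : V3 → ℝ} {x : V3} (h : ∀ᶠ y in 𝓝 x, f y = g y) : grad f x = grad g x :=
  funext fun j => pd_congr h j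

theorem dvg_congr {f g : V3 → V3} {x : V3} (h : ∀ᶠ y in 𝓝 x, f y = g y) : dvg f x = dvg g x :=
  Finset.sum_congr rfl fun j _ => pd_congr (h.mono fun y hy => by simp only [hy]) j

theorem dvgM_congr {f g : V3 → M3} {x : V3} (h : ∀ᶠ y in 𝓝 x, f y = g y) :
    dvgM f x = dvgM g x :=
  funext fun i => Finset.sum_congr rfl fun j _ => pd_congr (h.mono fun y hy => by simp only [hy]) j

theorem curl_congr {f g : V3 → V3} {x : V3} (h : ∀ᶠ y in 𝓝 x, f y = g y) :
    curl f x = curl g x := by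
  have hp : ∀ i j, pd j (fun y => f y i) x = pd j (fun y => g y i) x := fun i j =>
    pd_congr (h.mono fun y hy => by simp only [hy]) j
  simp only [curl, hp]

/-- A smooth positive function that is the identity on `[m/2, ∞)`. -/
noncomputable def posPart (m s : ℝ) : ℝ :=
  Real.smoothTransition (s * (2 / m)) * s + (1 - Real.smoothTransition (s * (2 / m)))

theorem contDiff_posPart (m : ℝ) : ContDiff ℝ 2 (posPart m) := by
  have h : ContDiff ℝ 2 fun s : ℝ => Real.smoothTransition (s * (2 / m)) :=
    Real.smoothTransition.contDiff.comp (contDiff_id.mul contDiff_const)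
  exact (h.mul contDiff_id).add (contDiff_const.sub h)

theorem posPart_pos {m : ℝ} (hm : 0 < m) (s : ℝ) : 0 < posPart m s := by
  rcases le_or_gt s 0 with hs | hs
  · have : s * (2 / m) ≤ 0 := mul_nonpos_of_nonpos_of_nonneg hs (by positivity)
    simp [posPart, Real.smoothTransition.zero_of_nonpos this]
  · have h0 := Real.smoothTransition.nonneg (s * (2 / m))
    have h1 := Real.smoothTransition.le_one (s * (2 / m))
    have h2 : 0 < Real.smoothTransition (s * (2 / m)) :=
      Real.smoothTransition.pos_of_pos (by positivity)
    have := mul_pos h2 hs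
    rw [posPart]; linarith

theorem posPart_eq_self {m s : ℝ} (hm : 0 < m) (hs : m / 2 < s) : posPart m s = s := by
  have : 1 ≤ s * (2 / m) := by
    rw [← mul_div_assoc, le_div_iff₀ hm]; linarith
  simp [posPart, Real.smoothTransition.one_of_one_le this]

theorem IsC1.posPart {f : ℝ → V3 → ℝ} (hf : IsC1 f) (m : ℝ) : IsC1 fun t x => posPart m (f t x) :=
  ((contDiff_posPart m).of_le one_le_two).comp hf

theorem IsC12.posPart {f : ℝ → V3 → ℝ} (hf : IsC12 f) (m : ℝ) :
    IsC12 fun t x => posPart m (f t x) := by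
  have hσ := contDiff_posPart m
  have hσ' : ContDiff ℝ 1 (deriv (MHD.posPart m)) := by
    have := (contDiff_succ_iff_deriv (n := 1)).1
      (show ContDiff ℝ (1 + 1) (MHD.posPart m) by rw [one_add_one_eq_two]; exact hσ)
    exact this.2.2
  refine ⟨hf.1.posPart m, fun t => hσ.comp (hf.2.1 t), ?_⟩
  have hd : ∀ t y, HasFDerivAt (f t) (fderiv ℝ (f t) y) y := fun t y =>
    ((hf.2.1 t).differentiable two_ne_zero y).hasFDerivAt
  have h1 : ∀ t, (fun y => fderiv ℝ (fun x => MHD.posPart m (f t x)) y)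
      = fun y => deriv (MHD.posPart m) (f t y) • fderiv ℝ (f t) y := by
    intro t; funext y
    exact (((hσ.differentiable two_ne_zero _).hasDerivAt).comp_hasFDerivAt y (hd t y)).fderiv
  have h2 : ∀ t y, fderiv ℝ (fun y => fderiv ℝ (fun x => MHD.posPart m (f t x)) y) y
      = deriv (MHD.posPart m) (f t y) • fderiv ℝ (fun y => fderiv ℝ (f t) y) y
        + (deriv (deriv (MHD.posPart m)) (f t y) • fderiv ℝ (f t) y).smulRight
          (fderiv ℝ (f t) y) := by
    intro t y
    rw [h1]
    have hdd : DifferentiableAt ℝ (fun y => fderiv ℝ (f t) y) y :=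
      (((hf.2.1 t).fderiv_right (m := 1) (by norm_num)).differentiable one_ne_zero) y
    have hc := ((hσ'.differentiable one_ne_zero _).hasDerivAt).comp_hasFDerivAt y (hd t y)
    exact (hc.smul hdd.hasFDerivAt).fderiv
  simp only [h2]
  have c0 := hf.1.continuous
  have c1 : Continuous fun q : ℝ × V3 => fderiv ℝ (f q.1) q.2 := by
    have : ∀ q : ℝ × V3, fderiv ℝ (f q.1) q.2
        = (fderiv ℝ (fun q : ℝ × V3 => f q.1 q.2) q).comp (ContinuousLinearMap.inr ℝ ℝ V3) :=
      fun q => (HasFDerivAt.comp (f := fun x : V3 => (q.1, x)) q.2 (hf.1.hasFDerivAt q)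
        (hasFDerivAt_prodMk_right q.1 q.2)).fderiv
    simp only [this]
    exact hf.1.continuous_fderiv.clm_comp continuous_const
  have c2 : Continuous (deriv (MHD.posPart m)) := hσ'.continuous
  have c3 : Continuous (deriv (deriv (MHD.posPart m))) := hσ'.continuous_deriv le_rfl
  have : ContinuousAdd (V3 →L[ℝ] V3 →L[ℝ] ℝ) :=
    (inferInstance : IsTopologicalAddGroup (V3 →L[ℝ] V3 →L[ℝ] ℝ)).toContinuousAdd
  refine Continuous.add ((c2.comp c0).smul hf.2.2) ?_
  have c4 : Continuous fun q : ℝ × V3 =>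
      deriv (deriv (MHD.posPart m)) (f q.1 q.2) • fderiv ℝ (f q.1) q.2 := (c3.comp c0).smul c1
  exact ((ContinuousLinearMap.smulRightL ℝ V3 (V3 →L[ℝ] ℝ)).continuous.comp c4).clm_apply c1

theorem exists_pos_lower_bound_of_compact {f : ℝ → V3 → ℝ} (hf : IsC1 f) {K : Set (ℝ × V3)}
    (hK : IsCompact K) (hpos : ∀ q ∈ K, 0 < f q.1 q.2) : ∃ m, 0 < m ∧ ∀ q ∈ K, m ≤ f q.1 q.2 := by
  rcases K.eq_empty_or_nonempty with rfl | hne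
  · exact ⟨1, one_pos, fun q hq => hq.elim⟩
  · obtain ⟨q, hq, hmin⟩ := hK.exists_isMinOn hne hf.continuous.continuousOn
    exact ⟨f q.1 q.2, hpos q hq, fun p hp => hmin hp⟩

theorem posPart_eventuallyEq {f : ℝ → V3 → ℝ} (hf : IsC1 f) {m : ℝ} (hm : 0 < m) {q : ℝ × V3}
    (hq : m ≤ f q.1 q.2) : ∀ᶠ p in 𝓝 q, posPart m (f p.1 p.2) = f p.1 p.2 := by
  have : ∀ᶠ p in 𝓝 q, m / 2 < f p.1 p.2 :=
    hf.continuous.continuousAt.eventually_const_lt ((half_lt_self hm).trans_le hq)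
  filter_upwards [this] with p hp using posPart_eq_self hm hp

/-- One may assume that the density and the temperature of a strong solution are positive
everywhere, not only on `[0,T] × Ω̄`. -/
theorem IsStrongSolution.exists_positive {G : Geometry} {bd : BoundaryData G} {fl : Fluid}
    {ρ₀ : V3 → ℝ} {u₀ : V3 → V3} {θ₀ : V3 → ℝ} {B₀ : V3 → V3}
    {r : ℝ → V3 → ℝ} {U : ℝ → V3 → V3} {Θ : ℝ → V3 → ℝ} {H : ℝ → V3 → V3}
    (h : IsStrongSolution G bd fl ρ₀ u₀ θ₀ B₀ r U Θ H) :
    ∃ r' Θ', IsStrongSolution G bd fl ρ₀ u₀ θ₀ B₀ r' U Θ' H ∧ (∀ t x, 0 < r' t x) ∧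
      (∀ t x, 0 < Θ' t x) ∧ ∀ t ∈ Ioo 0 G.T, ∀ x ∈ G.Ω, r' t x = r t x ∧ Θ' t x = Θ t x ∧
        grad (Θ' t) x = grad (Θ t) x := by
  have hK : IsCompact (Icc 0 G.T ×ˢ closure G.Ω) := isCompact_Icc.prod G.isBounded.isCompact_closure
  obtain ⟨m, hm, hm'⟩ := exists_pos_lower_bound_of_compact h.r_reg hK
    fun q hq => h.r_pos q.1 hq.1 q.2 hq.2
  obtain ⟨n, hn, hn'⟩ := exists_pos_lower_bound_of_compact h.Θ_reg.1 hK
    fun q hq => h.Θ_pos q.1 hq.1 q.2 hq.2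
  let r' : ℝ → V3 → ℝ := fun t x => posPart m (r t x)
  let Θ' : ℝ → V3 → ℝ := fun t x => posPart n (Θ t x)
  -- Equality holds in full space-time neighbourhoods, also of points with t = 0 or x on the
  -- boundary, because the modification starts only below half the minimum. Hence all derivatives
  -- agree on the closed cylinder.
  have ev : ∀ t ∈ Icc 0 G.T, ∀ x ∈ closure G.Ω,
      ∀ᶠ p in 𝓝 (t, x), r' p.1 p.2 = r p.1 p.2 ∧ Θ' p.1 p.2 = Θ p.1 p.2 := fun t ht x hx =>
    (posPart_eventuallyEq h.r_reg hm (hm' (t, x) ⟨ht, hx⟩)).and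
      (posPart_eventuallyEq h.Θ_reg.1 hn (hn' (t, x) ⟨ht, hx⟩))
  have evx : ∀ t ∈ Icc 0 G.T, ∀ x ∈ closure G.Ω,
      ∀ᶠ y in 𝓝 x, r' t y = r t y ∧ Θ' t y = Θ t y := fun t ht x hx =>
    (Continuous.tendsto (by fun_prop : Continuous fun y : V3 => (t, y)) x).eventually (ev t ht x hx)
  have evt : ∀ t ∈ Icc 0 G.T, ∀ x ∈ closure G.Ω,
      ∀ᶠ s in 𝓝 t, r' s x = r s x ∧ Θ' s x = Θ s x := fun t ht x hx =>
    (Continuous.tendsto (by fun_prop : Continuous fun s : ℝ => (s, x)) t).eventually (ev t ht x hx)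
  have eq : ∀ t ∈ Icc 0 G.T, ∀ x ∈ closure G.Ω, r' t x = r t x ∧ Θ' t x = Θ t x :=
    fun t ht x hx => (evx t ht x hx).self_of_nhds
  -- The entropy flux contains ∇Θ and is differentiated once more, so the gradients must agree near
  -- the point and not only at it.
  have evg : ∀ t ∈ Icc 0 G.T, ∀ x ∈ closure G.Ω,
      ∀ᶠ y in 𝓝 x, r' t y = r t y ∧ Θ' t y = Θ t y ∧ grad (Θ' t) y = grad (Θ t) y := by
    intro t ht x hx
    filter_upwards [evx t ht x hx, eventually_eventually_nhds.2 (evx t ht x hx)] with y h1 h2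
    exact ⟨h1.1, h1.2, grad_congr (h2.mono fun _ hz => hz.2)⟩
  have hfr : frontier G.Ω ⊆ closure G.Ω := frontier_subset_closure
  have hθD : G.ΓθD ⊆ closure G.Ω := (subset_union_left.trans G.union_θ.subset).trans hfr
  have hθN : G.ΓθN ⊆ closure G.Ω := (subset_union_right.trans G.union_θ.subset).trans hfr
  have h0 : (0 : ℝ) ∈ Icc 0 G.T := left_mem_Icc.2 G.T_pos.le
  refine ⟨r', Θ', ?_, fun t x => posPart_pos hm _, fun t x => posPart_pos hn _,
    fun t ht x hx => (evg t (Ioo_subset_Icc_self ht) x (subset_closure hx)).self_of_nhds⟩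
  refine
    { r_reg := h.r_reg.posPart m
      U_reg := h.U_reg
      Θ_reg := h.Θ_reg.posPart n
      H_reg := h.H_reg
      r_pos := fun t _ x _ => posPart_pos hm _
      Θ_pos := fun t _ x _ => posPart_pos hn _
      continuity := ?_
      momentum := ?_
      induction := ?_
      solenoidal := h.solenoidal
      entropy := ?_
      bc_velocity := h.bc_velocity
      bc_temperature := fun t ht x hx => by
        rw [← h.bc_temperature t ht x hx]; exact (eq t ht x (hθD hx)).2
      bc_heatFlux := fun t ht x hx => by
        obtain ⟨e1, e2, e3⟩ := (evg t ht x (hθN hx)).self_of_nhds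
        rw [e1, e2, e3]; exact h.bc_heatFlux t ht x hx
      bc_tangential := h.bc_tangential
      bc_normal := h.bc_normal
      bc_curl := h.bc_curl
      init_density := fun x hx => by
        rw [← h.init_density x hx]; exact (eq 0 h0 x (subset_closure hx)).1
      init_velocity := h.init_velocity
      init_temperature := fun x hx => by
        rw [← h.init_temperature x hx]; exact (eq 0 h0 x (subset_closure hx)).2
      init_magnetic := h.init_magnetic }
  all_goals
    intro t ht x hx
    have ht' := Ioo_subset_Icc_self ht
    have hx' : x ∈ closure G.Ω := subset_closure hx
    have ex := evx t ht' x hx'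
    have et := evt t ht' x hx'
    have eg := evg t ht' x hx'
    obtain ⟨e1, e2, e3⟩ := eg.self_of_nhds
  · rw [← h.continuity t ht x hx]
    congr 1
    · exact dt_congr (et.mono fun s hs => hs.1)
    · exact dvg_congr (ex.mono fun y hy => by rw [hy.1])
  · have := h.momentum t ht x hx
    rw [dtV_congr (g := fun t x => r t x • U t x) (et.mono fun s hs => by rw [hs.1]),
      dvgM_congr (f := fun y => r' t y • tensor (U t y) (U t y))
        (g := fun y => r t y • tensor (U t y) (U t y)) (ex.mono fun y hy => by rw [hy.1]),
      grad_congr (g := fun y => fl.p (r t y) (Θ t y)) (ex.mono fun y hy => by rw [hy.1, hy.2]),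
      dvgM_congr (f := fun y => fl.stress (r' t y) (Θ' t y) (symGrad (U t) y))
        (g := fun y => fl.stress (r t y) (Θ t y) (symGrad (U t) y))
        (ex.mono fun y hy => by rw [hy.1, hy.2])]
    exact this
  · have := h.induction t ht x hx
    rw [curl_congr (f := fun y => fl.ζ (r' t y) (Θ' t y) • curl (H t) y)
      (g := fun y => fl.ζ (r t y) (Θ t y) • curl (H t) y)
      (ex.mono fun y hy => by rw [hy.1, hy.2])]
    exact this
  · have := h.entropy t ht x hx
    rw [dt_congr (g := fun t x => r t x * fl.s (r t x) (Θ t x))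
        (et.mono fun s hs => by rw [hs.1, hs.2]),
      dvg_congr (f := fun y => (r' t y * fl.s (r' t y) (Θ' t y)) • U t y)
        (g := fun y => (r t y * fl.s (r t y) (Θ t y)) • U t y)
        (ex.mono fun y hy => by rw [hy.1, hy.2]),
      dvg_congr (f := fun y => (1 / Θ' t y) • fl.heatFlux (r' t y) (Θ' t y) (grad (Θ' t) y))
        (g := fun y => (1 / Θ t y) • fl.heatFlux (r t y) (Θ t y) (grad (Θ t) y))
        (eg.mono fun y hy => by rw [hy.1, hy.2.1, hy.2.2]), e1, e2, e3]
    exact this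

/-! ### The strong solution at a point -/

/-- The values and derivatives of a strong solution at `(t,x)`. -/
noncomputable def strongPoint (fl : Fluid) (r : ℝ → V3 → ℝ) (U : ℝ → V3 → V3) (Θ : ℝ → V3 → ℝ)
    (H : ℝ → V3 → V3) (t : ℝ) (x : V3) : StrongPoint where
  r := r t x
  rt := dt r t x
  gr := grad (r t) x
  Θ := Θ t x
  Θt := dt Θ t x
  gΘ := grad (Θ t) x
  U := U t x
  Ut := dtV U t x
  JU := jac (U t) x
  H := H t x
  Ht := dtV H t x
  JH := jac (H t) x
  divS := dvgM (fun y => fl.stress (r t y) (Θ t y) (symGrad (U t) y)) x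
  curlE := curl (fun y => fl.ζ (r t y) (Θ t y) • curl (H t) y) x
  divψ := dvg (fun y => (fl.κ (r t y) (Θ t y) / Θ t y) • grad (Θ t) y) x

/-- A regular state: the regularity of a strong solution, and positivity of the density and the
temperature on the whole space-time. -/
structure RegularState (r : ℝ → V3 → ℝ) (U : ℝ → V3 → V3) (Θ : ℝ → V3 → ℝ) (H : ℝ → V3 → V3) :
    Prop where
  r_reg : IsC1 r
  U_reg : IsC12 U
  Θ_reg : IsC12 Θ
  H_reg : IsC12 H
  r_pos : ∀ t x, 0 < r t x
  Θ_pos : ∀ t x, 0 < Θ t x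

namespace RegularState

variable {fl : Fluid} {f : ℝ → ℝ → ℝ} {r : ℝ → V3 → ℝ} {U : ℝ → V3 → V3} {Θ : ℝ → V3 → ℝ}
  {H : ℝ → V3 → V3}

theorem comp (h : RegularState r U Θ H) (hf : C1Quad f) : IsC1 fun t x => f (r t x) (Θ t x) :=
  IsC1.comp_quadrant hf h.r_reg h.Θ_reg.1 h.r_pos h.Θ_pos

theorem hasFDerivAt_comp (h : RegularState r U Θ H) (hf : C1Quad f) (q : ℝ × V3) (v : ℝ × V3) :
    fderiv ℝ (fun q : ℝ × V3 => f (r q.1 q.2) (Θ q.1 q.2)) q v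
      = d1 f (r q.1 q.2) (Θ q.1 q.2) * fderiv ℝ (fun q : ℝ × V3 => r q.1 q.2) q v
        + d2 f (r q.1 q.2) (Θ q.1 q.2) * fderiv ℝ (fun q : ℝ × V3 => Θ q.1 q.2) q v := by
  have h1 := HasFDerivAt.comp (f := fun q : ℝ × V3 => (r q.1 q.2, Θ q.1 q.2))
    (g := fun q : ℝ × ℝ => f q.1 q.2) q (hf.hasFDerivAt (h.r_pos q.1 q.2) (h.Θ_pos q.1 q.2))
    ((h.r_reg.hasFDerivAt q).prodMk (h.Θ_reg.1.hasFDerivAt q))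
  rw [HasFDerivAt.fderiv (f := fun q : ℝ × V3 => f (r q.1 q.2) (Θ q.1 q.2)) h1]
  exact C1Quad.fderiv_apply _ _ _ _ _

theorem pd_comp (h : RegularState r U Θ H) (hf : C1Quad f) (j : Fin 3) (t : ℝ) (x : V3) :
    pd j (fun y => f (r t y) (Θ t y)) x = (strongPoint fl r U Θ H t x).cg f j := by
  rw [(h.comp hf).pd_eq, h.hasFDerivAt_comp hf, ← h.r_reg.pd_eq, ← h.Θ_reg.1.pd_eq]
  rfl

theorem dt_comp (h : RegularState r U Θ H) (hf : C1Quad f) (t : ℝ) (x : V3) :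
    dt (fun t x => f (r t x) (Θ t x)) t x = (strongPoint fl r U Θ H t x).ct f := by
  rw [(h.comp hf).dt_eq, h.hasFDerivAt_comp hf, ← h.r_reg.dt_eq, ← h.Θ_reg.1.dt_eq]
  rfl

theorem U_isC1 (h : RegularState r U Θ H) (i : Fin 3) : IsC1 fun t x => U t x i :=
  h.U_reg.1.apply i

theorem H_isC1 (h : RegularState r U Θ H) (i : Fin 3) : IsC1 fun t x => H t x i :=
  h.H_reg.1.apply i

theorem jacU_isC01 (h : RegularState r U Θ H) (i j : Fin 3) : IsC01 fun t x => jac (U t) x i j :=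
  (h.U_reg.apply i).isC01_pd j

theorem jacH_isC01 (h : RegularState r U Θ H) (i j : Fin 3) : IsC01 fun t x => jac (H t) x i j :=
  (h.H_reg.apply i).isC01_pd j

theorem symGrad_isC01 (h : RegularState r U Θ H) (i j : Fin 3) :
    IsC01 fun t x => symGrad (U t) x i j := by
  have : ∀ t x, symGrad (U t) x i j = 1 / 2 * (jac (U t) x i j + jac (U t) x j i) := by
    intro t x; simp [symGrad, symPart]
  simp only [this]
  exact (IsC01.const _).mul ((h.jacU_isC01 i j).add (h.jacU_isC01 j i))

theorem stress_isC01 (h : RegularState r U Θ H) (hμ : C1Quad fl.μ) (hη : C1Quad fl.η)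
    (i j : Fin 3) : IsC01 fun t x => fl.stress (r t x) (Θ t x) (symGrad (U t) x) i j := by
  have htr : IsC01 fun t x => (symGrad (U t) x).trace :=
    IsC01.sum (f := fun i t x => symGrad (U t) x i i) fun i => h.symGrad_isC01 i i
  have e : ∀ t x, fl.stress (r t x) (Θ t x) (symGrad (U t) x) i j
      = fl.μ (r t x) (Θ t x) * (2 * symGrad (U t) x i j
          - 1 / 3 * (symGrad (U t) x).trace * (1 : M3) i j)
        + 1 / 3 * fl.η (r t x) (Θ t x) * (symGrad (U t) x).trace * (1 : M3) i j := by
    intro t x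
    simp only [Fluid.stress, Matrix.add_apply, Matrix.smul_apply, Matrix.sub_apply, smul_eq_mul]
    ring
  simp only [e]
  have c := IsC01.const
  exact ((h.comp hμ).isC01.mul (((c _).mul (h.symGrad_isC01 i j)).sub
    (((c _).mul htr).mul (c _)))).add ((((c _).mul (h.comp hη).isC01).mul htr).mul (c _))

theorem curl_isC01 (h : RegularState r U Θ H) (i : Fin 3) : IsC01 fun t x => curl (H t) x i := by
  have hp := h.jacH_isC01
  fin_cases i
  · exact (hp 2 1).sub (hp 1 2)
  · exact (hp 0 2).sub (hp 2 0)
  · exact (hp 1 0).sub (hp 0 1)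

theorem electric_isC01 (h : RegularState r U Θ H) (hζ : C1Quad fl.ζ) (i : Fin 3) :
    IsC01 fun t x => (fl.ζ (r t x) (Θ t x) • curl (H t) x) i :=
  (h.comp hζ).isC01.mul (h.curl_isC01 i)

theorem entropyFlux_isC01 (h : RegularState r U Θ H) (hκ : C1Quad fl.κ) (i : Fin 3) :
    IsC01 fun t x => ((fl.κ (r t x) (Θ t x) / Θ t x) • grad (Θ t) x) i :=
  (h.comp hκ.div_temperature).isC01.mul (h.Θ_reg.isC01_pd i)

theorem continuous_curlE (h : RegularState r U Θ H) (hζ : C1Quad fl.ζ) (i : Fin 3) :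
    Continuous fun q : ℝ × V3 => (strongPoint fl r U Θ H q.1 q.2).curlE i := by
  have hp := fun i => (h.electric_isC01 hζ i).continuous_pd
  fin_cases i
  · exact (hp 2 1).sub (hp 1 2)
  · exact (hp 0 2).sub (hp 2 0)
  · exact (hp 1 0).sub (hp 0 1)

theorem continuous_divψ (h : RegularState r U Θ H) (hκ : C1Quad fl.κ) :
    Continuous fun q : ℝ × V3 => (strongPoint fl r U Θ H q.1 q.2).divψ :=
  continuous_finsetSum Finset.univ fun j _ => (h.entropyFlux_isC01 hκ j).continuous_pd j

theorem continuous_divS (h : RegularState r U Θ H) (hμ : C1Quad fl.μ) (hη : C1Quad fl.η)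
    (i : Fin 3) : Continuous fun q : ℝ × V3 => (strongPoint fl r U Θ H q.1 q.2).divS i :=
  continuous_finsetSum Finset.univ fun j _ => (h.stress_isC01 hμ hη i j).continuous_pd j

/-- All listed quantities are continuous. Among them `divS` is the only one of second order: `curlE`
and `divψ` have cancelled from the integrand by the time bounds are needed. -/
theorem exists_bddBy (h : RegularState r U Θ H) (hμ : C1Quad fl.μ) (hη : C1Quad fl.η)
    {K : Set (ℝ × V3)} (hK : IsCompact K) :
    ∃ N, 0 ≤ N ∧ ∀ q ∈ K, (strongPoint fl r U Θ H q.1 q.2).BddBy N := by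
  have bd : ∀ {g : ℝ × V3 → ℝ}, Continuous g → ∃ C, ∀ q ∈ K, |g q| ≤ C := fun hg =>
    hK.exists_bound_of_continuousOn hg.continuousOn
  have b1 := bd h.Θ_reg.1.continuous_dt
  have b2 := fun i => bd (h.Θ_reg.1.continuous_pd i)
  have b3 := fun i => bd (h.U_isC1 i).continuous
  have b4 := fun (p : Fin 3 × Fin 3) => bd (h.jacU_isC01 p.1 p.2).continuous
  have b5 := fun i => bd (h.H_isC1 i).continuous
  have b6 := fun (p : Fin 3 × Fin 3) => bd (h.jacH_isC01 p.1 p.2).continuous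
  have b7 := fun i => bd (h.continuous_divS (fl := fl) hμ hη i)
  obtain ⟨C1, h1⟩ := b1
  choose C2 h2 using b2
  choose C3 h3 using b3
  choose C4 h4 using b4
  choose C5 h5 using b5
  choose C6 h6 using b6
  choose C7 h7 using b7
  have le : ∀ {ι : Type} [Fintype ι] (C : ι → ℝ) (i : ι), C i ≤ ∑ i, |C i| := fun C i =>
    (le_abs_self _).trans (Finset.single_le_sum (f := fun i => |C i|) (fun _ _ => abs_nonneg _)
      (Finset.mem_univ i))
  have n2 : 0 ≤ ∑ i, |C2 i| := by positivity
  have n3 : 0 ≤ ∑ i, |C3 i| := by positivity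
  have n4 : 0 ≤ ∑ i, |C4 i| := by positivity
  have n5 : 0 ≤ ∑ i, |C5 i| := by positivity
  have n6 : 0 ≤ ∑ i, |C6 i| := by positivity
  have n7 : 0 ≤ ∑ i, |C7 i| := by positivity
  refine ⟨|C1| + (∑ i, |C2 i|) + (∑ i, |C3 i|) + (∑ i, |C4 i|) + (∑ i, |C5 i|) + (∑ i, |C6 i|)
    + ∑ i, |C7 i|, by positivity, fun q hq => ?_⟩
  have n1 := abs_nonneg C1
  exact
    { Θt := (h1 q hq).trans (by linarith [le_abs_self C1])
      gΘ := fun i => (h2 i q hq).trans (by linarith [le C2 i])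
      U := fun i => (h3 i q hq).trans (by linarith [le C3 i])
      JU := fun i j => (h4 (i, j) q hq).trans (by linarith [le C4 (i, j)])
      H := fun i => (h5 i q hq).trans (by linarith [le C5 i])
      JH := fun i j => (h6 (i, j) q hq).trans (by linarith [le C6 (i, j)])
      divS := fun i => (h7 i q hq).trans (by linarith [le C7 i]) }

/-- The equations of a strong solution in non-conservative form. -/
theorem eqs (h : RegularState r U Θ H) {G : Geometry} {bd : BoundaryData G}
    {ρ₀ : V3 → ℝ} {u₀ : V3 → V3} {θ₀ : V3 → ℝ} {B₀ : V3 → V3}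
    (hS : IsStrongSolution G bd fl ρ₀ u₀ θ₀ B₀ r U Θ H)
    (hκ : C1Quad fl.κ) (hp : C1Quad fl.p) (hs : C1Quad fl.s) {t : ℝ} (ht : t ∈ Ioo 0 G.T) {x : V3} (hx : x ∈ G.Ω) :
    (strongPoint fl r U Θ H t x).Eqs fl := by
  set P := strongPoint fl r U Θ H t x with hP
  have dr := h.r_reg.differentiableAt t
  have dU := fun i => (h.U_isC1 i).differentiableAt t
  have dH := fun i => (h.H_isC1 i).differentiableAt t
  have hrU : ∀ i, IsC1 fun t x => r t x * U t x i := fun i => h.r_reg.mul (h.U_isC1 i)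
  have hrs : IsC1 fun t x => r t x * fl.s (r t x) (Θ t x) := h.r_reg.mul (h.comp hs)
  have drU := fun i => (hrU i).differentiableAt t
  have gr : ∀ j, pd j (r t) x = P.gr j := fun j => rfl
  have gU : ∀ i j, pd j (fun y => U t y i) x = P.JU i j := fun i j => rfl
  have gH : ∀ i j, pd j (fun y => H t y i) x = P.JH i j := fun i j => rfl
  have gdr : dt r t x = P.rt := rfl
  have gdU : ∀ i, dt (fun t x => U t x i) t x = P.Ut i := fun i => rfl
  have vr : r t x = P.r := rfl
  have vU : ∀ i, U t x i = P.U i := fun i => rfl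
  have vH : ∀ i, H t x i = P.H i := fun i => rfl
  have cont : P.rt + (∑ j, P.U j * P.gr j) + P.r * P.JU.trace = 0 := by
    have h1 := hS.continuity t ht x hx
    simp only [dvg, Pi.smul_apply, smul_eq_mul, pd_mul (dr x) (dU _ x), gr, gU, gdr, vr, vU] at h1
    simp only [Fin.sum_univ_three, Matrix.trace, Matrix.diag] at h1 ⊢
    linarith
  have solen : P.JH.trace = 0 :=
    hS.solenoidal t (Ioo_subset_Icc_self ht) x hx
  refine ⟨cont, fun i => ?_, fun i => ?_, solen, ?_⟩
  · have h1 := congrFun (hS.momentum t ht x hx) i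
    have e1 : dtV (fun t x => r t x • U t x) t x i = P.rt * P.U i + P.r * P.Ut i :=
      h.r_reg.dt_mul (h.U_isC1 i) t x
    have e2 : dvgM (fun y => r t y • tensor (U t y) (U t y)) x i
        = ∑ j, (P.r * P.U i * P.JU j j + P.U j * (P.r * P.JU i j + P.U i * P.gr j)) := by
      have : ∀ j, (fun y => (r t y • tensor (U t y) (U t y)) i j)
          = fun y => r t y * U t y i * U t y j := fun j => by
        funext y; simp [tensor, mul_assoc]
      simp only [dvgM, this, pd_mul (drU i x) (dU _ x), pd_mul (dr x) (dU _ x), gr, gU, vr, vU]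
    have e3 : grad (fun y => fl.p (r t y) (Θ t y)) x i = P.cg fl.p i := h.pd_comp hp i t x
    simp only [Pi.add_apply, e1, e2, e3] at h1
    change _ = P.divS i + (P.Y ⨯₃ P.H) i at h1
    rw [← h1]
    simp only [Fin.sum_univ_three, Matrix.trace, Matrix.diag] at cont ⊢
    -- Subtracting U times the continuity equation passes from the conservative to the convective
    -- form.
    linear_combination (-P.U i) * cont
  · have h1 := congrFun (hS.induction t ht x hx) i
    have e0 : ∀ i j k l, pd k (fun y => H t y i * U t y j - H t y j * U t y i) l
        = H t l i * pd k (fun y => U t y j) l + U t l j * pd k (fun y => H t y i) l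
          - (H t l j * pd k (fun y => U t y i) l + U t l i * pd k (fun y => H t y j) l) := by
      intro i j k l
      rw [pd_sub ((dH i l).fun_mul (dU j l)) ((dH j l).fun_mul (dU i l)), pd_mul (dH i l) (dU j l),
        pd_mul (dH j l) (dU i l)]
    have e1 : curl (fun y => H t y ⨯₃ U t y) x i = P.H i * P.JU.trace
        + (∑ j, P.JH i j * P.U j) - ∑ j, P.JU i j * P.H j := by
      have c0 : (fun y => (H t y ⨯₃ U t y) 0)
          = fun y => H t y 1 * U t y 2 - H t y 2 * U t y 1 := by
        funext y; simp [cross_apply]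
      have c1 : (fun y => (H t y ⨯₃ U t y) 1)
          = fun y => H t y 2 * U t y 0 - H t y 0 * U t y 2 := by
        funext y; simp [cross_apply]
      have c2 : (fun y => (H t y ⨯₃ U t y) 2)
          = fun y => H t y 0 * U t y 1 - H t y 1 * U t y 0 := by
        funext y; simp [cross_apply]
      simp only [curl, c0, c1, c2, e0, gU, gH, vU, vH]
      simp only [Fin.sum_univ_three, Matrix.trace, Matrix.diag] at solen ⊢
      fin_cases i
      -- In curl(H×U) the term U div H drops out by solenoidality.
      · simp; linear_combination (-P.U 0) * solen
      · simp; linear_combination (-P.U 1) * solen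
      · simp; linear_combination (-P.U 2) * solen
    simp only [Pi.add_apply, e1] at h1
    exact h1
  · have h1 := hS.entropy t ht x hx
    have e1 : dt (fun t x => r t x * fl.s (r t x) (Θ t x)) t x
        = P.rt * fl.s P.r P.Θ + P.r * P.ct fl.s := by
      rw [h.r_reg.dt_mul (h.comp hs), h.dt_comp hs]; rfl
    have e2 : dvg (fun y => (r t y * fl.s (r t y) (Θ t y)) • U t y) x
        = ∑ j, (P.r * fl.s P.r P.Θ * P.JU j j
          + P.U j * (P.r * P.cg fl.s j + fl.s P.r P.Θ * P.gr j)) := by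
      simp only [dvg, Pi.smul_apply, smul_eq_mul, pd_mul (hrs.differentiableAt t x) (dU _ x),
        pd_mul (dr x) ((h.comp hs).differentiableAt t x), h.pd_comp (fl := fl) hs]
      rfl
    have e3 : dvg (fun y => (1 / Θ t y) • fl.heatFlux (r t y) (Θ t y) (grad (Θ t) y)) x
        = -P.divψ := by
      have : ∀ j, (fun y => ((1 / Θ t y) • fl.heatFlux (r t y) (Θ t y) (grad (Θ t) y)) j)
          = fun y => (-1) * ((fl.κ (r t y) (Θ t y) / Θ t y) • grad (Θ t) y) j := fun j => by
        funext y
        simp only [Fluid.heatFlux, Pi.smul_apply, Pi.neg_apply, smul_eq_mul]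
        ring
      simp only [dvg, this, pd_const_mul _ ((h.entropyFlux_isC01 hκ _).differentiableAt t x)]
      rw [← Finset.mul_sum, neg_one_mul]
      rfl
    rw [e1, e2, e3] at h1
    change _ = fl.production P.r P.Θ P.D P.JU P.gΘ P.Y at h1
    rw [← h1]
    simp only [Fin.sum_univ_three, Matrix.trace, Matrix.diag] at cont ⊢
    -- As for the momentum, with s in place of the velocity.
    linear_combination (-fl.s P.r P.Θ) * cont

/-! ### Derivatives of the test functions built from the strong solution -/

theorem _root_.MHD.IsC1.half_normSq {V : ℝ → V3 → V3} (hV : IsC1 V) :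
    IsC1 fun t x => 1 / 2 * normSq (V t x) := by
  have e : ∀ t x, 1 / 2 * normSq (V t x) = 1 / 2 * ∑ i, V t x i * V t x i := fun t x => rfl
  simp only [e]
  exact (IsC1.const _).mul (IsC1.sum fun i => (hV.apply i).mul (hV.apply i))

theorem _root_.MHD.IsC1.dt_half_normSq {V : ℝ → V3 → V3} (hV : IsC1 V) (t : ℝ) (x : V3) :
    dt (fun t x => 1 / 2 * normSq (V t x)) t x = V t x ⬝ᵥ dtV V t x := by
  have d := fun i => ((hV.apply i).differentiableAt_time t x).hasDerivAt
  have h := (((((d 0).fun_mul (d 0)).fun_add ((d 1).fun_mul (d 1))).fun_add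
    ((d 2).fun_mul (d 2))).const_mul (1 / 2 : ℝ)).deriv
  have e : ∀ s, 1 / 2 * normSq (V s x)
      = 1 / 2 * (V s x 0 * V s x 0 + V s x 1 * V s x 1 + V s x 2 * V s x 2) := fun s => by
    rw [normSq, dotProduct, Fin.sum_univ_three]
  simp only [dt, e, h, dotProduct, dtV, Fin.sum_univ_three]
  ring

theorem _root_.MHD.IsC1.pd_half_normSq {V : ℝ → V3 → V3} (hV : IsC1 V) (j : Fin 3) (t : ℝ)
    (x : V3) : pd j (fun y => 1 / 2 * normSq (V t y)) x = ∑ i, V t x i * jac (V t) x i j := by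
  have d := fun i => ((hV.apply i).differentiableAt t x).hasFDerivAt
  have h := (((((d 0).fun_mul (d 0)).fun_add ((d 1).fun_mul (d 1))).fun_add
    ((d 2).fun_mul (d 2))).const_mul (1 / 2 : ℝ))
  have e : (fun y => 1 / 2 * normSq (V t y))
      = fun y => 1 / 2 * (V t y 0 * V t y 0 + V t y 1 * V t y 1 + V t y 2 * V t y 2) := by
    funext y; rw [normSq, dotProduct, Fin.sum_univ_three]
  rw [e, pd_eq_of_hasFDerivAt h]
  simp only [_root_.add_apply, _root_.smul_apply, smul_eq_mul, Fin.sum_univ_three]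
  change _ = V t x 0 * fderiv ℝ (fun y => V t y 0) x (Pi.single j 1)
    + V t x 1 * fderiv ℝ (fun y => V t y 1) x (Pi.single j 1)
    + V t x 2 * fderiv ℝ (fun y => V t y 2) x (Pi.single j 1)
  ring

/-- The test function `|U|²/2 - (e - Θs + p/r)` for the equation of continuity. -/
noncomputable def _root_.MHD.potential (fl : Fluid) (r : ℝ → V3 → ℝ) (U : ℝ → V3 → V3)
    (Θ : ℝ → V3 → ℝ) (t : ℝ) (x : V3) : ℝ :=
  1 / 2 * normSq (U t x) - (fl.e (r t x) (Θ t x) - Θ t x * fl.s (r t x) (Θ t x)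
    + fl.p (r t x) (Θ t x) / r t x)

theorem gibbs_isC1 (h : RegularState r U Θ H) (hp : C1Quad fl.p) (he : C1Quad fl.e)
    (hs : C1Quad fl.s) : IsC1 fun t x => fl.e (r t x) (Θ t x) - Θ t x * fl.s (r t x) (Θ t x)
      + fl.p (r t x) (Θ t x) / r t x :=
  ((h.comp he).sub (h.Θ_reg.1.mul (h.comp hs))).add
    ((h.comp hp).div h.r_reg fun t x => (h.r_pos t x).ne')

theorem potential_isC1 (h : RegularState r U Θ H) (hp : C1Quad fl.p) (he : C1Quad fl.e)
    (hs : C1Quad fl.s) : IsC1 (potential fl r U Θ) :=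
  h.U_reg.1.half_normSq.sub (h.gibbs_isC1 hp he hs)

/-- The derivative of the Gibbs potential in an arbitrary space-time direction. -/
theorem fderiv_gibbs (h : RegularState r U Θ H) (hG : fl.Gibbs) (hp : C1Quad fl.p)
    (he : C1Quad fl.e) (hs : C1Quad fl.s) (q v : ℝ × V3) :
    fderiv ℝ (fun q : ℝ × V3 => fl.e (r q.1 q.2) (Θ q.1 q.2)
      - Θ q.1 q.2 * fl.s (r q.1 q.2) (Θ q.1 q.2) + fl.p (r q.1 q.2) (Θ q.1 q.2) / r q.1 q.2) q v
    = fderiv ℝ (fun q : ℝ × V3 => fl.p (r q.1 q.2) (Θ q.1 q.2)) q v / r q.1 q.2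
      - fl.s (r q.1 q.2) (Θ q.1 q.2) * fderiv ℝ (fun q : ℝ × V3 => Θ q.1 q.2) q v := by
  have hr := h.r_pos q.1 q.2
  have hΘ := h.Θ_pos q.1 q.2
  have d1' := (h.comp he).hasFDerivAt q
  have d2' := (h.comp hs).hasFDerivAt q
  have d3' := (h.comp hp).hasFDerivAt q
  have d4 := h.r_reg.hasFDerivAt q
  have d5 := h.Θ_reg.1.hasFDerivAt q
  have hi := HasDerivAt.comp_hasFDerivAt (h₂ := fun x : ℝ => x⁻¹)
    (f := fun q : ℝ × V3 => r q.1 q.2) q (hasDerivAt_inv hr.ne') d4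
  have := (d1'.fun_sub (d5.fun_mul d2')).fun_add (d3'.fun_mul hi)
  simp only [div_eq_mul_inv]
  rw [HasFDerivAt.fderiv (f := fun q : ℝ × V3 => fl.e (r q.1 q.2) (Θ q.1 q.2)
      - Θ q.1 q.2 * fl.s (r q.1 q.2) (Θ q.1 q.2)
      + fl.p (r q.1 q.2) (Θ q.1 q.2) * (r q.1 q.2)⁻¹) this]
  simp only [_root_.add_apply, _root_.sub_apply, _root_.smul_apply, smul_eq_mul,
    h.hasFDerivAt_comp he, h.hasFDerivAt_comp hs, h.hasFDerivAt_comp hp, Function.comp_apply]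
  -- Gibbs' equation eliminates the derivatives of e; those of s then cancel, as does the term p/r²
  -- from differentiating p/r. This leaves dp/r − s dΘ.
  rw [← hG.d2_eq hr hΘ]
  have g1 := hG.d1_eq hr hΘ
  have g1' : d1 fl.e (r q.1 q.2) (Θ q.1 q.2) = Θ q.1 q.2 * d1 fl.s (r q.1 q.2) (Θ q.1 q.2)
      + fl.p (r q.1 q.2) (Θ q.1 q.2) / r q.1 q.2 ^ 2 := by linarith
  rw [g1']
  field_simp
  ring

theorem dt_potential (h : RegularState r U Θ H) (hG : fl.Gibbs) (hp : C1Quad fl.p)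
    (he : C1Quad fl.e) (hs : C1Quad fl.s) (t : ℝ) (x : V3) :
    dt (potential fl r U Θ) t x = (strongPoint fl r U Θ H t x).φt fl := by
  have h1 := h.U_reg.1.half_normSq.dt_sub (h.gibbs_isC1 hp he hs) t x
  have h2 := (h.gibbs_isC1 hp he hs).dt_eq t x
  rw [h.fderiv_gibbs hG hp he hs, ← (h.comp hp).dt_eq, ← h.Θ_reg.1.dt_eq,
    h.dt_comp (fl := fl) hp] at h2
  rw [h2, h.U_reg.1.dt_half_normSq] at h1
  exact h1

theorem grad_potential (h : RegularState r U Θ H) (hG : fl.Gibbs) (hp : C1Quad fl.p)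
    (he : C1Quad fl.e) (hs : C1Quad fl.s) (t : ℝ) (x : V3) :
    grad (potential fl r U Θ t) x = (strongPoint fl r U Θ H t x).gφ fl := by
  funext j
  have h1 := pd_sub (h.U_reg.1.half_normSq.differentiableAt t x)
    ((h.gibbs_isC1 hp he hs).differentiableAt t x) j
  have h2 := (h.gibbs_isC1 hp he hs).pd_eq j t x
  rw [h.fderiv_gibbs hG hp he hs, ← (h.comp hp).pd_eq, ← h.Θ_reg.1.pd_eq,
    h.pd_comp (fl := fl) hp] at h2
  rw [h2, h.U_reg.1.pd_half_normSq] at h1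
  exact h1

theorem dt_pressure (h : RegularState r U Θ H) (hp : C1Quad fl.p) (t : ℝ) (x : V3) :
    dt (fun t x => fl.p (r t x) (Θ t x) + 1 / 2 * normSq (H t x)) t x
      = (strongPoint fl r U Θ H t x).ct fl.p + H t x ⬝ᵥ dtV H t x := by
  rw [(h.comp hp).dt_add h.H_reg.1.half_normSq, h.H_reg.1.dt_half_normSq, h.dt_comp (fl := fl) hp]

theorem crossHelicity_isC1 (h : RegularState r U Θ H) : IsC1 fun t x => H t x ⬝ᵥ U t x :=
  IsC1.sum fun i => (h.H_isC1 i).mul (h.U_isC1 i)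

theorem grad_crossHelicity (h : RegularState r U Θ H) (t : ℝ) (x : V3) :
    grad (fun y => H t y ⬝ᵥ U t y) x = (strongPoint fl r U Θ H t x).gHU := by
  funext j
  have d := fun i => ((h.H_isC1 i).differentiableAt t x).hasFDerivAt.fun_mul
    ((h.U_isC1 i).differentiableAt t x).hasFDerivAt
  have e : (fun y => H t y ⬝ᵥ U t y)
      = fun y => H t y 0 * U t y 0 + H t y 1 * U t y 1 + H t y 2 * U t y 2 := by
    funext y; rw [dotProduct, Fin.sum_univ_three]
  rw [grad, e, pd_eq_of_hasFDerivAt (((d 0).fun_add (d 1)).fun_add (d 2))]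
  simp only [StrongPoint.gHU, Fin.sum_univ_three]
  rfl

/-- The flux `(p + |H|²/2) U - 𝕊 U` of mechanical energy. -/
noncomputable def _root_.MHD.energyFlux (fl : Fluid) (r : ℝ → V3 → ℝ) (U : ℝ → V3 → V3)
    (Θ : ℝ → V3 → ℝ) (H : ℝ → V3 → V3) (j : Fin 3) (t : ℝ) (x : V3) : ℝ :=
  (fl.p (r t x) (Θ t x) + 1 / 2 * normSq (H t x)) * U t x j
    - ∑ i, U t x i * fl.stress (r t x) (Θ t x) (symGrad (U t) x) i j

theorem energyFlux_isC01 (h : RegularState r U Θ H) (hμ : C1Quad fl.μ) (hη : C1Quad fl.η)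
    (hp : C1Quad fl.p) (j : Fin 3) : IsC01 (energyFlux fl r U Θ H j) :=
  (((h.comp hp).add h.H_reg.1.half_normSq).mul (h.U_isC1 j)).isC01.sub
    (IsC01.sum fun i => (h.U_isC1 i).isC01.mul (h.stress_isC01 hμ hη i j))

theorem div_energyFlux (h : RegularState r U Θ H) (hμ : C1Quad fl.μ) (hη : C1Quad fl.η)
    (hp : C1Quad fl.p) (t : ℝ) (x : V3) :
    ∑ j, pd j (energyFlux fl r U Θ H j t) x = (strongPoint fl r U Θ H t x).divF fl := by
  have hpH := (h.comp hp).add h.H_reg.1.half_normSq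
  have dU := fun i => (h.U_isC1 i).differentiableAt t x
  have dS := fun i j => (h.stress_isC01 (fl := fl) hμ hη i j).differentiableAt t x
  have e : ∀ j, pd j (energyFlux fl r U Θ H j t) x
      = (fl.p (r t x) (Θ t x) + 1 / 2 * normSq (H t x)) * jac (U t) x j j
        + U t x j * ((strongPoint fl r U Θ H t x).cg fl.p j + ∑ i, H t x i * jac (H t) x i j)
        - ∑ i, (U t x i * pd j (fun y => fl.stress (r t y) (Θ t y) (symGrad (U t) y) i j) x
          + fl.stress (r t x) (Θ t x) (symGrad (U t) x) i j * jac (U t) x i j) := by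
    intro j
    have hsum : pd j (fun y => ∑ i, U t y i * fl.stress (r t y) (Θ t y) (symGrad (U t) y) i j) x
        = ∑ i, (U t x i * pd j (fun y => fl.stress (r t y) (Θ t y) (symGrad (U t) y) i j) x
          + fl.stress (r t x) (Θ t x) (symGrad (U t) x) i j * jac (U t) x i j) := by
      have d := fun i => (dU i).fun_mul (dS i j)
      simp only [Fin.sum_univ_three]
      rw [pd_add ((d 0).fun_add (d 1)) (d 2), pd_add (d 0) (d 1), pd_mul (dU 0) (dS 0 j),
        pd_mul (dU 1) (dS 1 j), pd_mul (dU 2) (dS 2 j)]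
      rfl
    have dsum : DifferentiableAt ℝ
        (fun y => ∑ i, U t y i * fl.stress (r t y) (Θ t y) (symGrad (U t) y) i j) x :=
      DifferentiableAt.fun_sum fun i _ => (dU i).fun_mul (dS i j)
    have h1 := pd_sub ((hpH.differentiableAt t x).fun_mul (dU j)) dsum j
    rw [hsum, pd_mul (hpH.differentiableAt t x) (dU j),
      pd_add ((h.comp hp).differentiableAt t x) (h.H_reg.1.half_normSq.differentiableAt t x),
      h.pd_comp (fl := fl) hp, h.H_reg.1.pd_half_normSq] at h1
    exact h1
  simp only [e]
  change _ = (fl.p (r t x) (Θ t x) + 1 / 2 * normSq (H t x)) * (∑ j, jac (U t) x j j)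
    + (∑ j, U t x j * ((strongPoint fl r U Θ H t x).cg fl.p j + ∑ i, H t x i * jac (H t) x i j))
    - ((∑ i, U t x i * ∑ j, pd j (fun y => fl.stress (r t y) (Θ t y) (symGrad (U t) y) i j) x)
      + ∑ i, ∑ j, jac (U t) x i j * fl.stress (r t x) (Θ t x) (symGrad (U t) x) i j)
  simp only [Fin.sum_univ_three]
  ring

end RegularState

/-! ### Averages with respect to a Young measure -/

/-- `f` is integrable and `f q = ⟨V_q; F q⟩` for almost every `q`. -/
structure IsAverage {X Z : Type*} [MeasurableSpace X] [MeasurableSpace Z] (V : Kernel X Z)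
    (μ : Measure X) (f : X → ℝ) (F : X → Z → ℝ) : Prop where
  integrable : Integrable f μ
  ae_eq : ∀ᵐ q ∂μ, Integrable (F q) (V q) ∧ f q = ∫ z, F q z ∂V q

namespace IsAverage

variable {X Z : Type*} [MeasurableSpace X] [MeasurableSpace Z] {V : Kernel X Z} {μ : Measure X}
  {f f' : X → ℝ} {F F' : X → Z → ℝ}

theorem of_compProd [SFinite μ] [IsSFiniteKernel V] {g : Z → ℝ}
    (hg : Integrable (fun w : X × Z => g w.2) (μ ⊗ₘ V)) :
    IsAverage V μ (fun q => av (V q) g) fun _ => g where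
  integrable := Integrable.integral_compProd (κ := Kernel.const Unit μ)
    (η := Kernel.prodMkLeft Unit V) (a := ()) hg
  ae_eq := by
    filter_upwards [((Measure.integrable_compProd_iff hg.aestronglyMeasurable).1 hg).1] with q hq
    exact ⟨hq, rfl⟩

theorem coeff [IsMarkovKernel V] {a : X → ℝ} (ha : Integrable a μ) :
    IsAverage V μ a fun q _ => a q :=
  ⟨ha, ae_of_all _ fun _ => ⟨integrable_const _, by simp⟩⟩

theorem add (h : IsAverage V μ f F) (h' : IsAverage V μ f' F') :
    IsAverage V μ (fun q => f q + f' q) fun q z => F q z + F' q z where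
  integrable := h.integrable.add h'.integrable
  ae_eq := by
    filter_upwards [h.ae_eq, h'.ae_eq] with q hq hq'
    exact ⟨hq.1.add hq'.1, by rw [integral_add hq.1 hq'.1, hq.2, hq'.2]⟩

theorem neg (h : IsAverage V μ f F) : IsAverage V μ (fun q => -f q) fun q z => -F q z where
  integrable := h.integrable.neg
  ae_eq := by
    filter_upwards [h.ae_eq] with q hq
    exact ⟨hq.1.neg, by rw [integral_neg, hq.2]⟩

theorem sub (h : IsAverage V μ f F) (h' : IsAverage V μ f' F') :
    IsAverage V μ (fun q => f q - f' q) fun q z => F q z - F' q z := by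
  simpa only [sub_eq_add_neg] using h.add h'.neg

theorem sum {ι : Type*} {s : Finset ι} {f : ι → X → ℝ} {F : ι → X → Z → ℝ}
    (h : ∀ i, IsAverage V μ (f i) (F i)) :
    IsAverage V μ (fun q => ∑ i ∈ s, f i q) fun q z => ∑ i ∈ s, F i q z where
  integrable := integrable_finsetSum _ fun i _ => (h i).integrable
  ae_eq := by
    have : ∀ᵐ q ∂μ, ∀ i ∈ s, Integrable (F i q) (V q) ∧ f i q = ∫ z, F i q z ∂V q :=
      (ae_ball_iff s.countable_toSet).2 fun i _ => (h i).ae_eq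
    filter_upwards [this] with q hq
    exact ⟨integrable_finsetSum _ fun i hi => (hq i hi).1, by
      rw [integral_finsetSum _ fun i hi => (hq i hi).1]
      exact Finset.sum_congr rfl fun i hi => (hq i hi).2⟩

theorem congr (h : IsAverage V μ f F) (hf : ∀ q, f' q = f q) (hF : ∀ q z, F' q z = F q z) :
    IsAverage V μ f' F' := by
  rwa [show f' = f from funext hf, show F' = F from funext fun q => funext (hF q)]

/-- The average itself, for a representative of the integrable function. -/
theorem average (h : IsAverage V μ f F) : IsAverage V μ (fun q => ∫ z, F q z ∂V q) F where
  integrable := h.integrable.congr (h.ae_eq.mono fun _ hq => hq.2)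
  ae_eq := h.ae_eq.mono fun _ hq => ⟨hq.1, rfl⟩

theorem mul_coeff (h : IsAverage V μ f F) {a : X → ℝ}
    (ha : Integrable (fun q => f q * a q) μ) :
    IsAverage V μ (fun q => f q * a q) fun q z => F q z * a q where
  integrable := ha
  ae_eq := by
    filter_upwards [h.ae_eq] with q hq
    exact ⟨hq.1.mul_const _, by rw [integral_mul_const, hq.2]⟩

end IsAverage

/-! ### Averages on a space-time cylinder -/

theorem Geometry.ae_mem_cyl (G : Geometry) (τ : ℝ) :
    ∀ᵐ q ∂volume.restrict (G.cyl τ), q ∈ G.cyl τ :=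
  ae_restrict_mem (measurableSet_Ioo.prod G.isOpen.measurableSet)

theorem Geometry.cyl_mono (G : Geometry) {τ : ℝ} (h : τ ≤ G.T) : G.cyl τ ⊆ G.cyl G.T :=
  prod_mono (Ioo_subset_Ioo_right h) Subset.rfl

theorem Geometry.volume_cyl_ne_top (G : Geometry) (τ : ℝ) : volume (G.cyl τ) ≠ ⊤ := by
  have : Bornology.IsBounded (G.cyl τ) := (Metric.isBounded_Ioo 0 τ).prod G.isBounded
  exact this.measure_lt_top.ne

theorem Geometry.integrable_of_continuous (G : Geometry) {b : ℝ × V3 → ℝ} (hb : Continuous b) :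
    Integrable b (volume.restrict (G.cyl G.T)) := by
  have h1 : Integrable (fun _ : ℝ × V3 => (1 : ℝ)) (volume.restrict (G.cyl G.T)) :=
    integrableOn_const (G.volume_cyl_ne_top G.T)
  simpa using integrable_mul_continuous G.isBounded (G.ae_mem_cyl G.T) h1 hb

section Cylinder

variable {G : Geometry} {V : Kernel (ℝ × V3) Phase}

theorem IsAverage.mul_continuous {f : ℝ × V3 → ℝ} {F : ℝ × V3 → Phase → ℝ}
    (h : IsAverage V (volume.restrict (G.cyl G.T)) f F) {a : ℝ × V3 → ℝ} (ha : Continuous a) :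
    IsAverage V (volume.restrict (G.cyl G.T)) (fun q => f q * a q) fun q z => F q z * a q :=
  h.mul_coeff (integrable_mul_continuous G.isBounded (G.ae_mem_cyl G.T) h.integrable ha)

theorem IsAverage.of_continuous [IsMarkovKernel V] {a : ℝ × V3 → ℝ} (ha : Continuous a) :
    IsAverage V (volume.restrict (G.cyl G.T)) a fun q _ => a q :=
  IsAverage.coeff (G.integrable_of_continuous ha)

theorem ObsIntegrable.isAverage [IsMarkovKernel V] {g : Phase → ℝ} (hg : ObsIntegrable G V g) :
    IsAverage V (volume.restrict (G.cyl G.T)) (fun q => av (V q) g) fun _ => g :=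
  IsAverage.of_compProd hg

theorem isAverage_dot {g : ℝ × V3 → Phase → V3}
    (hg : ∀ i, IsAverage V (volume.restrict (G.cyl G.T)) (fun q => avV (V q) (g q) i)
      fun q z => g q z i)
    {v : ℝ × V3 → V3} (hv : ∀ i, Continuous fun q => v q i) :
    IsAverage V (volume.restrict (G.cyl G.T)) (fun q => avV (V q) (g q) ⬝ᵥ v q)
      fun q z => g q z ⬝ᵥ v q :=
  IsAverage.sum fun i => (hg i).mul_continuous (hv i)

theorem isAverage_frob {g : ℝ × V3 → Phase → M3}
    (hg : ∀ i j, IsAverage V (volume.restrict (G.cyl G.T)) (fun q => avM (V q) (g q) i j)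
      fun q z => g q z i j)
    {A : ℝ × V3 → M3} (hA : ∀ i j, Continuous fun q => A q i j) :
    IsAverage V (volume.restrict (G.cyl G.T)) (fun q => frob (avM (V q) (g q)) (A q))
      fun q z => frob (g q z) (A q) :=
  IsAverage.sum fun i => IsAverage.sum fun j => (hg i j).mul_continuous (hA i j)

end Cylinder

/-! ### Primitives in time -/

theorem setIntegral_Ioo_eq_intervalIntegral {T τ : ℝ} (hτ : τ ∈ Icc 0 T) (g : ℝ → ℝ) :
    ∫ t in Ioo 0 τ, g t = ∫ t in 0..τ, (Ioo 0 T).indicator g t := by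
  rw [intervalIntegral.integral_of_le hτ.1, integral_Ioc_eq_integral_Ioo]
  refine setIntegral_congr_fun measurableSet_Ioo fun t ht => ?_
  rw [indicator_of_mem (Ioo_subset_Ioo_right hτ.2 ht)]

theorem continuous_primitive_indicator {T : ℝ} {g : ℝ → ℝ}
    (hg : Integrable g (volume.restrict (Ioo 0 T))) :
    Continuous fun τ => ∫ t in 0..τ, (Ioo 0 T).indicator g t :=
  intervalIntegral.continuous_primitive
    (fun _ _ => ((integrable_indicator_iff measurableSet_Ioo).2 hg).intervalIntegrable) 0

/-- The continuous functions max(f,g) and g agree almost everywhere, hence everywhere on the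
nondegenerate closed interval. In particular the endpoint T is reached, where relations valid for
almost every τ say nothing directly. -/
theorem le_on_Icc_of_ae_le {T : ℝ} (hT : 0 < T) {f g : ℝ → ℝ} (hf : Continuous f)
    (hg : Continuous g) (h : ∀ᵐ τ ∂volume.restrict (Ioo 0 T), f τ ≤ g τ) {τ : ℝ}
    (hτ : τ ∈ Icc 0 T) : f τ ≤ g τ := by
  have h' : (fun τ => max (f τ) (g τ)) =ᵐ[volume.restrict (Icc 0 T)] g := by
    rw [← restrict_Ioo_eq_restrict_Icc]
    filter_upwards [h] with t ht using max_eq_right ht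
  have := Measure.eqOn_Icc_of_ae_eq (μ := volume) hT.ne h' (hf.max hg).continuousOn hg.continuousOn hτ
  exact max_eq_right_iff.1 this

/-- Integrals over initial time intervals that are nonnegative for almost all final times are
nonnegative for all of them. -/
theorem setIntegral_nonneg_of_ae {T : ℝ} (hT : 0 < T) {g : ℝ → ℝ}
    (hg : Integrable g (volume.restrict (Ioo 0 T)))
    (h : ∀ᵐ τ ∂volume.restrict (Ioo 0 T), 0 ≤ ∫ t in Ioo 0 τ, g t) {τ : ℝ} (hτ : τ ∈ Icc 0 T) :
    0 ≤ ∫ t in Ioo 0 τ, g t := by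
  rw [setIntegral_Ioo_eq_intervalIntegral hτ]
  refine le_on_Icc_of_ae_le hT continuous_const (continuous_primitive_indicator hg) ?_ hτ
  filter_upwards [h, ae_restrict_mem measurableSet_Ioo] with t ht ht'
  rwa [← setIntegral_Ioo_eq_intervalIntegral (Ioo_subset_Icc_self ht')]

/-- Grönwall's inequality for nonnegative integrable functions. -/
theorem ae_eq_zero_of_le_integral {T C : ℝ} {y : ℝ → ℝ}
    (hy : Integrable y (volume.restrict (Ioo 0 T)))
    (h0 : ∀ᵐ τ ∂volume.restrict (Ioo 0 T), 0 ≤ y τ)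
    (h : ∀ᵐ τ ∂volume.restrict (Ioo 0 T), y τ ≤ C * ∫ t in Ioo 0 τ, y t) :
    ∀ᵐ τ ∂volume.restrict (Ioo 0 T), y τ = 0 := by
  set Y : ℝ → ℝ := fun τ => ∫ t in 0..τ, (Ioo 0 T).indicator y t with hY
  have hYc : Continuous Y := continuous_primitive_indicator hy
  -- Since `y` is merely integrable, its primitive `Y` need not be differentiable everywhere.
  -- Integrating the inequality once more gives Y ≤ CZ with Z of class `C¹` and Z' = Y, to which the
  -- differential form of Grönwall's inequality applies.
  set Z : ℝ → ℝ := fun τ => ∫ t in 0..τ, Y t with hZ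
  have hZd : ∀ τ, HasDerivAt Z (Y τ) τ := fun τ => hYc.integral_hasStrictDerivAt 0 τ |>.hasDerivAt
  have hZc : Continuous Z := continuous_iff_continuousAt.2 fun τ => (hZd τ).continuousAt
  have hyi : Integrable ((Ioo 0 T).indicator y) volume :=
    (integrable_indicator_iff measurableSet_Ioo).2 hy
  have hle : ∀ᵐ τ ∂volume.restrict (Ioo 0 T), (Ioo 0 T).indicator y τ ≤ C * Y τ := by
    filter_upwards [h, ae_restrict_mem measurableSet_Ioo] with t ht ht'
    rw [indicator_of_mem ht']
    rwa [setIntegral_Ioo_eq_intervalIntegral (Ioo_subset_Icc_self ht')] at ht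
  have hY0 : ∀ τ ∈ Icc 0 T, 0 ≤ Y τ := fun τ hτ => by
    simp only [hY]
    rw [← setIntegral_Ioo_eq_intervalIntegral hτ]
    exact integral_nonneg_of_ae (ae_mono (Measure.restrict_mono (Ioo_subset_Ioo_right hτ.2) le_rfl) h0)
  have hYZ : ∀ τ ∈ Icc 0 T, Y τ ≤ C * Z τ := by
    intro τ hτ
    simp only [hY, hZ]
    rw [← intervalIntegral.integral_const_mul]
    refine intervalIntegral.integral_mono_ae_restrict hτ.1 hyi.intervalIntegrable
      ((continuous_const.mul hYc).intervalIntegrable _ _) ?_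
    rw [← restrict_Ioo_eq_restrict_Icc]
    exact ae_mono (Measure.restrict_mono (Ioo_subset_Ioo_right hτ.2) le_rfl) hle
  have hZ0 : ∀ τ ∈ Icc 0 T, 0 ≤ Z τ := fun τ hτ =>
    intervalIntegral.integral_nonneg hτ.1 fun t ht => hY0 t ⟨ht.1, ht.2.trans hτ.2⟩
  have hgr := norm_le_gronwallBound_of_norm_deriv_right_le (f := Z) (f' := Y) (δ := 0) (K := C)
    (ε := 0) (a := 0) (b := T) hZc.continuousOn (fun x _ => (hZd x).hasDerivWithinAt)
    (by simp [hZ]) (fun x hx => by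
      have hx' := Ico_subset_Icc_self hx
      rw [Real.norm_of_nonneg (hY0 x hx'), Real.norm_of_nonneg (hZ0 x hx'), add_zero]
      exact hYZ x hx')
  filter_upwards [hle, h0, ae_restrict_mem measurableSet_Ioo] with t ht ht0 htm
  have htm' := Ioo_subset_Icc_self htm
  have hz : Z t = 0 := by
    have := hgr t htm'
    rw [gronwallBound_ε0_δ0] at this
    exact norm_le_zero_iff.1 this
  have hy0 : Y t = 0 := le_antisymm (by simpa [hz] using hYZ t htm') (hY0 t htm')
  rw [hy0, mul_zero, indicator_of_mem htm] at ht
  exact le_antisymm ht ht0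

/-! ### Matrix-valued measures -/

theorem abs_signedInt_le (ν : SignedMeasure (ℝ × V3)) {A : Set (ℝ × V3)}
    {f : ℝ × V3 → ℝ} {N : ℝ} (hf : ∀ q ∈ A, |f q| ≤ N) :
    |signedInt ν A f| ≤ N * ν.totalVariation.real A := by
  have h1 := norm_setIntegral_le_of_norm_le_const (μ := ν.toJordanDecomposition.posPart)
    (measure_lt_top _ A) (f := f) hf
  have h2 := norm_setIntegral_le_of_norm_le_const (μ := ν.toJordanDecomposition.negPart)
    (measure_lt_top _ A) (f := f) hf
  rw [Real.norm_eq_abs] at h1 h2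
  have h3 : ν.totalVariation.real A = ν.toJordanDecomposition.posPart.real A
      + ν.toJordanDecomposition.negPart.real A := by
    rw [SignedMeasure.totalVariation, measureReal_add_apply]
  rw [signedInt, h3, mul_add]
  exact (abs_sub _ _).trans (add_le_add h1 h2)

/-- The variation sums over entries, so an entrywise bound suffices with no dimensional factor. The
mass is written as the integral of 1, in the shape of the domination of the defects with constant
weight. -/
theorem MatrixMeasure.abs_int_le (R : MatrixMeasure) {A : Set (ℝ × V3)}
    {F : ℝ × V3 → M3} {N : ℝ} (hF : ∀ q ∈ A, ∀ i j, |F q i j| ≤ N) :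
    |R.int A F| ≤ N * ∫ _q in A, (1 : ℝ) ∂(MatrixMeasure.var R) := by
  have h1 : ∫ _q in A, (1 : ℝ) ∂(MatrixMeasure.var R) = ∑ i, ∑ j, (R i j).totalVariation.real A := by
    simp only [integral_const, smul_eq_mul, mul_one, measureReal_restrict_apply_univ]
    simp only [MatrixMeasure.var, measureReal_def, Measure.coe_finsetSum, Finset.sum_apply]
    rw [ENNReal.toReal_sum fun i _ => ENNReal.sum_ne_top.2 fun j _ => measure_ne_top _ _]
    exact Finset.sum_congr rfl fun i _ => ENNReal.toReal_sum fun j _ => measure_ne_top _ _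
  rw [h1, Finset.mul_sum]
  refine (Finset.abs_sum_le_sum_abs _ _).trans (Finset.sum_le_sum fun i _ => ?_)
  rw [Finset.mul_sum]
  exact (Finset.abs_sum_le_sum_abs _ _).trans
    (Finset.sum_le_sum fun j _ => abs_signedInt_le _ fun q hq => hF q hq i j)

/-! ### Identities with time dependent test fields -/

theorem IsC1.time_mul {φ : ℝ → ℝ} (hφ : ContDiff ℝ ∞ φ) {f : V3 → ℝ} (hf : ContDiff ℝ 1 f) :
    IsC1 fun t x => φ t * f x := by
  have h1 : ContDiff ℝ 1 φ := hφ.of_le (by exact_mod_cast le_top)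
  exact (h1.comp contDiff_fst).mul (hf.comp contDiff_snd)

namespace IsDMVSolutionWith

variable {G : Geometry} {bd : BoundaryData G} {fl : Fluid} {V : Kernel (ℝ × V3) Phase}
  [IsMarkovKernel V] {V₀ : Kernel V3 Phase₀} {RM RB : MatrixMeasure} {DT : (ℝ → V3 → ℝ) → ℝ → ℝ}
  {DB : (ℝ → V3 → V3) → ℝ → ℝ}

/-- Extends the velocity compatibility to fields without a time derivative, such as the viscous
stress, and localises it to (0,τ). The products φ(t)Z(s,x) are admissible in the original condition,
and freezing recovers Z(t,x). -/
theorem integral_velocity_eq_zero (hV : IsDMVSolutionWith G bd fl V V₀ RM RB DT DB)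
    {Z : ℝ → V3 → M3} (hZ : ∀ i j, IsC01 fun t x => Z t x i j)
    (hsym : ∀ t x, (Z t x).IsSymm) {τ : ℝ} (hτ : τ ≤ G.T) :
    ∫ q in G.cyl τ, (avV (V q) (fun z => z.u) ⬝ᵥ dvgM (Z q.1) q.2
      + frob (avM (V q) fun z => z.Du) (Z q.1 q.2)) = 0 := by
  have hdv : ∀ i, Continuous fun q : ℝ × V3 => dvgM (Z q.1) q.2 i := fun i =>
    continuous_finsetSum _ fun j _ => (hZ i j).continuous_pd j
  -- The index type collects the coefficients of the divergence and of the entries of `Z` into one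
  -- finite family, since only the sum of the two pairings vanishes.
  have key := integral_eq_zero_of_frozen G.isOpen G.isBounded G.T_pos
    (κ := Fin 3 ⊕ Fin 3 × Fin 3)
    (a := Sum.elim (fun i q => avV (V q) (fun z => z.u) i)
      fun k q => avM (V q) (fun z => z.Du) k.1 k.2)
    (z := Sum.elim (fun i t x => dvgM (Z t) x i) fun k t x => Z t x k.1 k.2)
    (fun k => by
      rcases k with i | k
      · exact (hV.int_velocity i).isAverage.integrable
      · exact (hV.int_Du k.1 k.2).isAverage.integrable)
    (fun k => by
      rcases k with i | k
      · exact hdv i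
      · exact (hZ k.1 k.2).continuous)
    (fun s _ φ hφ => ?_) hτ
  · simp only [Fintype.sum_sum_type, Fintype.sum_prod_type, Sum.elim_inl, Sum.elim_inr] at key
    exact key
  · have h := hV.compat_velocity (fun t x => φ t • Z s x)
      (fun i j => IsC1.time_mul hφ ((hZ i j).slice s))
      (fun t _ x _ => by rw [Matrix.IsSymm, Matrix.transpose_smul, hsym s x])
    have e : ∀ q : ℝ × V3, dvgM (fun x => φ q.1 • Z s x) q.2 = φ q.1 • dvgM (Z s) q.2 := fun q => by
      ext i
      simp only [dvgM, Matrix.smul_apply, smul_eq_mul, Pi.smul_apply, Finset.mul_sum]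
      exact Finset.sum_congr rfl fun j _ =>
        pd_const_mul _ (((hZ i j).slice s).differentiable one_ne_zero _) j
    simp only [e] at h
    have c1 : ∀ i, Continuous fun q : ℝ × V3 => (φ q.1 • dvgM (Z s) q.2) i := fun i =>
      (hφ.continuous.comp continuous_fst).mul ((hdv i).comp (by fun_prop :
        Continuous fun q : ℝ × V3 => (s, q.2)))
    have c2 : ∀ i j, Continuous fun q : ℝ × V3 => (φ q.1 • Z s q.2) i j := fun i j =>
      (hφ.continuous.comp continuous_fst).mul ((hZ i j).continuous.comp (by fun_prop :
        Continuous fun q : ℝ × V3 => (s, q.2)))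
    have i1 := (isAverage_dot (fun i => (hV.int_velocity i).isAverage) c1).integrable
    have i2 := (isAverage_frob (fun i j => (hV.int_Du i j).isAverage) c2).integrable
    have h2 : ∫ q in G.cyl G.T, (avV (V q) (fun z => z.u) ⬝ᵥ (φ q.1 • dvgM (Z s) q.2)
        + frob (avM (V q) fun z => z.Du) (φ q.1 • Z s q.2)) = 0 := by
      rw [integral_add i1 i2]
      linarith
    refine Eq.trans ?_ h2
    refine integral_congr_ae (ae_of_all _ fun q => ?_)
    simp only [Fintype.sum_sum_type, Fintype.sum_prod_type, Sum.elim_inl, Sum.elim_inr, frob,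
      dotProduct, Matrix.smul_apply, Pi.smul_apply, smul_eq_mul, mul_add, Finset.mul_sum]
    congr 1
    · exact Finset.sum_congr rfl fun i _ => by ring
    · exact Finset.sum_congr rfl fun i _ => Finset.sum_congr rfl fun j _ => by ring

/-- Freezing again; the Neumann condition on ψ is imposed at every time of [0,T], so each frozen
field satisfies it too. The reference temperature is not frozen, since it belongs to the integrable
factors. -/
theorem integral_temperature_eq_zero (hV : IsDMVSolutionWith G bd fl V V₀ RM RB DT DB)
    {Θ : ℝ → V3 → ℝ} (hΘ : IsTempExtension G bd Θ) {ψ : ℝ → V3 → V3}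
    (hψ : ∀ i, IsC01 fun t x => ψ t x i)
    (hn : ∀ t ∈ Icc 0 G.T, ∀ x ∈ G.ΓθN, ψ t x ⬝ᵥ G.n x = 0) {τ : ℝ} (hτ : τ ≤ G.T) :
    ∫ q in G.cyl τ, (av (V q) (fun z => z.θ - Θ q.1 q.2) * dvg (ψ q.1) q.2
      + avV (V q) (fun z => z.Dθ - grad (Θ q.1) q.2) ⬝ᵥ ψ q.1 q.2) = 0 := by
  have hdv : Continuous fun q : ℝ × V3 => dvg (ψ q.1) q.2 :=
    continuous_finsetSum _ fun j _ => (hψ j).continuous_pd j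
  have a1 : IsAverage V (volume.restrict (G.cyl G.T))
      (fun q => av (V q) fun z => z.θ - Θ q.1 q.2) fun q z => z.θ - Θ q.1 q.2 :=
    (hV.int_temperature.isAverage.sub (IsAverage.of_continuous hΘ.reg.1.continuous)).average
  have a2 : ∀ i, IsAverage V (volume.restrict (G.cyl G.T))
      (fun q => avV (V q) (fun z => z.Dθ - grad (Θ q.1) q.2) i)
      fun q z => (z.Dθ - grad (Θ q.1) q.2) i := fun i =>
    ((hV.int_Dθ i).isAverage.sub (IsAverage.of_continuous (hΘ.reg.1.continuous_pd i))).average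
  have key := integral_eq_zero_of_frozen G.isOpen G.isBounded G.T_pos
    (κ := Unit ⊕ Fin 3)
    (a := Sum.elim (fun _ q => av (V q) fun z => z.θ - Θ q.1 q.2)
      fun i q => avV (V q) (fun z => z.Dθ - grad (Θ q.1) q.2) i)
    (z := Sum.elim (fun _ t x => dvg (ψ t) x) fun i t x => ψ t x i)
    (fun k => by
      rcases k with i | k
      · exact a1.integrable
      · exact (a2 k).integrable)
    (fun k => by
      rcases k with i | k
      · exact hdv
      · exact (hψ k).continuous)
    (fun s hs φ hφ => ?_) hτ
  · simp only [Fintype.sum_sum_type, Sum.elim_inl, Sum.elim_inr, Finset.univ_unique,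
      Finset.sum_singleton] at key
    exact key
  · have h := hV.compat_temperature (fun t x => φ t • ψ s x) Θ
      (IsC1.pi fun i => IsC1.time_mul hφ ((hψ i).slice s))
      (fun t _ x hx => by rw [smul_dotProduct, hn s hs x hx, smul_zero]) hΘ
    have e : ∀ q : ℝ × V3, dvg (fun x => φ q.1 • ψ s x) q.2 = φ q.1 * dvg (ψ s) q.2 := fun q => by
      simp only [dvg, smul_eq_mul, Pi.smul_apply, Finset.mul_sum]
      exact Finset.sum_congr rfl fun j _ =>
        pd_const_mul _ (((hψ j).slice s).differentiable one_ne_zero _) j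
    simp only [e] at h
    have c1 : Continuous fun q : ℝ × V3 => φ q.1 * dvg (ψ s) q.2 :=
      (hφ.continuous.comp continuous_fst).mul (hdv.comp (by fun_prop :
        Continuous fun q : ℝ × V3 => (s, q.2)))
    have c2 : ∀ i, Continuous fun q : ℝ × V3 => (φ q.1 • ψ s q.2) i := fun i =>
      (hφ.continuous.comp continuous_fst).mul ((hψ i).continuous.comp (by fun_prop :
        Continuous fun q : ℝ × V3 => (s, q.2)))
    have i1 := (a1.mul_continuous c1).integrable
    have i2 := (isAverage_dot a2 c2).integrable
    have h2 : ∫ q in G.cyl G.T, (av (V q) (fun z => z.θ - Θ q.1 q.2) * (φ q.1 * dvg (ψ s) q.2)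
        + avV (V q) (fun z => z.Dθ - grad (Θ q.1) q.2) ⬝ᵥ (φ q.1 • ψ s q.2)) = 0 := by
      rw [integral_add i1 i2]
      linarith
    refine Eq.trans ?_ h2
    refine integral_congr_ae (ae_of_all _ fun q => ?_)
    simp only [Fintype.sum_sum_type, Sum.elim_inl, Sum.elim_inr, Finset.univ_unique,
      Finset.sum_singleton, dotProduct, Pi.smul_apply, smul_eq_mul, mul_add, Finset.mul_sum]
    congr 1
    · ring
    · exact Finset.sum_congr rfl fun i _ => by ring

/-- Freezing with vanishing tangential trace on the Neumann part. For the strong solution the test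
field is ζ curl H, which satisfies this by the condition on curl H × n. -/
theorem integral_magnetic_eq_zero (hV : IsDMVSolutionWith G bd fl V V₀ RM RB DT DB)
    {H : ℝ → V3 → V3} (hH : IsMagExtension G bd H) {E : ℝ → V3 → V3}
    (hE : ∀ i, IsC01 fun t x => E t x i)
    (hn : ∀ t ∈ Icc 0 G.T, ∀ x ∈ G.ΓBN, E t x ⨯₃ G.n x = 0) {τ : ℝ} (hτ : τ ≤ G.T) :
    ∫ q in G.cyl τ, (avV (V q) (fun z => z.B - H q.1 q.2) ⬝ᵥ curl (E q.1) q.2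
      - avV (V q) (fun z => z.CB - curl (H q.1) q.2) ⬝ᵥ E q.1 q.2) = 0 := by
  have hcurl : ∀ {F : ℝ → V3 → V3}, (∀ i, IsC01 fun t x => F t x i) → ∀ i,
      Continuous fun q : ℝ × V3 => curl (F q.1) q.2 i := by
    intro F hF i
    fin_cases i
    · exact ((hF 2).continuous_pd 1).sub ((hF 1).continuous_pd 2)
    · exact ((hF 0).continuous_pd 2).sub ((hF 2).continuous_pd 0)
    · exact ((hF 1).continuous_pd 0).sub ((hF 0).continuous_pd 1)
  have hHi : ∀ i, IsC1 fun t x => H t x i := fun i => hH.reg.1.apply i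
  have a1 : ∀ i, IsAverage V (volume.restrict (G.cyl G.T))
      (fun q => avV (V q) (fun z => z.B - H q.1 q.2) i) fun q z => (z.B - H q.1 q.2) i := fun i =>
    ((hV.int_magnetic i).isAverage.sub (IsAverage.of_continuous (hHi i).continuous)).average
  have a2 : ∀ i, IsAverage V (volume.restrict (G.cyl G.T))
      (fun q => avV (V q) (fun z => z.CB - curl (H q.1) q.2) i)
      fun q z => (z.CB - curl (H q.1) q.2) i := fun i =>
    ((hV.int_CB i).isAverage.sub
      (IsAverage.of_continuous (hcurl (fun i => (hHi i).isC01) i))).average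
  have key := integral_eq_zero_of_frozen G.isOpen G.isBounded G.T_pos
    (κ := Fin 3 ⊕ Fin 3)
    (a := Sum.elim (fun i q => avV (V q) (fun z => z.B - H q.1 q.2) i)
      fun i q => -avV (V q) (fun z => z.CB - curl (H q.1) q.2) i)
    (z := Sum.elim (fun i t x => curl (E t) x i) fun i t x => E t x i)
    (fun k => by
      rcases k with i | k
      · exact (a1 i).integrable
      · exact (a2 k).neg.integrable)
    (fun k => by
      rcases k with i | k
      · exact hcurl hE i
      · exact (hE k).continuous)
    (fun s hs φ hφ => ?_) hτ
  · simp only [Fintype.sum_sum_type, Sum.elim_inl, Sum.elim_inr, neg_mul,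
      Finset.sum_neg_distrib, ← sub_eq_add_neg] at key
    exact key
  · have h := hV.compat_magnetic H (fun t x => φ t • E s x) hH
      (IsC1.pi fun i => IsC1.time_mul hφ ((hE i).slice s))
      (Or.inl fun t _ x hx => by rw [map_smul, LinearMap.smul_apply, hn s hs x hx, smul_zero])
    have e : ∀ q : ℝ × V3, curl (fun x => φ q.1 • E s x) q.2 = φ q.1 • curl (E s) q.2 := fun q => by
      have hp : ∀ i j, pd j (fun y => (φ q.1 • E s y) i) q.2
          = φ q.1 * pd j (fun y => E s y i) q.2 := fun i j =>
        pd_const_mul _ (((hE i).slice s).differentiable one_ne_zero _) j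
      simp only [curl, hp]
      ext i
      fin_cases i <;> simp <;> ring
    simp only [e] at h
    have c1 : ∀ i, Continuous fun q : ℝ × V3 => (φ q.1 • curl (E s) q.2) i := fun i =>
      (hφ.continuous.comp continuous_fst).mul ((hcurl hE i).comp (by fun_prop :
        Continuous fun q : ℝ × V3 => (s, q.2)))
    have c2 : ∀ i, Continuous fun q : ℝ × V3 => (φ q.1 • E s q.2) i := fun i =>
      (hφ.continuous.comp continuous_fst).mul ((hE i).continuous.comp (by fun_prop :
        Continuous fun q : ℝ × V3 => (s, q.2)))
    have i1 := (isAverage_dot a1 c1).integrable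
    have i2 := (isAverage_dot a2 c2).integrable
    have h2 : ∫ q in G.cyl G.T, (avV (V q) (fun z => z.B - H q.1 q.2) ⬝ᵥ (φ q.1 • curl (E s) q.2)
        - avV (V q) (fun z => z.CB - curl (H q.1) q.2) ⬝ᵥ (φ q.1 • E s q.2)) = 0 := by
      rw [integral_sub i1 i2, h, sub_eq_zero]
      simp only [dotProduct_comm]
    refine Eq.trans ?_ h2
    refine integral_congr_ae (ae_of_all _ fun q => ?_)
    simp only [Fintype.sum_sum_type, Sum.elim_inl, Sum.elim_inr, dotProduct, Pi.smul_apply,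
      smul_eq_mul, mul_add, Finset.mul_sum, sub_eq_add_neg, ← Finset.sum_neg_distrib]
    congr 1 <;> exact Finset.sum_congr rfl fun i _ => by ring

/-- Two approximations are combined: truncation gives compact support in Ω at each frozen time, and
freezing in time removes the need for a time derivative. -/
theorem integral_solenoidal_eq_zero (hV : IsDMVSolutionWith G bd fl V V₀ RM RB DT DB)
    {W : ℝ → V3 → ℝ} (hW : IsC01 W) (h0 : ∀ t ∈ Icc 0 G.T, ∀ x ∈ frontier G.Ω, W t x = 0)
    {τ : ℝ} (hτ : τ ≤ G.T) :
    ∫ q in G.cyl τ, avV (V q) (fun z => z.B) ⬝ᵥ grad (W q.1) q.2 = 0 := by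
  have hB := fun i => (hV.int_magnetic i).isAverage
  refine integral_eq_zero_of_frozen G.isOpen G.isBounded G.T_pos
    (a := fun i q => avV (V q) (fun z => z.B) i) (z := fun i t x => grad (W t) x i)
    (fun i => (hB i).integrable) hW.continuous_pd (fun s hs φ hφ => ?_) hτ
  obtain ⟨Wn, h1, h2, ⟨C, hC⟩, h4⟩ :=
    exists_compactly_supported_approx G.isOpen G.isBounded (hW.slice s) (h0 s hs)
  have hc : ∀ n i, Continuous fun q : ℝ × V3 => φ q.1 * pd i (Wn n) q.2 := fun n i =>
    (hφ.continuous.comp continuous_fst).mul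
      ((((h1 n).continuous_fderiv one_ne_zero).clm_apply continuous_const).comp continuous_snd)
  have hz : ∀ n, ∫ q in G.cyl G.T, avV (V q) (fun z => z.B) ⬝ᵥ
      (fun i => φ q.1 * pd i (Wn n) q.2) = 0 := by
    intro n
    have hn := hV.solenoidal (fun t x => φ t * Wn n x) (IsC1.time_mul hφ (h1 n)) (by
      obtain ⟨K, hK, hKΩ, hK0⟩ := h2 n
      exact ⟨K, hK, hKΩ, fun t _ x hx => by rw [hK0 x hx, mul_zero]⟩)
    have e : ∀ q : ℝ × V3, grad (fun x => φ q.1 * Wn n x) q.2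
        = fun i => φ q.1 * pd i (Wn n) q.2 := fun q => funext fun i =>
      pd_const_mul _ ((h1 n).differentiable one_ne_zero _) i
    simp only [e] at hn
    have hi := (isAverage_dot hB (v := fun q i => φ q.1 * pd i (Wn n) q.2) (hc n)).integrable
    have hg := integrable_slice_integral hi
    have hT : G.T ∈ Icc 0 G.T := ⟨G.T_pos.le, le_rfl⟩
    have hn' : ∀ᵐ τ ∂volume.restrict (Ioo 0 G.T), ∫ t in Ioo 0 τ, ∫ x in G.Ω,
        avV (V (t, x)) (fun z => z.B) ⬝ᵥ (fun i => φ t * pd i (Wn n) x) = 0 := by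
      filter_upwards [hn, ae_restrict_mem measurableSet_Ioo] with τ hτ hm
      refine Eq.trans ?_ hτ
      exact (setIntegral_prod_slices hm.2.le hi).symm
    refine (setIntegral_prod_slices le_rfl hi).trans (le_antisymm ?_ ?_)
    -- The relation is known for almost every final time; continuity of the primitive carries each
    -- of the two inequalities to the final time T.
    · have := setIntegral_nonneg_of_ae G.T_pos hg.neg (hn'.mono fun τ h => by
        simp only [Pi.neg_apply, integral_neg, h, neg_zero, le_refl]) hT
      simpa only [Pi.neg_apply, integral_neg, neg_nonneg] using this
    · exact setIntegral_nonneg_of_ae G.T_pos hg (hn'.mono fun τ h => h.ge) hT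
  obtain ⟨D, hD⟩ := (isCompact_Icc (a := 0) (b := G.T)).exists_bound_of_continuousOn
    hφ.continuous.continuousOn
  have hlim := tendsto_integral_of_dominated_convergence (μ := volume.restrict (G.cyl G.T))
    (F := fun n q => avV (V q) (fun z => z.B) ⬝ᵥ (fun i => φ q.1 * pd i (Wn n) q.2))
    (f := fun q => φ q.1 * ∑ i, avV (V q) (fun z => z.B) i * grad (W s) q.2 i)
    (fun q => ∑ i, ‖avV (V q) (fun z => z.B) i‖ * (D * C))
    (fun n => (isAverage_dot hB (v := fun q i => φ q.1 * pd i (Wn n) q.2)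
      (hc n)).integrable.aestronglyMeasurable)
    (integrable_finsetSum _ fun i _ => (hB i).integrable.norm.mul_const _) ?_ ?_
  · simp only [hz] at hlim
    exact tendsto_nhds_unique hlim tendsto_const_nhds
  · intro n
    filter_upwards [G.ae_mem_cyl G.T] with q hq
    refine (norm_sum_le _ _).trans (Finset.sum_le_sum fun i _ => ?_)
    rw [norm_mul, norm_mul]
    have hφq := hD q.1 (Ioo_subset_Icc_self hq.1)
    gcongr
    · exact (norm_nonneg _).trans hφq
    · exact hC n q.2 hq.2 i
  · have h4' : ∀ᵐ q ∂volume.restrict (G.cyl G.T), ∀ j,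
        Tendsto (fun n => pd j (Wn n) q.2) atTop (𝓝 (pd j (W s) q.2)) := by
      have : (volume : Measure (ℝ × V3)).restrict (G.cyl G.T)
          = (volume.restrict (Ioo 0 G.T)).prod (volume.restrict G.Ω) := by
        rw [Measure.prod_restrict, Geometry.cyl, Measure.volume_eq_prod]
      rw [this]
      exact Measure.quasiMeasurePreserving_snd.ae h4
    filter_upwards [h4'] with q hq
    rw [Finset.mul_sum]
    refine tendsto_finsetSum _ fun i _ => ?_
    have := ((hq i).const_mul (φ q.1)).const_mul (avV (V q) (fun z => z.B) i)
    convert this using 2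
    simp only [grad]
    ring

end IsDMVSolutionWith

/-! ### Identities for the strong solution -/

/-- Integration of the time derivative of a `C¹` function. -/
theorem IsC1.integral_sub_eq {f : ℝ → V3 → ℝ} (hf : IsC1 f) (G : Geometry) {τ : ℝ}
    (hτ : τ ∈ Ioo 0 G.T) :
    (∫ x in G.Ω, f τ x) - ∫ x in G.Ω, f 0 x = ∫ q in G.cyl τ, dt f q.1 q.2 := by
  have hb : Bornology.IsBounded G.Ω := G.isBounded
  have hc := hf.continuous_dt
  have hi : ∀ s, Integrable (f s) (volume.restrict G.Ω) := fun s =>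
    ((hf.slice s).continuous.continuousOn.integrableOn_compact
      hb.isCompact_closure).mono_set subset_closure
  rw [← integral_sub (hi τ) (hi 0)]
  have h1 : Integrable (fun q : ℝ × V3 => dt f q.1 q.2)
      ((volume.restrict (Ioo 0 τ)).prod (volume.restrict G.Ω)) := by
    have := (G.integrable_of_continuous hc)
    rw [Measure.prod_restrict, ← Measure.volume_eq_prod]
    exact IntegrableOn.mono_set this (G.cyl_mono hτ.2.le)
  have h2 : ∫ q in G.cyl τ, dt f q.1 q.2
      = ∫ x in G.Ω, ∫ t in Ioo 0 τ, dt f t x := by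
    rw [Geometry.cyl, Measure.volume_eq_prod, ← Measure.prod_restrict,
      integral_prod_symm _ h1]
  rw [h2]
  refine integral_congr_ae (ae_of_all _ fun x => ?_)
  have hd := intervalIntegral.integral_eq_sub_of_hasDerivAt (a := 0) (b := τ)
    (f := fun t => f t x) (f' := fun t => dt f t x)
    (fun t _ => (hf.differentiableAt_time t x).hasDerivAt)
    ((hc.comp (by fun_prop : Continuous fun t : ℝ => (t, x))).intervalIntegrable _ _)
  rw [intervalIntegral.integral_of_le hτ.1.le, integral_Ioc_eq_integral_Ioo] at hd
  exact hd.symm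

theorem integral_divergence_eq_zero (G : Geometry) {F : Fin 3 → ℝ → V3 → ℝ}
    (hF : ∀ j, IsC01 (F j)) (h0 : ∀ t ∈ Icc 0 G.T, ∀ x ∈ frontier G.Ω, ∀ j, F j t x = 0)
    {τ : ℝ} (hτ : τ ≤ G.T) :
    ∫ q in G.cyl τ, ∑ j, pd j (F j q.1) q.2 = 0 := by
  have hi : Integrable (fun q : ℝ × V3 => ∑ j, pd j (F j q.1) q.2)
      (volume.restrict (G.cyl G.T)) :=
    G.integrable_of_continuous (continuous_finsetSum _ fun j _ => (hF j).continuous_pd j)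
  have hs : ∀ t, ∀ j, Integrable (fun x => pd j (F j t) x) (volume.restrict G.Ω) := fun t j =>
    ((((hF j).continuous_pd j).comp (by fun_prop : Continuous fun x : V3 =>
      (t, x))).continuousOn.integrableOn_compact G.isBounded.isCompact_closure).mono_set
      subset_closure
  refine (setIntegral_prod_slices hτ hi).trans ?_
  refine setIntegral_eq_zero_of_forall_eq_zero fun t ht => ?_
  rw [integral_finsetSum _ fun j _ => hs t j]
  exact Finset.sum_eq_zero fun j _ => integral_pd_eq_zero G.isOpen G.isBounded ((hF j).slice t)
    (fun x hx => h0 t ⟨ht.1.le, ht.2.le.trans hτ⟩ x hx j) j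

/-! ### The relative energy inequality -/

theorem IsAverage.integrable_cyl {G : Geometry} {V : Kernel (ℝ × V3) Phase} {f : ℝ × V3 → ℝ}
    {F : ℝ × V3 → Phase → ℝ} (h : IsAverage V (volume.restrict (G.cyl G.T)) f F) {τ : ℝ}
    (hτ : τ ≤ G.T) : Integrable f (volume.restrict (G.cyl τ)) :=
  IntegrableOn.mono_set h.integrable (G.cyl_mono hτ)

theorem IsAverage.setIntegral_add {G : Geometry} {V : Kernel (ℝ × V3) Phase}
    {f f' : ℝ × V3 → ℝ} {F F' : ℝ × V3 → Phase → ℝ}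
    (h : IsAverage V (volume.restrict (G.cyl G.T)) f F)
    (h' : IsAverage V (volume.restrict (G.cyl G.T)) f' F') {τ : ℝ} (hτ : τ ≤ G.T) :
    ∫ q in G.cyl τ, (f q + f' q) = (∫ q in G.cyl τ, f q) + ∫ q in G.cyl τ, f' q :=
  integral_add (h.integrable_cyl hτ) (h'.integrable_cyl hτ)

theorem IsAverage.setIntegral_sub {G : Geometry} {V : Kernel (ℝ × V3) Phase}
    {f f' : ℝ × V3 → ℝ} {F F' : ℝ × V3 → Phase → ℝ}
    (h : IsAverage V (volume.restrict (G.cyl G.T)) f F)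
    (h' : IsAverage V (volume.restrict (G.cyl G.T)) f' F') {τ : ℝ} (hτ : τ ≤ G.T) :
    ∫ q in G.cyl τ, (f q - f' q) = (∫ q in G.cyl τ, f q) - ∫ q in G.cyl τ, f' q :=
  integral_sub (h.integrable_cyl hτ) (h'.integrable_cyl hτ)

theorem av_dirac (z₀ : Phase₀) (g : Phase₀ → ℝ) : av (Measure.dirac z₀) g = g z₀ :=
  integral_dirac g z₀

theorem avV_dirac (z₀ : Phase₀) (g : Phase₀ → V3) : avV (Measure.dirac z₀) g = g z₀ :=
  funext fun i => integral_dirac (fun z => g z i) z₀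

namespace RegularState

variable {fl : Fluid} {r : ℝ → V3 → ℝ} {U : ℝ → V3 → V3} {Θ : ℝ → V3 → ℝ} {H : ℝ → V3 → V3}

theorem pressure_isC1 (h : RegularState r U Θ H) (hp : C1Quad fl.p) :
    IsC1 fun t x => fl.p (r t x) (Θ t x) + 1 / 2 * normSq (H t x) :=
  (h.comp hp).add h.H_reg.1.half_normSq

/-- The relative energy integrand in terms of the observables of a measure-valued solution. -/
theorem relEnergy_eq (t : ℝ) (x : V3) (z : Phase) :
    (strongPoint fl r U Θ H t x).relEnergy fl z
      = fl.ballistic (Θ t x) (H t x) z.ρ z.u z.θ z.B - (z.ρ • z.u) ⬝ᵥ U t x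
        + z.ρ * potential fl r U Θ t x + (fl.p (r t x) (Θ t x) + 1 / 2 * normSq (H t x)) := by
  simp only [StrongPoint.relEnergy, strongPoint, Fluid.ballistic, Fluid.energy, potential,
    Fluid.relThermal, normSq, dotProduct, Fin.sum_univ_three, Pi.sub_apply, Pi.smul_apply,
    smul_eq_mul]
  ring

theorem raw_eq (h : RegularState r U Θ H) (hG : fl.Gibbs) (hp : C1Quad fl.p) (he : C1Quad fl.e)
    (hs : C1Quad fl.s) (hμ : C1Quad fl.μ) (hη : C1Quad fl.η) (t : ℝ) (x : V3) (z : Phase) :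
    (strongPoint fl r U Θ H t x).raw fl z
      = -(fl.entropyObs z * dt Θ t x + fl.entropyFluxObs z ⬝ᵥ grad (Θ t) x)
        - (z.B ⬝ᵥ dtV H t x - fl.inductionObs z ⬝ᵥ curl (H t) x) - fl.productionObs z * Θ t x
        - ((z.ρ • z.u) ⬝ᵥ dtV U t x - frob (fl.stressObs z) (jac (U t) x))
        - (frob (convObs z) (jac (U t) x) + fl.pressureObs z * dvg (U t) x)
        + (z.ρ * dt (potential fl r U Θ) t x + (z.ρ • z.u) ⬝ᵥ grad (potential fl r U Θ t) x)
        + dt (fun t x => fl.p (r t x) (Θ t x) + 1 / 2 * normSq (H t x)) t x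
        + (z.u ⬝ᵥ dvgM (fun y => fl.stress (r t y) (Θ t y) (symGrad (U t) y)) x
          + frob z.Du (fl.stress (r t x) (Θ t x) (symGrad (U t) x)))
        + ((z.θ - Θ t x) * dvg (fun y => (fl.κ (r t y) (Θ t y) / Θ t y) • grad (Θ t) y) x
          + (z.Dθ - grad (Θ t) x) ⬝ᵥ ((fl.κ (r t x) (Θ t x) / Θ t x) • grad (Θ t) x))
        - ((z.B - H t x) ⬝ᵥ curl (fun y => fl.ζ (r t y) (Θ t y) • curl (H t) y) x
          - (z.CB - curl (H t) x) ⬝ᵥ (fl.ζ (r t x) (Θ t x) • curl (H t) x))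
        - z.B ⬝ᵥ grad (fun y => H t y ⬝ᵥ U t y) x
        + ∑ j, pd j (energyFlux fl r U Θ H j t) x := by
  rw [h.dt_potential hG hp he hs, h.grad_potential hG hp he hs, h.dt_pressure hp,
    h.grad_crossHelicity (fl := fl), h.div_energyFlux hμ hη hp, StrongPoint.raw,
    dotProduct_comm (z.CB - _)]
  rfl

end RegularState

/-- A regular strong solution and a measure-valued solution with the same initial data. -/
structure Comparison (G : Geometry) (bd : BoundaryData G) (fl : Fluid)
    (ρ₀ : V3 → ℝ) (u₀ : V3 → V3) (θ₀ : V3 → ℝ) (B₀ : V3 → V3)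
    (r : ℝ → V3 → ℝ) (U : ℝ → V3 → V3) (Θ : ℝ → V3 → ℝ) (H : ℝ → V3 → V3)
    (V : Kernel (ℝ × V3) Phase) (V₀ : Kernel V3 Phase₀) (RM RB : MatrixMeasure)
    (DT : (ℝ → V3 → ℝ) → ℝ → ℝ) (DB : (ℝ → V3 → V3) → ℝ → ℝ) : Prop where
  strong : IsStrongSolution G bd fl ρ₀ u₀ θ₀ B₀ r U Θ H
  regular : RegularState r U Θ H
  dmv : IsDMVSolutionWith G bd fl V V₀ RM RB DT DB
  initial : ∀ᵐ x ∂volume.restrict G.Ω, V₀ x = Measure.dirac (ρ₀ x, u₀ x, θ₀ x, B₀ x)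
  μ_reg : C1Quad fl.μ
  η_reg : C1Quad fl.η
  κ_reg : C1Quad fl.κ
  ζ_reg : C1Quad fl.ζ
  p_reg : C1Quad fl.p
  e_reg : C1Quad fl.e
  s_reg : C1Quad fl.s
  gibbs : fl.Gibbs

namespace Comparison

variable {G : Geometry} {bd : BoundaryData G} {fl : Fluid} {ρ₀ : V3 → ℝ} {u₀ : V3 → V3}
  {θ₀ : V3 → ℝ} {B₀ : V3 → V3} {r : ℝ → V3 → ℝ} {U : ℝ → V3 → V3} {Θ : ℝ → V3 → ℝ}
  {H : ℝ → V3 → V3} {V : Kernel (ℝ × V3) Phase} {V₀ : Kernel V3 Phase₀}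
  {RM RB : MatrixMeasure} {DT : (ℝ → V3 → ℝ) → ℝ → ℝ} {DB : (ℝ → V3 → V3) → ℝ → ℝ}

theorem isTempTest (h : Comparison G bd fl ρ₀ u₀ θ₀ B₀ r U Θ H V V₀ RM RB DT DB) :
    IsTempTest G bd Θ :=
  ⟨⟨h.strong.Θ_reg, h.strong.bc_temperature⟩, h.strong.Θ_pos⟩

theorem isMagTest (h : Comparison G bd fl ρ₀ u₀ θ₀ B₀ r U Θ H V V₀ RM RB DT DB) :
    IsMagTest G bd H :=
  ⟨⟨h.strong.H_reg, h.strong.bc_tangential⟩, h.strong.solenoidal, h.strong.bc_normal⟩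

/-- The initial relative energy vanishes. -/
theorem initial_eq (h : Comparison G bd fl ρ₀ u₀ θ₀ B₀ r U Θ H V V₀ RM RB DT DB) :
    ∫ x in G.Ω, av (V₀ x) (fun z => fl.ballistic (Θ 0 x) (H 0 x) z.ρ z.u z.θ z.B)
      = (∫ x in G.Ω, avV (V₀ x) (fun z => z.ρ • z.u) ⬝ᵥ U 0 x)
        - (∫ x in G.Ω, av (V₀ x) (fun z => z.ρ) * potential fl r U Θ 0 x)
        - ∫ x in G.Ω, (fl.p (r 0 x) (Θ 0 x) + 1 / 2 * normSq (H 0 x)) := by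
  have hR := h.regular
  have hi : ∀ {f : ℝ → V3 → ℝ}, IsC1 f → Integrable (f 0) (volume.restrict G.Ω) := fun hf =>
    ((hf.slice 0).continuous.continuousOn.integrableOn_compact
      G.isBounded.isCompact_closure).mono_set subset_closure
  have hd : ∀ᵐ x ∂volume.restrict G.Ω, V₀ x = Measure.dirac (r 0 x, U 0 x, Θ 0 x, H 0 x) := by
    filter_upwards [h.initial, ae_restrict_mem G.isOpen.measurableSet] with x hx hxΩ
    rw [hx, h.strong.init_density x hxΩ, h.strong.init_velocity x hxΩ,
      h.strong.init_temperature x hxΩ, h.strong.init_magnetic x hxΩ]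
  have e1 : ∫ x in G.Ω, avV (V₀ x) (fun z => z.ρ • z.u) ⬝ᵥ U 0 x
      = ∫ x in G.Ω, (r 0 x • U 0 x) ⬝ᵥ U 0 x := by
    refine integral_congr_ae ?_
    filter_upwards [hd] with x hx
    rw [hx, avV_dirac]
    rfl
  have e2 : ∫ x in G.Ω, av (V₀ x) (fun z => z.ρ) * potential fl r U Θ 0 x
      = ∫ x in G.Ω, r 0 x * potential fl r U Θ 0 x := by
    refine integral_congr_ae ?_
    filter_upwards [hd] with x hx
    rw [hx, av_dirac]
    rfl
  have i1 : Integrable (fun x => (r 0 x • U 0 x) ⬝ᵥ U 0 x) (volume.restrict G.Ω) :=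
    hi (IsC1.sum fun i => (hR.r_reg.mul (hR.U_isC1 i)).mul (hR.U_isC1 i))
  have i2 := hi (hR.r_reg.mul (hR.potential_isC1 (fl := fl) h.p_reg h.e_reg h.s_reg))
  have i3 := hi (hR.pressure_isC1 (fl := fl) h.p_reg)
  rw [e1, e2, ← integral_sub i1 i2]
  refine Eq.trans (integral_congr_ae ?_) (integral_sub (i1.sub i2) i3)
  filter_upwards [hd] with x hx
  rw [hx, av_dirac]
  -- At coinciding states the kinetic and magnetic distances vanish by inspection, so the thermal
  -- part is all that matters.
  have h1 := fl.relThermal_self (hR.r_pos 0 x) (Θ 0 x)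
  rw [Fluid.relThermal] at h1
  simp only [Fluid.ballistic, Fluid.energy, potential, normSq, Phase₀.ρ, Phase₀.u, Phase₀.θ,
    Phase₀.B, dotProduct, Fin.sum_univ_three, Pi.smul_apply, smul_eq_mul]
  linarith

/-- The concentration defects are controlled by the dissipation defects. -/
theorem exists_defect_bound (h : Comparison G bd fl ρ₀ u₀ θ₀ B₀ r U Θ H V V₀ RM RB DT DB) :
    ∃ c, ∀ᵐ τ ∂volume.restrict (Ioo 0 G.T),
      -(RM.int (Icc 0 τ ×ˢ closure G.Ω) (fun q => jac (U q.1) q.2)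
        + RB.int (Icc 0 τ ×ˢ closure G.Ω) fun q => jac (U q.1) q.2)
      ≤ c * ∫ t in Ioo 0 τ, (DT Θ t + DB H t) := by
  obtain ⟨N, hN, hb⟩ := h.regular.exists_bddBy (fl := fl) h.μ_reg h.η_reg
    (isCompact_Icc.prod G.isBounded.isCompact_closure : IsCompact (Icc 0 G.T ×ˢ closure G.Ω))
  obtain ⟨c1, h1⟩ := h.dmv.defect_momentum Θ h.isTempTest
  obtain ⟨c2, h2⟩ := h.dmv.defect_magnetic H h.isMagTest
  have iT : Integrable (DT Θ) (volume.restrict (Ioo 0 G.T)) :=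
    (h.dmv.DT_bdd Θ h.isTempTest).integrable le_top
  have iB : Integrable (DB H) (volume.restrict (Ioo 0 G.T)) :=
    (h.dmv.DB_bdd H h.isMagTest).integrable le_top
  -- `N` bounds ∇U on the closed cylinder. The domination constants carry no sign, hence the
  -- absolute values; the weight in both dominations is 1.
  refine ⟨N * (|c1| + |c2|), ?_⟩
  filter_upwards [h1 (fun _ => 1) continuous_const fun _ _ => zero_le_one,
    h2 (fun _ => 1) continuous_const fun _ _ => zero_le_one, ae_restrict_mem measurableSet_Ioo]
    with τ h1 h2 hτ
  have hsub : Ioo 0 τ ⊆ Ioo 0 G.T := Ioo_subset_Ioo_right hτ.2.le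
  have nT : 0 ≤ ∫ t in Ioo 0 τ, DT Θ t := integral_nonneg_of_ae
    (ae_mono (Measure.restrict_mono hsub le_rfl) (h.dmv.DT_nonneg Θ h.isTempTest))
  have nB : 0 ≤ ∫ t in Ioo 0 τ, DB H t := integral_nonneg_of_ae
    (ae_mono (Measure.restrict_mono hsub le_rfl) (h.dmv.DB_nonneg H h.isMagTest))
  have hJ : ∀ q ∈ Icc 0 τ ×ˢ closure G.Ω, ∀ i j, |jac (U q.1) q.2 i j| ≤ N := fun q hq =>
    (hb q ⟨Icc_subset_Icc_right hτ.2.le hq.1, hq.2⟩).JU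
  have b1 := (neg_le_abs _).trans (RM.abs_int_le hJ)
  have b2 := (neg_le_abs _).trans (RB.abs_int_le hJ)
  simp only [one_mul] at h1 h2
  have k1 := mul_le_mul_of_nonneg_left
    (h1.trans (mul_le_mul_of_nonneg_right (le_abs_self c1) nT)) hN
  have k2 := mul_le_mul_of_nonneg_left
    (h2.trans (mul_le_mul_of_nonneg_right (le_abs_self c2) nB)) hN
  rw [integral_add (IntegrableOn.mono_set iT hsub) (IntegrableOn.mono_set iB hsub)]
  have k3 : 0 ≤ N * (|c1| * ∫ t in Ioo 0 τ, DB H t) := by positivity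
  have k4 : 0 ≤ N * (|c2| * ∫ t in Ioo 0 τ, DT Θ t) := by positivity
  linarith

variable [IsMarkovKernel V]

theorem isAverage_ballistic (h : Comparison G bd fl ρ₀ u₀ θ₀ B₀ r U Θ H V V₀ RM RB DT DB) :
    IsAverage V (volume.restrict (G.cyl G.T))
      (fun q => av (V q) fun z => fl.ballistic (Θ q.1 q.2) (H q.1 q.2) z.ρ z.u z.θ z.B)
      fun q z => fl.ballistic (Θ q.1 q.2) (H q.1 q.2) z.ρ z.u z.θ z.B := by
  have a := (h.dmv.int_energy.isAverage.sub
    (h.dmv.int_entropy.isAverage.mul_continuous h.regular.Θ_reg.1.continuous)).sub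
    (isAverage_dot (fun i => (h.dmv.int_magnetic i).isAverage)
      fun i => (h.regular.H_isC1 i).continuous)
  refine (a.congr (fun _ => rfl) fun q z => ?_ : IsAverage V _ _ fun q z =>
    fl.ballistic (Θ q.1 q.2) (H q.1 q.2) z.ρ z.u z.θ z.B).average
  rw [Fluid.ballistic, dotProduct_comm, mul_comm (Θ q.1 q.2)]
  rfl

theorem isAverage_momentum (h : Comparison G bd fl ρ₀ u₀ θ₀ B₀ r U Θ H V V₀ RM RB DT DB) :
    IsAverage V (volume.restrict (G.cyl G.T))
      (fun q => avV (V q) (fun z => z.ρ • z.u) ⬝ᵥ U q.1 q.2)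
      fun q z => (z.ρ • z.u) ⬝ᵥ U q.1 q.2 :=
  isAverage_dot (fun i => (h.dmv.int_momentum i).isAverage)
    fun i => (h.regular.U_isC1 i).continuous

theorem isAverage_potential (h : Comparison G bd fl ρ₀ u₀ θ₀ B₀ r U Θ H V V₀ RM RB DT DB) :
    IsAverage V (volume.restrict (G.cyl G.T))
      (fun q => av (V q) (fun z => z.ρ) * potential fl r U Θ q.1 q.2)
      fun q z => z.ρ * potential fl r U Θ q.1 q.2 :=
  h.dmv.int_density.isAverage.mul_continuous
    (h.regular.potential_isC1 h.p_reg h.e_reg h.s_reg).continuous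

theorem isAverage_relEnergy (h : Comparison G bd fl ρ₀ u₀ θ₀ B₀ r U Θ H V V₀ RM RB DT DB) :
    IsAverage V (volume.restrict (G.cyl G.T))
      (fun q => av (V q) (fun z => fl.ballistic (Θ q.1 q.2) (H q.1 q.2) z.ρ z.u z.θ z.B)
        - avV (V q) (fun z => z.ρ • z.u) ⬝ᵥ U q.1 q.2
        + av (V q) (fun z => z.ρ) * potential fl r U Θ q.1 q.2
        + (fl.p (r q.1 q.2) (Θ q.1 q.2) + 1 / 2 * normSq (H q.1 q.2)))
      fun q z => (strongPoint fl r U Θ H q.1 q.2).relEnergy fl z :=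
  (((h.isAverage_ballistic.sub h.isAverage_momentum).add h.isAverage_potential).add
    (IsAverage.of_continuous (h.regular.pressure_isC1 h.p_reg).continuous)).congr
    (fun _ => rfl) fun q z => RegularState.relEnergy_eq q.1 q.2 z

/-- The averages of the relative energy at almost every time. -/
theorem integral_relEnergy_eq (h : Comparison G bd fl ρ₀ u₀ θ₀ B₀ r U Θ H V V₀ RM RB DT DB) :
    ∀ᵐ τ ∂volume.restrict (Ioo 0 G.T),
      ∫ x in G.Ω, (av (V (τ, x)) (fun z => fl.ballistic (Θ τ x) (H τ x) z.ρ z.u z.θ z.B)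
        - avV (V (τ, x)) (fun z => z.ρ • z.u) ⬝ᵥ U τ x
        + av (V (τ, x)) (fun z => z.ρ) * potential fl r U Θ τ x
        + (fl.p (r τ x) (Θ τ x) + 1 / 2 * normSq (H τ x)))
      = (∫ x in G.Ω, av (V (τ, x)) fun z => fl.ballistic (Θ τ x) (H τ x) z.ρ z.u z.θ z.B)
        - (∫ x in G.Ω, avV (V (τ, x)) (fun z => z.ρ • z.u) ⬝ᵥ U τ x)
        + (∫ x in G.Ω, av (V (τ, x)) (fun z => z.ρ) * potential fl r U Θ τ x)
        + ∫ x in G.Ω, (fl.p (r τ x) (Θ τ x) + 1 / 2 * normSq (H τ x)) := by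
  have i4 := (IsAverage.of_continuous (G := G) (V := V)
    (h.regular.pressure_isC1 h.p_reg).continuous).integrable
  filter_upwards [ae_integrable_slice h.isAverage_ballistic.integrable,
    ae_integrable_slice h.isAverage_momentum.integrable,
    ae_integrable_slice h.isAverage_potential.integrable, ae_integrable_slice i4]
    with τ h1 h2 h3 h4
  exact (integral_add ((h1.sub h2).add h3) h4).trans (congrArg (· + _)
    ((integral_add (h1.sub h2) h3).trans (congrArg (· + _) (integral_sub h1 h2))))

/-- The averages of the integrand of the relative energy inequality, and its integrals in terms of
those of the test identities. -/
theorem exists_isAverage_raw (h : Comparison G bd fl ρ₀ u₀ θ₀ B₀ r U Θ H V V₀ RM RB DT DB) :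
    ∃ f, IsAverage V (volume.restrict (G.cyl G.T)) f
        (fun q z => (strongPoint fl r U Θ H q.1 q.2).raw fl z) ∧
      ∀ τ ∈ Ioo 0 G.T, ∫ q in G.cyl τ, f q =
        -(∫ q in G.cyl τ, (av (V q) fl.entropyObs * dt Θ q.1 q.2
            + avV (V q) fl.entropyFluxObs ⬝ᵥ grad (Θ q.1) q.2))
        - (∫ q in G.cyl τ, (avV (V q) (fun z => z.B) ⬝ᵥ dtV H q.1 q.2
            - avV (V q) fl.inductionObs ⬝ᵥ curl (H q.1) q.2))
        - (∫ q in G.cyl τ, av (V q) fl.productionObs * Θ q.1 q.2)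
        - (∫ q in G.cyl τ, (avV (V q) (fun z => z.ρ • z.u) ⬝ᵥ dtV U q.1 q.2
            - frob (avM (V q) fl.stressObs) (jac (U q.1) q.2)))
        - (∫ q in G.cyl τ, (frob (avM (V q) convObs) (jac (U q.1) q.2)
            + av (V q) fl.pressureObs * dvg (U q.1) q.2))
        + (∫ q in G.cyl τ, (av (V q) (fun z => z.ρ) * dt (potential fl r U Θ) q.1 q.2
            + avV (V q) (fun z => z.ρ • z.u) ⬝ᵥ grad (potential fl r U Θ q.1) q.2))
        + ((∫ x in G.Ω, (fl.p (r τ x) (Θ τ x) + 1 / 2 * normSq (H τ x)))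
          - ∫ x in G.Ω, (fl.p (r 0 x) (Θ 0 x) + 1 / 2 * normSq (H 0 x))) := by
  have hR := h.regular
  have hV := h.dmv
  have cΘ := hR.Θ_reg.1
  have cφ := hR.potential_isC1 (fl := fl) h.p_reg h.e_reg h.s_reg
  have cp := hR.pressure_isC1 (fl := fl) h.p_reg
  have cS := hR.stress_isC01 (fl := fl) h.μ_reg h.η_reg
  have cψ := hR.entropyFlux_isC01 (fl := fl) h.κ_reg
  have cE := hR.electric_isC01 (fl := fl) h.ζ_reg
  have cF := hR.energyFlux_isC01 (fl := fl) h.μ_reg h.η_reg h.p_reg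
  have jU := fun i j => (hR.jacU_isC01 i j).continuous
  have a1 := (hV.int_entropy.isAverage.mul_continuous cΘ.continuous_dt).add
    (isAverage_dot (fun i => (hV.int_entropyFlux i).isAverage) (v := fun q => grad (Θ q.1) q.2)
      cΘ.continuous_pd)
  have a2 := (isAverage_dot (fun i => (hV.int_magnetic i).isAverage)
      (v := fun q => dtV H q.1 q.2) fun i => (hR.H_isC1 i).continuous_dt).sub
    (isAverage_dot (fun i => (hV.int_induction i).isAverage) (v := fun q => curl (H q.1) q.2)
      fun i => (hR.curl_isC01 i).continuous)
  have a3 := hV.int_production.isAverage.mul_continuous cΘ.continuous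
  have a4 := (isAverage_dot (fun i => (hV.int_momentum i).isAverage)
      (v := fun q => dtV U q.1 q.2) fun i => (hR.U_isC1 i).continuous_dt).sub
    (isAverage_frob (fun i j => (hV.int_stress i j).isAverage) (A := fun q => jac (U q.1) q.2) jU)
  have a5 := (isAverage_frob (fun i j => (hV.int_conv i j).isAverage)
      (A := fun q => jac (U q.1) q.2) jU).add
    (hV.int_pressure.isAverage.mul_continuous (a := fun q => dvg (U q.1) q.2)
      (continuous_finsetSum _ fun j _ => jU j j))
  have a6 := (hV.int_density.isAverage.mul_continuous cφ.continuous_dt).add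
    (isAverage_dot (fun i => (hV.int_momentum i).isAverage)
      (v := fun q => grad (potential fl r U Θ q.1) q.2) cφ.continuous_pd)
  have a7 := IsAverage.of_continuous (G := G) (V := V) cp.continuous_dt
  have a8 := (isAverage_dot (fun i => (hV.int_velocity i).isAverage)
      (v := fun q => dvgM (fun y => fl.stress (r q.1 y) (Θ q.1 y) (symGrad (U q.1) y)) q.2)
      (hR.continuous_divS h.μ_reg h.η_reg)).add
    (isAverage_frob (fun i j => (hV.int_Du i j).isAverage)
      (A := fun q => fl.stress (r q.1 q.2) (Θ q.1 q.2) (symGrad (U q.1) q.2))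
      fun i j => (cS i j).continuous)
  have a9 := ((hV.int_temperature.isAverage.sub
      (IsAverage.of_continuous cΘ.continuous)).average.mul_continuous
      (hR.continuous_divψ (fl := fl) h.κ_reg)).add
    (isAverage_dot (g := fun q z => z.Dθ - grad (Θ q.1) q.2)
      (fun i => ((hV.int_Dθ i).isAverage.sub
        (IsAverage.of_continuous (cΘ.continuous_pd i))).average)
      (v := fun q => (fl.κ (r q.1 q.2) (Θ q.1 q.2) / Θ q.1 q.2) • grad (Θ q.1) q.2)
      fun i => (cψ i).continuous)
  have a10 := (isAverage_dot (g := fun q z => z.B - H q.1 q.2)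
      (fun i => ((hV.int_magnetic i).isAverage.sub
        (IsAverage.of_continuous (hR.H_isC1 i).continuous)).average)
      (v := fun q => curl (fun y => fl.ζ (r q.1 y) (Θ q.1 y) • curl (H q.1) y) q.2)
      (hR.continuous_curlE h.ζ_reg)).sub
    (isAverage_dot (g := fun q z => z.CB - curl (H q.1) q.2)
      (fun i => ((hV.int_CB i).isAverage.sub
        (IsAverage.of_continuous (hR.curl_isC01 i).continuous)).average)
      (v := fun q => fl.ζ (r q.1 q.2) (Θ q.1 q.2) • curl (H q.1) q.2)
      fun i => (cE i).continuous)
  have a11 := isAverage_dot (fun i => (hV.int_magnetic i).isAverage)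
    (v := fun q => grad (fun y => H q.1 y ⬝ᵥ U q.1 y) q.2) hR.crossHelicity_isC1.continuous_pd
  have a12 := IsAverage.of_continuous (G := G) (V := V)
    (a := fun q => ∑ j, pd j (energyFlux fl r U Θ H j q.1) q.2)
    (continuous_finsetSum _ fun j _ => (cF j).continuous_pd j)
  have s2 := a1.neg.sub a2
  have s3 := s2.sub a3
  have s4 := s3.sub a4
  have s5 := s4.sub a5
  have s6 := s5.add a6
  have s7 := s6.add a7
  have s8 := s7.add a8
  have s9 := s8.add a9
  have s10 := s9.sub a10
  have s11 := s10.sub a11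
  refine ⟨_, (s11.add a12).congr (fun _ => rfl) fun q z =>
    hR.raw_eq h.gibbs h.p_reg h.e_reg h.s_reg h.μ_reg h.η_reg q.1 q.2 z, fun τ hτ => ?_⟩
  have hle := hτ.2.le
  rw [s11.setIntegral_add a12 hle, s10.setIntegral_sub a11 hle, s9.setIntegral_sub a10 hle,
    s8.setIntegral_add a9 hle, s7.setIntegral_add a8 hle, s6.setIntegral_add a7 hle,
    s5.setIntegral_add a6 hle, s4.setIntegral_sub a5 hle, s3.setIntegral_sub a4 hle,
    s2.setIntegral_sub a3 hle, a1.neg.setIntegral_sub a2 hle, integral_neg]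
  -- The pressure term is rewritten as a difference of its values at τ and 0; each of the next five
  -- integrals is zero by a test identity or by the divergence theorem.
  have z7 := cp.integral_sub_eq G hτ
  have z8 := hV.integral_velocity_eq_zero cS (fun t x =>
    StrongPoint.isSymm_stress fl (StrongPoint.isSymm_symPart _)) hle
  have z9 := hV.integral_temperature_eq_zero h.isTempTest.toIsTempExtension cψ (fun t ht x hx => by
    have := h.strong.bc_heatFlux t ht x hx
    rw [Fluid.heatFlux, neg_dotProduct, smul_dotProduct, neg_eq_zero, smul_eq_mul,
      mul_eq_zero] at this
    rw [smul_dotProduct, smul_eq_mul, div_mul_eq_mul_div, mul_eq_zero.2 this, zero_div]) hle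
  have z10 := hV.integral_magnetic_eq_zero h.isMagTest.toIsMagExtension cE (fun t ht x hx => by
    rw [map_smul, LinearMap.smul_apply, h.strong.bc_curl t ht x hx, smul_zero]) hle
  have z11 := hV.integral_solenoidal_eq_zero hR.crossHelicity_isC1.isC01 (fun t ht x hx => by
    rw [h.strong.bc_velocity t ht x hx, dotProduct_zero]) hle
  have z12 := integral_divergence_eq_zero G cF (fun t ht x hx j => by
    simp [energyFlux, h.strong.bc_velocity t ht x hx]) hle
  have key : ∀ {i i₈ i₉ i₁₀ i₁₁ i₁₂ : ℝ}, i₈ = 0 → i₉ = 0 → i₁₀ = 0 → i₁₁ = 0 → i₁₂ = 0 →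
      i + i₈ + i₉ - i₁₀ - i₁₁ + i₁₂ = i := by
    intro i i₈ i₉ i₁₀ i₁₁ i₁₂ h8 h9 h10 h11 h12
    linarith
  rw [z7]
  exact key z8 z9 z10 z11 z12

/-- The relative energy inequality. -/
theorem exists_relEnergy_inequality
    (h : Comparison G bd fl ρ₀ u₀ θ₀ B₀ r U Θ H V V₀ RM RB DT DB) :
    ∃ (e f : ℝ × V3 → ℝ) (c : ℝ),
      IsAverage V (volume.restrict (G.cyl G.T)) e
        (fun q z => (strongPoint fl r U Θ H q.1 q.2).relEnergy fl z) ∧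
      IsAverage V (volume.restrict (G.cyl G.T)) f
        (fun q z => (strongPoint fl r U Θ H q.1 q.2).raw fl z) ∧
      ∀ᵐ τ ∂volume.restrict (Ioo 0 G.T), (∫ x in G.Ω, e (τ, x)) + (DT Θ τ + DB H τ)
        ≤ (∫ q in G.cyl τ, f q) + c * ∫ t in Ioo 0 τ, (DT Θ t + DB H t) := by
  obtain ⟨f, hf, hf'⟩ := h.exists_isAverage_raw
  obtain ⟨c, hc⟩ := h.exists_defect_bound
  refine ⟨_, f, c, h.isAverage_relEnergy, hf, ?_⟩
  filter_upwards [hc, h.integral_relEnergy_eq, ae_restrict_mem measurableSet_Ioo,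
    h.dmv.ballistic Θ H h.isTempTest h.isMagTest,
    h.dmv.momentum U h.regular.U_reg.1 h.strong.bc_velocity,
    h.dmv.continuity (potential fl r U Θ) (h.regular.potential_isC1 h.p_reg h.e_reg h.s_reg)]
    with τ h1 h2 hτ h3 h4 h5
  have h6 := h.initial_eq
  -- The ballistic inequality, minus the momentum equation tested with U, plus the continuity
  -- equation tested with the potential. The initial integrals cancel by `h6`, and the concentration
  -- measures, which enter with a minus sign, are bounded by `h1`.
  rw [h2, hf' τ hτ]
  linarith

end Comparison

/-! ### Measure-valued–strong uniqueness -/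

theorem eq_dirac_of_ae_eq {Z : Type*} [MeasurableSpace Z] {ν : Measure Z} [IsProbabilityMeasure ν]
    {z₀ : Z} (h : ∀ᵐ z ∂ν, z = z₀) : ν = Measure.dirac z₀ := by
  have h1 : ν.map id = ν.map fun _ => z₀ := Measure.map_congr h
  rwa [Measure.map_id, Measure.map_const, measure_univ, one_smul] at h1

theorem ae_ae_of_ae_cyl {G : Geometry} {p : ℝ × V3 → Prop}
    (h : ∀ᵐ q ∂volume.restrict (G.cyl G.T), p q) :
    ∀ᵐ t ∂volume.restrict (Ioo 0 G.T), ∀ᵐ x ∂volume.restrict G.Ω, p (t, x) := by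
  rw [Geometry.cyl, Measure.volume_eq_prod, ← Measure.prod_restrict] at h
  exact Measure.ae_ae_of_ae_prod h

theorem normSq_eq_zero {v : V3} (h : normSq v = 0) : v = 0 := by
  funext i
  have := abs_apply_le_sqrt v i
  rw [h, Real.sqrt_zero] at this
  exact abs_eq_zero.1 (le_antisymm this (abs_nonneg _))

theorem frob_self_eq_zero {A : M3} (h : frob A A = 0) : A = 0 := by
  ext i j
  have := sq_apply_le_frob A i j
  rw [h] at this
  exact pow_eq_zero_iff two_ne_zero |>.1 (le_antisymm this (sq_nonneg _))

theorem StrongPoint.diss_nonneg (P : StrongPoint) (z : Phase) : 0 ≤ P.diss z :=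
  add_nonneg (add_nonneg (frob_self_nonneg _) (normSq_nonneg _)) (normSq_nonneg _)

theorem StrongPoint.dist2_nonneg (P : StrongPoint) (z : Phase) : 0 ≤ P.dist2 z :=
  add_nonneg (add_nonneg (normSq_nonneg _) (normSq_nonneg _)) (by positivity)

theorem StrongPoint.eq_of_dist2_of_diss {P : StrongPoint} {z : Phase} (h : P.dist2 z = 0)
    (h' : P.diss z = 0) : z = (P.r, P.U, P.Θ, P.H, P.D, P.gΘ, P.Y) := by
  have n1 := normSq_nonneg (z.u - P.U)
  have n2 := normSq_nonneg (z.B - P.H)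
  have n3 := sq_nonneg (z.ρ - P.r)
  have n4 := sq_nonneg (z.θ - P.Θ)
  have n5 := frob_self_nonneg (z.Du - P.D)
  have n6 := normSq_nonneg (z.Dθ - P.gΘ)
  have n7 := normSq_nonneg (z.CB - P.Y)
  rw [dist2] at h
  rw [diss] at h'
  have e1 : z.u = P.U := sub_eq_zero.1 (normSq_eq_zero (by linarith))
  have e2 : z.B = P.H := sub_eq_zero.1 (normSq_eq_zero (by linarith))
  have e3 : z.ρ = P.r := sub_eq_zero.1 (pow_eq_zero_iff two_ne_zero |>.1 (by linarith))
  have e4 : z.θ = P.Θ := sub_eq_zero.1 (pow_eq_zero_iff two_ne_zero |>.1 (by linarith))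
  have e5 : z.Du = P.D := sub_eq_zero.1 (frob_self_eq_zero (by linarith))
  have e6 : z.Dθ = P.gΘ := sub_eq_zero.1 (normSq_eq_zero (by linarith))
  have e7 : z.CB = P.Y := sub_eq_zero.1 (normSq_eq_zero (by linarith))
  rw [← e1, ← e2, ← e3, ← e4, ← e5, ← e6, ← e7]
  rfl

theorem measurableSet_bounds (ρlo ρhi θlo θhi : ℝ) :
    MeasurableSet {z : Phase | ρlo < z.ρ ∧ z.ρ < ρhi ∧ θlo < z.θ ∧ z.θ < θhi} := by
  have hρ : Measurable Phase.ρ := measurable_fst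
  have hθ : Measurable Phase.θ := measurable_fst.comp (measurable_snd.comp measurable_snd)
  exact (measurableSet_lt measurable_const hρ).inter ((measurableSet_lt hρ measurable_const).inter
    ((measurableSet_lt measurable_const hθ).inter (measurableSet_lt hθ measurable_const)))

namespace Comparison

variable {G : Geometry} {bd : BoundaryData G} {fl : Fluid} {ρ₀ : V3 → ℝ} {u₀ : V3 → V3}
  {θ₀ : V3 → ℝ} {B₀ : V3 → V3} {r : ℝ → V3 → ℝ} {U : ℝ → V3 → V3} {Θ : ℝ → V3 → ℝ}
  {H : ℝ → V3 → V3} {V : Kernel (ℝ × V3) Phase} {V₀ : Kernel V3 Phase₀}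
  {RM RB : MatrixMeasure} {DT : (ℝ → V3 → ℝ) → ℝ → ℝ} {DB : (ℝ → V3 → V3) → ℝ → ℝ}

/-- A relative energy that is nonnegative and controls the integrand of the relative energy
inequality vanishes, and so do the averages of that integrand. -/
theorem ae_eq_zero_of_inequality (h : Comparison G bd fl ρ₀ u₀ θ₀ B₀ r U Θ H V V₀ RM RB DT DB)
    {e f : ℝ × V3 → ℝ} {c C : ℝ} (ie : Integrable e (volume.restrict (G.cyl G.T)))
    (jf : Integrable f (volume.restrict (G.cyl G.T)))
    (he : ∀ᵐ q ∂volume.restrict (G.cyl G.T), 0 ≤ e q)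
    (hf : ∀ᵐ q ∂volume.restrict (G.cyl G.T), f q ≤ C * e q)
    (hineq : ∀ᵐ τ ∂volume.restrict (Ioo 0 G.T), (∫ x in G.Ω, e (τ, x)) + (DT Θ τ + DB H τ)
        ≤ (∫ q in G.cyl τ, f q) + c * ∫ t in Ioo 0 τ, (DT Θ t + DB H t)) :
    ∀ᵐ q ∂volume.restrict (G.cyl G.T), e q = 0 ∧ f q = 0 := by
  have iD : Integrable (fun t => DT Θ t + DB H t) (volume.restrict (Ioo 0 G.T)) :=
    ((h.dmv.DT_bdd Θ h.isTempTest).integrable le_top).add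
      ((h.dmv.DB_bdd H h.isMagTest).integrable le_top)
  have iE := integrable_slice_integral ie
  have nD : ∀ᵐ t ∂volume.restrict (Ioo 0 G.T), 0 ≤ DT Θ t + DB H t := by
    filter_upwards [h.dmv.DT_nonneg Θ h.isTempTest, h.dmv.DB_nonneg H h.isMagTest] with t h1 h2
    exact add_nonneg h1 h2
  have nE : ∀ᵐ t ∂volume.restrict (Ioo 0 G.T), 0 ≤ ∫ x in G.Ω, e (t, x) := by
    filter_upwards [ae_ae_of_ae_cyl he] with t ht
    exact integral_nonneg_of_ae ht
  have hsub : ∀ τ ∈ Ioo 0 G.T, Ioo 0 τ ⊆ Ioo 0 G.T := fun τ hτ => Ioo_subset_Ioo_right hτ.2.le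
  -- Grönwall is applied to the sum of relative energy and defects; the maximum of the two constants
  -- serves both nonnegative summands.
  have hy := ae_eq_zero_of_le_integral (C := max C c) (iE.add iD)
    (by filter_upwards [nE, nD] with t h1 h2 using add_nonneg h1 h2) (by
      filter_upwards [hineq, ae_restrict_mem measurableSet_Ioo] with τ h1 hτ
      have hs := hsub τ hτ
      have k1 : ∫ q in G.cyl τ, f q ≤ C * ∫ t in Ioo 0 τ, ∫ x in G.Ω, e (t, x) := by
        have := setIntegral_prod_slices hτ.2.le ie
        rw [← this, ← integral_const_mul]
        exact integral_mono_ae (IntegrableOn.mono_set jf (G.cyl_mono hτ.2.le))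
          ((IntegrableOn.mono_set ie (G.cyl_mono hτ.2.le)).const_mul C)
          (ae_mono (Measure.restrict_mono (G.cyl_mono hτ.2.le) le_rfl) hf)
      have k2 : 0 ≤ ∫ t in Ioo 0 τ, ∫ x in G.Ω, e (t, x) :=
        integral_nonneg_of_ae (ae_mono (Measure.restrict_mono hs le_rfl) nE)
      have k3 : 0 ≤ ∫ t in Ioo 0 τ, (DT Θ t + DB H t) :=
        integral_nonneg_of_ae (ae_mono (Measure.restrict_mono hs le_rfl) nD)
      have k4 := mul_le_mul_of_nonneg_right (le_max_left C c) k2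
      have k5 := mul_le_mul_of_nonneg_right (le_max_right C c) k3
      have k6 := integral_add (IntegrableOn.mono_set iE hs) (IntegrableOn.mono_set iD hs)
      simp only [Pi.add_apply]
      rw [k6, mul_add]
      linarith)
  have hzero : ∀ᵐ t ∂volume.restrict (Ioo 0 G.T),
      (∫ x in G.Ω, e (t, x)) = 0 ∧ DT Θ t + DB H t = 0 := by
    filter_upwards [hy, nE, nD] with t h1 h2 h3
    simp only [Pi.add_apply] at h1
    exact ⟨by linarith, by linarith⟩
  have he0 : e =ᵐ[volume.restrict (G.cyl G.T)] 0 := by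
    refine (integral_eq_zero_iff_of_nonneg_ae he ie).1 ?_
    refine (setIntegral_prod_slices le_rfl ie).trans ?_
    rw [integral_congr_ae (hzero.mono fun t ht => ht.1), integral_zero]
  -- As e = 0, the bound f ≤ C e gives f ≤ 0.
  have hfle : ∀ᵐ q ∂volume.restrict (G.cyl G.T), 0 ≤ (-f) q := by
    filter_upwards [he0, hf] with q h1 h2
    rw [h1, Pi.zero_apply, mul_zero] at h2
    exact neg_nonneg.2 h2
  have hf0 : -f =ᵐ[volume.restrict (G.cyl G.T)] 0 := by
    refine (integral_eq_zero_iff_of_nonneg_ae hfle jf.neg).1 (le_antisymm ?_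
      (integral_nonneg_of_ae hfle))
    -- Conversely, with relative energy and defects equal to zero, the inequality says that the
    -- integral of f up to almost every τ is nonnegative, and then also up to T.
    have := setIntegral_nonneg_of_ae G.T_pos (integrable_slice_integral jf) (by
      filter_upwards [hineq, hzero, ae_restrict_mem measurableSet_Ioo] with τ h1 h2 hτ
      have hD : ∫ t in Ioo 0 τ, (DT Θ t + DB H t) = 0 := by
        refine integral_eq_zero_of_ae ?_
        filter_upwards [ae_restrict_of_ae_restrict_of_subset (hsub τ hτ) hzero] with t ht
        exact ht.2
      rw [h2.1, h2.2, hD, mul_zero, add_zero, add_zero] at h1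
      exact h1.trans_eq (setIntegral_prod_slices hτ.2.le jf)) (⟨G.T_pos.le, le_rfl⟩ : G.T ∈ Icc 0 G.T)
    simp only [Pi.neg_apply, integral_neg]
    exact neg_nonpos.2 (this.trans_eq (setIntegral_prod_slices le_rfl jf).symm)
  filter_upwards [he0, hf0] with q h1 h2
  exact ⟨h1, neg_eq_zero.1 h2⟩

variable [IsMarkovKernel V]

/-- The vanishing of the averaged relative energy identifies density, velocity, temperature and
magnetic field. The gradients are identified in a second pass, from the dissipation kept in the
bound for raw. -/
theorem ae_eq_dirac (h : Comparison G bd fl ρ₀ u₀ θ₀ B₀ r U Θ H V V₀ RM RB DT DB)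
    (hμ_pos : ∀ ρ θ : ℝ, 0 < ρ → 0 < θ → 0 < fl.μ ρ θ)
    (hη_nonneg : ∀ ρ θ : ℝ, 0 < ρ → 0 < θ → 0 ≤ fl.η ρ θ)
    (hκ_pos : ∀ ρ θ : ℝ, 0 < ρ → 0 < θ → 0 < fl.κ ρ θ)
    (hζ_pos : ∀ ρ θ : ℝ, 0 < ρ → 0 < θ → 0 < fl.ζ ρ θ)
    (hp_lip : LipDerivQuad fl.p) (hs_lip : LipDerivQuad fl.s)
    (hStable : fl.ThermodynamicallyStable) {ρlo ρhi θlo θhi : ℝ} (hρlo : 0 < ρlo)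
    (hθlo : 0 < θlo)
    (hbounded : ∀ᵐ q ∂volume.restrict (G.cyl G.T),
      V q {z | ρlo < z.ρ ∧ z.ρ < ρhi ∧ θlo < z.θ ∧ z.θ < θhi} = 1) :
    ∀ᵐ q ∂volume.restrict (G.cyl G.T),
      V q = Measure.dirac (r q.1 q.2, U q.1 q.2, Θ q.1 q.2, H q.1 q.2,
        symGrad (U q.1) q.2, grad (Θ q.1) q.2, curl (H q.1) q.2) := by
  have hR := h.regular
  have hK : IsCompact (Icc 0 G.T ×ˢ closure G.Ω) := isCompact_Icc.prod G.isBounded.isCompact_closure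
  obtain ⟨r₁, hr₁, hr₁'⟩ := exists_pos_lower_bound_of_compact hR.r_reg hK
    fun q _ => hR.r_pos q.1 q.2
  obtain ⟨Θ₁, hΘ₁, hΘ₁'⟩ := exists_pos_lower_bound_of_compact hR.Θ_reg.1 hK
    fun q _ => hR.Θ_pos q.1 q.2
  obtain ⟨r₂, hr₂⟩ := hK.exists_bound_of_continuousOn hR.r_reg.continuous.continuousOn
  obtain ⟨Θ₂, hΘ₂⟩ := hK.exists_bound_of_continuousOn hR.Θ_reg.1.continuous.continuousOn
  obtain ⟨N, hN, hb⟩ := hR.exists_bddBy (fl := fl) h.μ_reg h.η_reg hK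
  -- One compact rectangle is chosen to contain the support of the Young measure and the range of
  -- the strong solution; all pointwise constants refer to it.
  have ha : 0 < min ρlo r₁ := lt_min hρlo hr₁
  have hc : 0 < min θlo Θ₁ := lt_min hθlo hΘ₁
  obtain ⟨C, m, hC, hm, hraw⟩ := StrongPoint.exists_raw_bound (b := max ρhi r₂) (d := max θhi Θ₂)
    h.μ_reg h.η_reg h.κ_reg h.ζ_reg hμ_pos hη_nonneg hκ_pos hζ_pos h.p_reg h.e_reg h.s_reg
    hp_lip hs_lip h.gibbs hStable ha hc hN
  obtain ⟨m₀, hm₀, hcoer⟩ := StrongPoint.exists_relEnergy_coercive (b := max ρhi r₂)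
    (d := max θhi Θ₂) h.gibbs hStable h.p_reg h.e_reg h.s_reg ha hc
  have hgood : ∀ᵐ q ∂volume.restrict (G.cyl G.T), ∀ᵐ z ∂V q,
      m₀ * (strongPoint fl r U Θ H q.1 q.2).dist2 z
          ≤ (strongPoint fl r U Θ H q.1 q.2).relEnergy fl z ∧
      (strongPoint fl r U Θ H q.1 q.2).raw fl z
          ≤ C * (strongPoint fl r U Θ H q.1 q.2).relEnergy fl z
            - m * (strongPoint fl r U Θ H q.1 q.2).diss z := by
    filter_upwards [hbounded, h.dmv.phase, G.ae_mem_cyl G.T] with q h1 h2 hq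
    have hqK : q ∈ Icc 0 G.T ×ˢ closure G.Ω :=
      ⟨Ioo_subset_Icc_self hq.1, subset_closure hq.2⟩
    have hPbox : (r q.1 q.2, Θ q.1 q.2) ∈
        box (min ρlo r₁) (max ρhi r₂) (min θlo Θ₁) (max θhi Θ₂) :=
      ⟨⟨(min_le_right _ _).trans (hr₁' q hqK),
        ((le_abs_self _).trans (hr₂ q hqK)).trans (le_max_right _ _)⟩,
        (min_le_right _ _).trans (hΘ₁' q hqK),
        ((le_abs_self _).trans (hΘ₂ q hqK)).trans (le_max_right _ _)⟩
    filter_upwards [h2, (mem_ae_iff_prob_eq_one (measurableSet_bounds ρlo ρhi θlo θhi)).2 h1]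
      with z hz hz'
    have hzbox : (z.ρ, z.θ) ∈ box (min ρlo r₁) (max ρhi r₂) (min θlo Θ₁) (max θhi Θ₂) :=
      ⟨⟨(min_le_left _ _).trans hz'.1.le, hz'.2.1.le.trans (le_max_left _ _)⟩,
        (min_le_left _ _).trans hz'.2.2.1.le, hz'.2.2.2.le.trans (le_max_left _ _)⟩
    exact ⟨hcoer _ z hPbox hzbox,
      hraw _ z (hR.eqs h.strong h.κ_reg h.p_reg h.s_reg hq.1 hq.2) (hb q hqK) hPbox hzbox hz.2.2⟩
  obtain ⟨e, f, c, he, hf, hineq⟩ := h.exists_relEnergy_inequality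
  have hnn : ∀ᵐ q ∂volume.restrict (G.cyl G.T), ∀ᵐ z ∂V q,
      0 ≤ (strongPoint fl r U Θ H q.1 q.2).relEnergy fl z := by
    filter_upwards [hgood] with q hq
    filter_upwards [hq] with z hz
    exact (mul_nonneg hm₀.le (StrongPoint.dist2_nonneg _ z)).trans hz.1
  have hzero := h.ae_eq_zero_of_inequality (C := C) he.integrable hf.integrable
    (by
      filter_upwards [he.ae_eq, hnn] with q h1 h2
      rw [h1.2]
      exact integral_nonneg_of_ae h2)
    (by
      filter_upwards [he.ae_eq, hf.ae_eq, hgood] with q h1 h2 h3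
      rw [h1.2, h2.2, ← integral_const_mul]
      refine integral_mono_ae h2.1 (h1.1.const_mul C) ?_
      filter_upwards [h3] with z hz
      exact hz.2.trans (sub_le_self _ (mul_nonneg hm.le (StrongPoint.diss_nonneg _ z))))
    hineq
  filter_upwards [hzero, he.ae_eq, hf.ae_eq, hgood, hnn] with q h1 h2 h3 h4 h5
  have hE : ∀ᵐ z ∂V q, (strongPoint fl r U Θ H q.1 q.2).relEnergy fl z = 0 :=
    (integral_eq_zero_iff_of_nonneg_ae h5 h2.1).1 (h2.2.symm.trans h1.1)
  -- With zero relative energy, raw ≤ −m·diss ≤ 0. As its average is zero, raw vanishes almost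
  -- surely, and therefore so does diss.
  have hneg : ∀ᵐ z ∂V q, 0 ≤ -(strongPoint fl r U Θ H q.1 q.2).raw fl z := by
    filter_upwards [hE, h4] with z hz hz'
    have := mul_nonneg hm.le (StrongPoint.diss_nonneg (strongPoint fl r U Θ H q.1 q.2) z)
    rw [hz, mul_zero] at hz'
    linarith [hz'.2]
  have hraw0 := (integral_eq_zero_iff_of_nonneg_ae hneg h3.1.neg).1
    (by rw [integral_neg, ← h3.2, h1.2, neg_zero])
  refine eq_dirac_of_ae_eq ?_
  filter_upwards [hE, hraw0, h4] with z hz hz' hz4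
  have k1 := StrongPoint.dist2_nonneg (strongPoint fl r U Θ H q.1 q.2) z
  have k2 := StrongPoint.diss_nonneg (strongPoint fl r U Θ H q.1 q.2) z
  rw [Pi.zero_apply, neg_eq_zero] at hz'
  rw [hz, hz', mul_zero, zero_sub] at hz4
  have k3 : (strongPoint fl r U Θ H q.1 q.2).dist2 z = 0 :=
    le_antisymm (nonpos_of_mul_nonpos_right hz4.1 hm₀) k1
  have k4 : (strongPoint fl r U Θ H q.1 q.2).diss z = 0 :=
    le_antisymm (nonpos_of_mul_nonpos_right (neg_nonneg.1 hz4.2) hm) k2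
  exact StrongPoint.eq_of_dist2_of_diss k3 k4

end Comparison

end MHD

/-! ### The uniqueness theorem -/

theorem theorem5p1 (G : MHD.Geometry) (bd : MHD.BoundaryData G) (fl : MHD.Fluid)
    -- the coefficients
    (hμ : MHD.C1Quad fl.μ) (hη : MHD.C1Quad fl.η) (hκ : MHD.C1Quad fl.κ) (hζ : MHD.C1Quad fl.ζ)
    (hμ_pos : ∀ ρ θ : ℝ, 0 < ρ → 0 < θ → 0 < fl.μ ρ θ)
    (hη_nonneg : ∀ ρ θ : ℝ, 0 < ρ → 0 < θ → 0 ≤ fl.η ρ θ)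
    (hκ_pos : ∀ ρ θ : ℝ, 0 < ρ → 0 < θ → 0 < fl.κ ρ θ)
    (hζ_pos : ∀ ρ θ : ℝ, 0 < ρ → 0 < θ → 0 < fl.ζ ρ θ)
    -- the thermodynamic functions
    (hp : MHD.C1Quad fl.p) (he : MHD.C1Quad fl.e) (hs : MHD.C1Quad fl.s)
    (hp_lip : MHD.LipDerivQuad fl.p) (hs_lip : MHD.LipDerivQuad fl.s)
    (hGibbs : fl.Gibbs) (hStable : fl.ThermodynamicallyStable)
    -- the initial data
    (ρ₀ : MHD.V3 → ℝ) (u₀ : MHD.V3 → MHD.V3) (θ₀ : MHD.V3 → ℝ) (B₀ : MHD.V3 → MHD.V3)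
    (hinit : ∀ x ∈ G.Ω, 0 < ρ₀ x ∧ 0 < θ₀ x ∧ MHD.dvg B₀ x = 0)
    -- the strong solution
    (r : ℝ → MHD.V3 → ℝ) (U : ℝ → MHD.V3 → MHD.V3) (Θ : ℝ → MHD.V3 → ℝ)
    (H : ℝ → MHD.V3 → MHD.V3)
    (hstrong : MHD.IsStrongSolution G bd fl ρ₀ u₀ θ₀ B₀ r U Θ H)
    -- the dissipative measure-valued solution
    (V : Kernel (ℝ × MHD.V3) MHD.Phase) [IsMarkovKernel V]
    (V₀ : Kernel MHD.V3 MHD.Phase₀) [IsMarkovKernel V₀]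
    (hV : MHD.IsDMVSolution G bd fl V V₀)
    -- it is supported where density and temperature are bounded and bounded away from zero
    (ρlo ρhi θlo θhi : ℝ) (hρlo : 0 < ρlo) (hρhi : 0 < ρhi) (hθlo : 0 < θlo) (hθhi : 0 < θhi)
    (hbounded : ∀ᵐ q ∂volume.restrict (Ioo 0 G.T ×ˢ G.Ω),
      V q {z | ρlo < z.ρ ∧ z.ρ < ρhi ∧ θlo < z.θ ∧ z.θ < θhi} = 1)
    -- the initial data coincide
    (hV₀ : ∀ᵐ x ∂volume.restrict G.Ω, V₀ x = Measure.dirac (ρ₀ x, u₀ x, θ₀ x, B₀ x)) :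
    ∀ᵐ q ∂volume.restrict (Ioo 0 G.T ×ˢ G.Ω),
      V q = Measure.dirac (r q.1 q.2, U q.1 q.2, Θ q.1 q.2, H q.1 q.2,
        MHD.symGrad (U q.1) q.2, MHD.grad (Θ q.1) q.2, MHD.curl (H q.1) q.2) := by
  obtain ⟨RM, RB, DT, DB, hdmv⟩ := hV
  -- Constitutive functions are controlled only for positive arguments. A density and a temperature
  -- that are positive on all of space-time make every composition globally regular, and nothing
  -- changes inside the cylinder.
  obtain ⟨r', Θ', hstrong', hr', hΘ', heq⟩ := hstrong.exists_positive
  have hR : MHD.RegularState r' U Θ' H :=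
    ⟨hstrong'.r_reg, hstrong'.U_reg, hstrong'.Θ_reg, hstrong'.H_reg, hr', hΘ'⟩
  have hC : MHD.Comparison G bd fl ρ₀ u₀ θ₀ B₀ r' U Θ' H V V₀ RM RB DT DB :=
    ⟨hstrong', hR, hdmv, hV₀, hμ, hη, hκ, hζ, hp, he, hs, hGibbs⟩
  filter_upwards [hC.ae_eq_dirac hμ_pos hη_nonneg hκ_pos hζ_pos hp_lip hs_lip hStable hρlo hθlo
    hbounded, G.ae_mem_cyl G.T] with q hq hm
  obtain ⟨h1, h2, h3⟩ := heq q.1 hm.1 q.2 hm.2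
  rw [hq, h1, h2, h3]
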